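/- Let $M=S^1\times\mathbb R$ be the open cylinder. A $C^1$ diffeomorphism $f:M\to M$ is called Anosov if there are a continuous Riemannian metric on $M$ (not necessarily complete), a splitting $T_xM=E^s_x\oplus E^u_x$ at every $x\in M$ with $Df(E^s_x)=E^s_{f(x)}$ and $Df(E^u_x)=E^u_{f(x)}$, and constants $C>0$, $0<\lambda<1$ such that, for all $x\in M$ and all integers $n\ge 0$, $$\|D_xf^{n}v\|\le C\lambda^n\|v\|\ \text{ for } v\in E^s_x,\qquad \|D_xf^{-n}v\|\le C\lambda^n\|v\|\ \text{ for } v\in E^u_x .$$ If $f:M\to M$ is an Anosov diffeomorphism, then the set of periodic points of $f$ is not dense in $M$. -/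

import Mathlib

open scoped Manifold ContDiff

/-- The length `‖v‖ = √⟨v, v⟩` of a tangent vector with respect to a continuous Riemannian metric. -/
noncomputable def riemannianLength
    {E : Type*} [NormedAddCommGroup E] [NormedSpace ℝ E]
    {H : Type*} [TopologicalSpace H] {I : ModelWithCorners ℝ E H}
    {M : Type*} [TopologicalSpace M] [ChartedSpace H M] [IsManifold I 1 M]
    (g : Bundle.ContinuousRiemannianMetric E (fun x : M => TangentSpace I x))
    {x : M} (v : TangentSpace I x) : ℝ :=
  √(g.inner x v v)

/-- A `C^1` diffeomorphism `f` of a (possibly non-compact) manifold `M` is *Anosov* if, for some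
continuous Riemannian metric, the tangent bundle splits as a `Df`-invariant direct sum `Es ⊕ Eu`
such that, for constants `C > 0` and `0 < lam < 1` and all `n ≥ 0`,
`‖Df^n v‖ ≤ C lam^n ‖v‖` on `Es` and `‖Df^(-n) v‖ ≤ C lam^n ‖v‖` on `Eu`.
(Continuity of the splitting is a consequence of these conditions.  The metric is not required to
be complete.) -/
def IsAnosov
    {E : Type*} [NormedAddCommGroup E] [NormedSpace ℝ E]
    {H : Type*} [TopologicalSpace H] {I : ModelWithCorners ℝ E H}
    {M : Type*} [TopologicalSpace M] [ChartedSpace H M] [IsManifold I 1 M]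
    (f : M ≃ₘ^1⟮I, I⟯ M) : Prop :=
  ∃ (g : Bundle.ContinuousRiemannianMetric E (fun x : M => TangentSpace I x))
    (Es Eu : ∀ x : M, Submodule ℝ (TangentSpace I x)) (C lam : ℝ),
    0 < C ∧ 0 < lam ∧ lam < 1 ∧
    (∀ x, IsCompl (Es x) (Eu x)) ∧
    (∀ x, (Es x).map (mfderiv I I f x).toLinearMap = Es (f x)) ∧
    (∀ x, (Eu x).map (mfderiv I I f x).toLinearMap = Eu (f x)) ∧
    (∀ (n : ℕ) (x : M), ∀ v ∈ Es x,
      riemannianLength g (mfderiv I I (f^[n]) x v) ≤ C * lam ^ n * riemannianLength g v) ∧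
    (∀ (n : ℕ) (x : M), ∀ v ∈ Eu x,
      riemannianLength g (mfderiv I I (f.symm^[n]) x v) ≤ C * lam ^ n * riemannianLength g v)

open Set Filter Topology

/-! Everything is lifted to the universal covering of the cylinder by the plane `ℂ`. The stable and
unstable bundles are characterised by growth rates, so they are closed, hence continuous. Either one
of them is the whole tangent bundle, or they are two transverse line fields of the plane with
continuous angles (`trichotomy`, `exists_lineAngles`).

In the plane, curves tangent to two transverse line fields meet at most once (`no_bigon`), by a
count of angles of secants in the manner of Hopf's Umlaufsatz. Hence a point `w` that is not fixed
cannot be asymptotic to fixed points in both directions of time: `w` and `G w` would be joined by a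
stable arc and by an unstable arc, that is, by a bigon (`eq_of_heteroclinic`).

Let two periodic points of the cylinder have nearby distinct lifts `p` and `q`. A common even
iterate of the lift commutes with deck translations. Composed with one translation it is a map `G`
fixing `p`, with another it is `H = G + c` fixing `q`. Since `p` and `q` are close, the stable curve
of each meets the unstable curve of the other, at points `z` and `y`. If `c = 0`, then `y`
contradicts the absence of heteroclinic points. If `c ≠ 0`, then `H⁻ⁿ z` and `Hⁿ y` are both close
to `q` for large `n`, so a stable curve through the first meets an unstable curve through the
second; the meeting point is asymptotic under `G` to the distinct fixed points `p - n c` and `p + n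
c`, which is again impossible (`eq_of_box`). So periodic points are isolated from each other and
cannot be dense.

The line fields are merely continuous, so curves come from Peano's theorem and uniqueness of
integral curves is never used. In place of a stable manifold theorem, `exists_curve_of_tendsto` puts
the points asymptotic to a fixed point on a tangent curve by a cone argument. The metric may be
incomplete, so lengths are compared with Euclidean ones only near a limit point. -/

/-! ### Continuous angles and angles of secants. -/

/-- A continuous nonvanishing function on a convex set has a continuous angle. -/
lemma exists_angle {E : Type*} [NormedAddCommGroup E] [NormedSpace ℝ E] {S : Set E}
    (hS : Convex ℝ S) {m : E → ℂ} (hm : ContinuousOn m S) (h0 : ∀ x ∈ S, m x ≠ 0) :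
    ∃ L : E → ℝ, ContinuousOn L S ∧ ∀ x ∈ S, m x = ‖m x‖ * Complex.exp (L x * Complex.I) := by
  classical
  rcases S.eq_empty_or_nonempty with rfl | hne
  · exact ⟨0, by simp, by simp⟩
  have := hS.contractibleSpace hne
  -- Lifting through the covering `Circle.exp` requires a simply connected and locally path
  -- connected domain; relative balls of a convex set are convex.
  have : LocallyPathConnectedSpace S := by
    refine LocallyPathConnectedSpace.of_bases (p := fun _ r => 0 < r)
      (s := fun x r => Metric.ball x r) (fun x => Metric.nhds_basis_ball) ?_
    intro x r hr
    have : IsPathConnected (Metric.ball (x : E) r ∩ S) :=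
      ((convex_ball _ _).inter hS).isPathConnected ⟨x, Metric.mem_ball_self hr, x.2⟩
    have h2 : Metric.ball x r = (Subtype.val ⁻¹' (Metric.ball (x : E) r ∩ S) : Set S) := by
      ext y; simp [Subtype.dist_eq]
    rw [h2]
    refine (Topology.IsInducing.subtypeVal.isPathConnected_iff).2 ?_
    convert! this using 1
    ext y
    constructor
    · rintro ⟨z, hz, rfl⟩; exact hz
    · intro hy; exact ⟨⟨y, hy.2⟩, hy, rfl⟩
  obtain ⟨x₀, hx₀⟩ := hne
  have hcont : Continuous fun x : S => m x := continuousOn_iff_continuous_domRestrict.1 hm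
  have hunit : ∀ x : S, m x / ‖m x‖ ∈ Submonoid.unitSphere ℂ := by
    intro x
    have := norm_ne_zero_iff.2 (h0 x x.2)
    simp [Submonoid.unitSphere, this]
  let f : C(S, Circle) := ⟨fun x => (⟨m x / ‖m x‖, hunit x⟩ : Circle), by
    refine Continuous.subtype_mk ?_ _
    refine hcont.div (Complex.continuous_ofReal.comp hcont.norm) ?_
    intro x
    exact_mod_cast norm_ne_zero_iff.2 (h0 x x.2)⟩
  obtain ⟨t, ht⟩ : ∃ t, Circle.exp t = f ⟨x₀, hx₀⟩ := ⟨_, Circle.exp_arg _⟩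
  obtain ⟨F, ⟨-, hF⟩, -⟩ := Circle.isCoveringMap_exp.existsUnique_continuousMap_lifts f ⟨x₀, hx₀⟩ t ht
  refine ⟨fun x => if hx : x ∈ S then F ⟨x, hx⟩ else 0, ?_, ?_⟩
  · rw [continuousOn_iff_continuous_domRestrict]
    convert! F.continuous
    ext ⟨x, hx⟩
    simp [hx]
  · intro x hx
    have := congrFun hF ⟨x, hx⟩
    have h2 := congrArg (fun z : Circle => (z : ℂ)) this
    have h3 : (‖m x‖ : ℂ) ≠ 0 := by exact_mod_cast norm_ne_zero_iff.2 (h0 x hx)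
    simp only [Function.comp, Circle.coe_exp, f] at h2
    simp only [hx, dif_pos]
    rw [h2]
    change _ = _ * (m x / ‖m x‖)
    field_simp

/-- Two continuous angles of the same direction differ by a constant multiple of `2π`. -/
lemma angle_unique {X : Type*} [TopologicalSpace X] {S : Set X} (hS : IsPreconnected S)
    {L₁ L₂ : X → ℝ} (h₁ : ContinuousOn L₁ S) (h₂ : ContinuousOn L₂ S)
    (h : ∀ x ∈ S, Complex.exp (L₁ x * Complex.I) = Complex.exp (L₂ x * Complex.I)) :
    ∃ k : ℤ, ∀ x ∈ S, L₁ x = L₂ x + 2 * Real.pi * k := by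
  have hk : ∀ x ∈ S, ∃ k : ℤ, L₁ x = L₂ x + 2 * Real.pi * k := by
    intro x hx
    obtain ⟨n, hn⟩ := Complex.exp_eq_exp_iff_exists_int.1 (h x hx)
    refine ⟨n, ?_⟩
    have := congrArg Complex.im hn
    simp at this
    linarith
  rcases S.eq_empty_or_nonempty with rfl | ⟨x₀, hx₀⟩
  · exact ⟨0, by simp⟩
  obtain ⟨k, hk0⟩ := hk x₀ hx₀
  refine ⟨k, fun x hx => ?_⟩
  obtain ⟨j, hj⟩ := hk x hx
  have hπ := Real.pi_pos
  suffices hjk : j = k by rw [hj, hjk]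
  by_contra hne
  have hc : ContinuousOn (fun x => (L₁ x - L₂ x) / (2 * Real.pi)) S := (h₁.sub h₂).div_const _
  have hv : ∀ y ∈ S, ∀ i : ℤ, L₁ y = L₂ y + 2 * Real.pi * i →
      (L₁ y - L₂ y) / (2 * Real.pi) = i := by
    intro y _ i hi; rw [hi]; field_simp; ring
  have hI := (hS.image _ hc).ordConnected
  -- The normalised difference is continuous with integer values. If it took two of them, it would
  -- also take a half-integer in between.
  have key : ∀ a b : ℤ, a < b → (a : ℝ) ∈ (fun x => (L₁ x - L₂ x) / (2 * Real.pi)) '' S →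
      (b : ℝ) ∈ (fun x => (L₁ x - L₂ x) / (2 * Real.pi)) '' S → False := by
    intro a b hab ha hb
    have hab' : (a : ℝ) + 1 ≤ b := by exact_mod_cast hab
    obtain ⟨y, hy, hy2⟩ := hI.out ha hb (show (a : ℝ) + 1/2 ∈ Icc (a : ℝ) b from
      ⟨by linarith, by linarith⟩)
    obtain ⟨i, hi⟩ := hk y hy
    have := hv y hy i hi
    simp only at hy2
    rw [this] at hy2
    have h3 : (2 * i : ℝ) = 2 * a + 1 := by linarith
    have h4 : 2 * i = 2 * a + 1 := by exact_mod_cast h3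
    omega
  have m1 : (j : ℝ) ∈ (fun x => (L₁ x - L₂ x) / (2 * Real.pi)) '' S := ⟨x, hx, hv x hx j hj⟩
  have m2 : (k : ℝ) ∈ (fun x => (L₁ x - L₂ x) / (2 * Real.pi)) '' S := ⟨x₀, hx₀, hv x₀ hx₀ k hk0⟩
  rcases lt_or_gt_of_ne hne with h | h
  · exact key _ _ h m1 m2
  · exact key _ _ h m2 m1

/-- An angle that stays in an open half plane varies by less than `π`. -/
lemma abs_sub_lt_pi_of_cos_pos {g : ℝ → ℝ} {κ : ℝ} (hg : ContinuousOn g (Icc 0 1))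
    (hc : ∀ u ∈ Icc (0 : ℝ) 1, 0 < Real.cos (g u - κ)) : |g 1 - g 0| < Real.pi := by
  by_contra hcon
  push Not at hcon
  have hπ := Real.pi_pos
  have hIVT := intermediate_value_uIcc (a := (0:ℝ)) (b := 1) (f := g)
    (by rwa [uIcc_of_le zero_le_one])
  rw [uIcc_of_le (zero_le_one' ℝ)] at hIVT
  -- Every closed interval of length at least `π` contains a zero of `cos (· - κ)`.
  have key : ∀ lo hi : ℝ, Real.pi ≤ hi - lo → ∃ k : ℤ, lo ≤ κ + Real.pi / 2 + k * Real.pi ∧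
      κ + Real.pi / 2 + k * Real.pi ≤ hi := by
    intro lo hi h
    refine ⟨⌈(lo - κ - Real.pi / 2) / Real.pi⌉, ?_, ?_⟩
    · have := Int.le_ceil ((lo - κ - Real.pi / 2) / Real.pi)
      rw [div_le_iff₀ hπ] at this
      linarith
    · have := Int.ceil_lt_add_one ((lo - κ - Real.pi / 2) / Real.pi)
      have h2 : (⌈(lo - κ - Real.pi / 2) / Real.pi⌉ : ℝ) * Real.pi
          < ((lo - κ - Real.pi / 2) / Real.pi + 1) * Real.pi := by gcongr
      rw [add_mul, div_mul_cancel₀ _ hπ.ne'] at h2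
      linarith
  have fin : ∀ k : ℤ, κ + Real.pi / 2 + k * Real.pi ∈ uIcc (g 0) (g 1) → False := by
    intro k hk
    obtain ⟨u, hu, hu2⟩ := hIVT hk
    have := hc u hu
    rw [hu2, show κ + Real.pi / 2 + k * Real.pi - κ = Real.pi / 2 + k * Real.pi by ring,
      Real.cos_add_int_mul_pi] at this
    simp at this
  rcases le_total (g 0) (g 1) with h | h
  · rw [abs_of_nonneg (by linarith)] at hcon
    obtain ⟨k, h1, h2⟩ := key _ _ hcon
    exact fin k (by rw [uIcc_of_le h]; exact ⟨h1, h2⟩)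
  · rw [abs_of_nonpos (by linarith)] at hcon
    obtain ⟨k, h1, h2⟩ := key (g 1) (g 0) (by linarith)
    exact fin k (by rw [uIcc_of_ge h]; exact ⟨h1, h2⟩)

/-- The angle of the secants of a curve that is positively tangent to the direction field `θ`,
extended to the diagonal by the angle of the tangent. -/
lemma exists_secant_angle {θ : ℂ → ℝ} (hθ : Continuous θ) {α : ℝ → ℂ} {a : ℝ → ℝ}
    (ha : Continuous a) (hpos : ∀ t, 0 < a t)
    (hα : ∀ t, HasDerivAt α (a t * Complex.exp (θ (α t) * Complex.I)) t)
    (hinj : InjOn α (Icc 0 1)) :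
    ∃ A : ℝ × ℝ → ℝ, ContinuousOn A (Icc 0 1 ×ˢ Icc 0 1) ∧
      (∀ t ∈ Icc (0 : ℝ) 1, A (t, t) = θ (α t)) ∧
      ∀ s ∈ Icc (0 : ℝ) 1, ∀ t ∈ Icc (0 : ℝ) 1, s < t →
        ∃ r : ℝ, 0 < r ∧ α t - α s = r * Complex.exp (A (s, t) * Complex.I) := by
  have hαc : Continuous α := continuous_iff_continuousAt.2 fun t => (hα t).continuousAt
  set d : ℝ → ℂ := fun t => a t * Complex.exp (θ (α t) * Complex.I) with hd
  have hdc : Continuous d := by fun_prop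
  -- The mean velocity between `s` and `t` is the secant divided by `t - s`, and it is continuous
  -- across the diagonal. It has no zero: off the diagonal by injectivity, on it because the speed
  -- is positive.
  let S : ℝ × ℝ → ℂ := fun p => ∫ r in (0:ℝ)..1, d (p.1 + r * (p.2 - p.1))
  have hSc : Continuous S := by
    apply intervalIntegral.continuous_parametric_intervalIntegral_of_continuous'
    fun_prop
  have hSeq : ∀ s t : ℝ, α t - α s = (t - s : ℝ) * S (s, t) := by
    intro s t
    have h1 : ∀ r ∈ uIcc (0:ℝ) 1, HasDerivAt (fun r => α (s + r * (t - s)))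
        ((t - s : ℝ) * d (s + r * (t - s))) r := by
      intro r _
      have h2 : HasDerivAt (fun r : ℝ => s + r * (t - s)) (t - s) r := by
        simpa using ((hasDerivAt_id r).mul_const (t - s)).const_add s
      have := (hα (s + r * (t - s))).scomp r h2
      simpa [Function.comp_def] using this
    have h3 := intervalIntegral.integral_eq_sub_of_hasDerivAt h1
      (Continuous.intervalIntegrable (by fun_prop) _ _)
    rw [intervalIntegral.integral_const_mul] at h3
    simp only [S]
    rw [h3]; simp
  have hSdiag : ∀ t, S (t, t) = d t := by
    intro t; simp [S]
  have hS0 : ∀ p ∈ (Icc 0 1 ×ˢ Icc 0 1 : Set (ℝ × ℝ)), S p ≠ 0 := by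
    rintro ⟨s, t⟩ ⟨hs, ht⟩ h0
    simp only at hs ht
    have h1 := hSeq s t
    rw [h0, mul_zero, sub_eq_zero] at h1
    have h2 := hinj ht hs h1
    subst h2
    rw [hSdiag] at h0
    simp [hd, (hpos t).ne'] at h0
  obtain ⟨A, hAc, hA⟩ := exists_angle ((convex_Icc (0:ℝ) 1).prod (convex_Icc (0:ℝ) 1))
    hSc.continuousOn hS0
  have hdiag : ContinuousOn (fun t : ℝ => A (t, t)) (Icc 0 1) :=
    hAc.comp (by fun_prop) (fun t ht => ⟨ht, ht⟩)
  have hexp : ∀ t ∈ Icc (0:ℝ) 1, Complex.exp (A (t, t) * Complex.I)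
      = Complex.exp (θ (α t) * Complex.I) := by
    intro t ht
    have h1 := hA (t, t) ⟨ht, ht⟩
    rw [hSdiag] at h1
    have h2 : ‖d t‖ = a t := by
      simp [hd, Complex.norm_exp_ofReal_mul_I, abs_of_pos (hpos t)]
    rw [h2] at h1
    have h3 : (a t : ℂ) ≠ 0 := by exact_mod_cast (hpos t).ne'
    exact (mul_left_cancel₀ h3 h1).symm
  obtain ⟨k, hk⟩ := angle_unique isPreconnected_Icc hdiag
    ((hθ.comp hαc).continuousOn) hexp
  refine ⟨fun p => A p - 2 * Real.pi * k, hAc.sub continuousOn_const, ?_, ?_⟩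
  · intro t ht; simp [hk t ht]
  · intro s hs t ht hst
    refine ⟨(t - s) * ‖S (s, t)‖, mul_pos (by linarith) (norm_pos_iff.2 (hS0 _ ⟨hs, ht⟩)), ?_⟩
    rw [hSeq, hA (s, t) ⟨hs, ht⟩]
    have : Complex.exp (((A (s, t) - 2 * Real.pi * k : ℝ) : ℂ) * Complex.I)
        = Complex.exp (A (s, t) * Complex.I) := by
      rw [Complex.exp_eq_exp_iff_exists_int]
      exact ⟨-k, by push_cast; ring⟩
    rw [this]
    push_cast
    simp
    ring

/-- Comparison of angles around a corner: if `L` is a continuous angle of `γ t - δ s` near the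
origin of the quadrant, the angles along the two axes differ by at most `π`. -/
lemma abs_angle_sub_le_pi_of_corner {γ δ : ℝ → ℂ} {g d ψ₁ ψ₂ : ℝ} (hg : 0 < g) (hd : 0 < d)
    (h0 : γ 0 = δ 0) (hγ : HasDerivAt γ (g * Complex.exp (ψ₁ * Complex.I)) 0)
    (hδ : HasDerivAt δ (d * Complex.exp (ψ₂ * Complex.I)) 0)
    (hne : Real.cos (ψ₁ - ψ₂) < 1) {L : ℝ × ℝ → ℝ}
    (hL : ContinuousOn L ((Icc 0 1 ×ˢ Icc 0 1) \ {(0, 0), (1, 1)}))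
    (hm : ∀ p ∈ ((Icc 0 1 ×ˢ Icc 0 1) \ {(0, 0), (1, 1)} : Set (ℝ × ℝ)),
      γ p.2 - δ p.1 = ‖γ p.2 - δ p.1‖ * Complex.exp (L p * Complex.I))
    {l₁ l₂ : ℝ} (h₁ : Tendsto (fun t => L (0, t)) (𝓝[>] 0) (𝓝 l₁))
    (h₂ : Tendsto (fun t => L (t, 0)) (𝓝[>] 0) (𝓝 l₂)) : |l₁ - l₂| ≤ Real.pi := by
  -- In the direction `ν`, nonzero by `hne`, `γ` starts by increasing and `δ` by decreasing. Hence
  -- `γ t - δ s` stays in an open half plane near the corner, and its angle varies by less than `π`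
  -- along the segment from `(t, 0)` to `(0, t)`.
  set ν : ℂ := Complex.exp (ψ₁ * Complex.I) - Complex.exp (ψ₂ * Complex.I) with hν
  let f : ℂ → ℝ := fun z => z.re * ν.re + z.im * ν.im
  have hfγ : 0 < f (g * Complex.exp (ψ₁ * Complex.I)) := by
    have : f (g * Complex.exp (ψ₁ * Complex.I)) = g * (1 - Real.cos (ψ₁ - ψ₂)) := by
      simp [f, hν, Complex.exp_ofReal_mul_I_re, Complex.exp_ofReal_mul_I_im]
      rw [Real.cos_sub]
      linear_combination g * Real.sin_sq_add_cos_sq ψ₁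
    rw [this]; exact mul_pos hg (by linarith)
  have hfδ : f (d * Complex.exp (ψ₂ * Complex.I)) < 0 := by
    have : f (d * Complex.exp (ψ₂ * Complex.I)) = d * (Real.cos (ψ₁ - ψ₂) - 1) := by
      simp [f, hν, Complex.exp_ofReal_mul_I_re, Complex.exp_ofReal_mul_I_im]
      rw [Real.cos_sub]
      linear_combination -d * Real.sin_sq_add_cos_sq ψ₂
    rw [this]; exact mul_neg_of_pos_of_neg hd (by linarith)
  have hfd : ∀ {c : ℝ → ℂ} {v : ℂ}, HasDerivAt c v 0 → HasDerivAt (fun t => f (c t)) (f v) 0 := by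
    intro c v hc
    have hre : HasDerivAt (fun t => (c t).re) v.re 0 := 
      Complex.reCLM.hasFDerivAt.comp_hasDerivAt (0:ℝ) hc
    have him : HasDerivAt (fun t => (c t).im) v.im 0 := 
      Complex.imCLM.hasFDerivAt.comp_hasDerivAt (0:ℝ) hc
    exact (hre.mul_const _).add (him.mul_const _)
  have hpos : ∀ {h : ℝ → ℝ} {v : ℝ}, HasDerivAt h v 0 → 0 < v → ∀ᶠ t in 𝓝[>] (0:ℝ), h 0 < h t := by
    intro h v hh hv
    have h1 := (hasDerivAt_iff_tendsto_slope.1 hh).eventually (lt_mem_nhds hv)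
    have h2 : ∀ᶠ t in 𝓝[>] (0:ℝ), 0 < slope h 0 t :=
      h1.filter_mono (nhdsWithin_mono _ (by intro x hx; simp at hx ⊢; exact hx.ne'))
    filter_upwards [h2, self_mem_nhdsWithin] with t ht ht0
    rw [slope_def_field] at ht
    have ht0' : (0:ℝ) < t := ht0
    rw [sub_zero, div_pos_iff_of_pos_right ht0'] at ht
    linarith
  have e1 := hpos (hfd hγ) hfγ
  have e2 := hpos (hfd hδ).fun_neg (by simpa using hfδ : (0:ℝ) < -f _)
  obtain ⟨ε, hε, he⟩ := (mem_nhdsGT_iff_exists_Ioo_subset).1 (inter_mem e1 e2)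
  have hε0 : (0:ℝ) < ε := hε
  have hmain : ∀ᶠ t in 𝓝[>] (0:ℝ), |L (0, t) - L (t, 0)| ≤ Real.pi := by
    filter_upwards [Ioo_mem_nhdsGT (show (0:ℝ) < min ε 1 by positivity)] with t ht
    obtain ⟨ht0, ht1⟩ := ht
    have htε : t < ε := ht1.trans_le (min_le_left _ _)
    have ht1' : t < 1 := ht1.trans_le (min_le_right _ _)
    have hmem : ∀ u ∈ Icc (0:ℝ) 1, ((1 - u) * t, u * t) ∈
        ((Icc 0 1 ×ˢ Icc 0 1) \ {(0, 0), (1, 1)} : Set (ℝ × ℝ)) := by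
      rintro u ⟨hu0, hu1⟩
      refine ⟨⟨⟨by nlinarith, by nlinarith⟩, ⟨by nlinarith, by nlinarith⟩⟩, ?_⟩
      simp only [mem_insert_iff, mem_singleton_iff, Prod.mk.injEq, not_or, not_and]
      constructor
      · intro h1 h2; nlinarith
      · intro h1 h2; nlinarith
    have := abs_sub_lt_pi_of_cos_pos (g := fun u => L ((1 - u) * t, u * t)) (κ := ν.arg)
      (hL.comp (by fun_prop) hmem) ?_
    · simpa using this.le
    · intro u hu
      have h1 := hm _ (hmem u hu)
      simp only at h1
      have h2 : 0 < f (γ (u * t) - δ ((1 - u) * t)) := by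
        have h3 : f (γ 0) ≤ f (γ (u * t)) ∧ (0 < u → f (γ 0) < f (γ (u * t))) := by
          rcases hu.1.eq_or_lt with h | h
          · subst h; simp
          · have : f (γ 0) < f (γ (u * t)) :=
              (he ⟨by positivity, by nlinarith [hu.2]⟩).1
            exact ⟨this.le, fun _ => this⟩
        have h4 : f (δ ((1 - u) * t)) ≤ f (δ 0) ∧ (u < 1 → f (δ ((1 - u) * t)) < f (δ 0)) := by
          rcases hu.2.eq_or_lt with h | h
          · subst h; simp
          · have h5 : -f (δ 0) < -f (δ ((1 - u) * t)) :=
              (he ⟨mul_pos (by linarith) ht0, by nlinarith [hu.1]⟩).2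
            have h6 : f (δ ((1 - u) * t)) < f (δ 0) := by linarith
            exact ⟨h6.le, fun _ => h6⟩
        have h5 : f (γ (u * t) - δ ((1 - u) * t)) = f (γ (u * t)) - f (δ ((1 - u) * t)) := by
          simp [f]; ring
        have h6 : f (γ 0) = f (δ 0) := by rw [h0]
        rw [h5]
        rcases lt_or_ge 0 u with h | h
        · linarith [h3.2 h, h4.1]
        · linarith [h3.1, h4.2 (by linarith)]
      have h7 : ∀ (r x : ℝ), f (r * Complex.exp (x * Complex.I))
          = r * ‖ν‖ * Real.cos (x - ν.arg) := by
        intro r x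
        have e1 : ν.re = ‖ν‖ * Real.cos ν.arg := (Complex.norm_mul_cos_arg ν).symm
        have e2 : ν.im = ‖ν‖ * Real.sin ν.arg := (Complex.norm_mul_sin_arg ν).symm
        simp only [f]
        rw [e1, e2]
        simp only [Complex.re_ofReal_mul, Complex.im_ofReal_mul, Complex.exp_ofReal_mul_I_re,
          Complex.exp_ofReal_mul_I_im]
        rw [Real.cos_sub]; ring
      rw [h1, h7] at h2
      exact pos_of_mul_pos_right h2 (by positivity)
  exact le_of_tendsto (h₁.sub h₂).abs hmain

lemma angle_eq_of_pos_mul {r₁ r₂ x y : ℝ} (h₁ : 0 < r₁) (h₂ : 0 < r₂)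
    (h : (r₁ : ℂ) * Complex.exp (x * Complex.I) = r₂ * Complex.exp (y * Complex.I)) :
    Complex.exp (x * Complex.I) = Complex.exp (y * Complex.I) := by
  have h3 := congrArg norm h
  simp [Complex.norm_exp_ofReal_mul_I, abs_of_pos h₁, abs_of_pos h₂] at h3
  subst h3
  exact mul_left_cancel₀ (by exact_mod_cast h₁.ne') h

/-! ### Two transverse curves do not bound a simple bigon. -/

/-- Curves positively tangent to two transverse direction fields of the plane cannot bound a
bigon. -/
lemma no_simple_bigon {θ₁ θ₂ : ℂ → ℝ} (hθ₁ : Continuous θ₁) (hθ₂ : Continuous θ₂)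
    (hθ : ∀ z, θ₁ z < θ₂ z ∧ θ₂ z < θ₁ z + Real.pi) {α β : ℝ → ℂ} {a b : ℝ → ℝ}
    (ha : Continuous a) (hb : Continuous b) (hapos : ∀ t, 0 < a t) (hbpos : ∀ t, 0 < b t)
    (hα : ∀ t, HasDerivAt α (a t * Complex.exp (θ₁ (α t) * Complex.I)) t)
    (hβ : ∀ t, HasDerivAt β (b t * Complex.exp (θ₂ (β t) * Complex.I)) t)
    (hαi : InjOn α (Icc 0 1)) (hβi : InjOn β (Icc 0 1)) (h0 : α 0 = β 0) (h1 : α 1 = β 1)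
    (hmeet : ∀ s ∈ Icc (0 : ℝ) 1, ∀ t ∈ Icc (0 : ℝ) 1, α s = β t →
      (s = 0 ∧ t = 0) ∨ (s = 1 ∧ t = 1)) : False := by
  have hπ := Real.pi_pos
  have hαc : Continuous α := continuous_iff_continuousAt.2 fun t => (hα t).continuousAt
  have hβc : Continuous β := continuous_iff_continuousAt.2 fun t => (hβ t).continuousAt
  obtain ⟨A, hAc, hAd, hA⟩ := exists_secant_angle hθ₁ ha hapos hα hαi
  obtain ⟨B, hBc, hBd, hB⟩ := exists_secant_angle hθ₂ hb hbpos hβ hβi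
  set S : Set (ℝ × ℝ) := (Icc 0 1 ×ˢ Icc 0 1) \ {(0, 0), (1, 1)} with hS
  -- The removed corners are extreme points of the square, so convexity survives and `β t - α s` has
  -- a continuous angle.
  have hSconv : Convex ℝ S := by
    rintro ⟨x₁, x₂⟩ ⟨⟨hx₁, hx₂⟩, hx⟩ ⟨y₁, y₂⟩ ⟨⟨hy₁, hy₂⟩, hy⟩ u v hu hv huv
    refine ⟨((convex_Icc (0:ℝ) 1).prod (convex_Icc (0:ℝ) 1)) ⟨hx₁, hx₂⟩ ⟨hy₁, hy₂⟩ hu hv huv, ?_⟩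
    simp only [mem_insert_iff, mem_singleton_iff, Prod.mk.injEq, not_or, not_and, mem_Icc,
      Prod.smul_mk, smul_eq_mul, Prod.mk_add_mk] at *
    have hv' : v = 1 - u := by linarith
    subst hv'
    rcases hu.eq_or_lt with hu0 | hu0
    · subst hu0; simpa using hy
    rcases hv.eq_or_lt with hv0 | hv0
    · have : u = 1 := by linarith
      subst this; simpa using hx
    constructor
    · intro e1 e2
      have := mul_nonneg hu hx₁.1
      have := mul_nonneg hu hx₂.1
      have := mul_nonneg hv hy₁.1
      have := mul_nonneg hv hy₂.1
      have z1 : x₁ = 0 := by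
        have : u * x₁ = 0 := by linarith
        exact (mul_eq_zero.1 this).resolve_left hu0.ne'
      have z2 : x₂ = 0 := by
        have : u * x₂ = 0 := by linarith
        exact (mul_eq_zero.1 this).resolve_left hu0.ne'
      exact hx.1 z1 z2
    · intro e1 e2
      have := mul_nonneg hu (sub_nonneg.2 hx₁.2)
      have := mul_nonneg hu (sub_nonneg.2 hx₂.2)
      have := mul_nonneg hv (sub_nonneg.2 hy₁.2)
      have := mul_nonneg hv (sub_nonneg.2 hy₂.2)
      have z1 : 1 - x₁ = 0 := by
        have : u * (1 - x₁) = 0 := by linarith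
        exact (mul_eq_zero.1 this).resolve_left hu0.ne'
      have z2 : 1 - x₂ = 0 := by
        have : u * (1 - x₂) = 0 := by linarith
        exact (mul_eq_zero.1 this).resolve_left hu0.ne'
      exact hx.2 (by linarith) (by linarith)
  obtain ⟨L, hLc, hL⟩ := exists_angle (m := fun p : ℝ × ℝ => β p.2 - α p.1) hSconv
    (by fun_prop) (by
      rintro ⟨s, t⟩ ⟨⟨hs, ht⟩, hn⟩ h
      have := hmeet s hs t ht (sub_eq_zero.1 h).symm
      simp only [mem_insert_iff, mem_singleton_iff, Prod.mk.injEq] at hn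
      exact hn this)
  have hLpos : ∀ p ∈ S, 0 < ‖β p.2 - α p.1‖ := by
    rintro ⟨s, t⟩ ⟨⟨hs, ht⟩, hn⟩
    refine norm_pos_iff.2 fun h => ?_
    have := hmeet s hs t ht (sub_eq_zero.1 h).symm
    simp only [mem_insert_iff, mem_singleton_iff, Prod.mk.injEq] at hn
    exact hn this
  have hπexp : ∀ x : ℝ, Complex.exp (((x + Real.pi : ℝ) : ℂ) * Complex.I)
      = - Complex.exp (x * Complex.I) := by
    intro x; push_cast; rw [add_mul, Complex.exp_add, Complex.exp_pi_mul_I]; ring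
  -- the four edges
  have edge : ∀ (I : Set ℝ) (e f : ℝ → ℝ × ℝ) (Q : ℝ × ℝ → ℝ) (c : ℝ), IsPreconnected I →
      Continuous e → Continuous f → MapsTo e I S → MapsTo f I (Icc 0 1 ×ˢ Icc 0 1) →
      ContinuousOn Q (Icc 0 1 ×ˢ Icc 0 1) →
      (∀ u ∈ I, ∃ r : ℝ, 0 < r ∧ β (e u).2 - α (e u).1
        = r * Complex.exp ((Q (f u) + c : ℝ) * Complex.I)) →
      ∃ k : ℤ, ∀ u ∈ I, L (e u) = Q (f u) + c + 2 * Real.pi * k := by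
    intro I e f Q c hI he hf hem hfm hQ h
    refine angle_unique hI (hLc.comp he.continuousOn hem)
      ((hQ.comp hf.continuousOn hfm).add continuousOn_const) ?_
    intro u hu
    obtain ⟨r, hr, hr2⟩ := h u hu
    have := hL _ (hem hu)
    rw [this] at hr2
    exact angle_eq_of_pos_mul (hLpos _ (hem hu)) hr hr2
  have i01 : ∀ {u : ℝ}, u ∈ Ioc (0:ℝ) 1 → u ∈ Icc (0:ℝ) 1 := fun h => ⟨h.1.le, h.2⟩
  have i10 : ∀ {u : ℝ}, u ∈ Ico (0:ℝ) 1 → u ∈ Icc (0:ℝ) 1 := fun h => ⟨h.1, h.2.le⟩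
  have z0 : (0:ℝ) ∈ Icc (0:ℝ) 1 := by simp
  have z1 : (1:ℝ) ∈ Icc (0:ℝ) 1 := by simp
  -- On the sides `s = 0` and `t = 1`, `β t - α s` is a forward secant of one of the curves. On the
  -- sides `t = 0` and `s = 1` it is a reversed secant, whence the extra `π`.
  obtain ⟨k₁, E₁⟩ := edge (Ioc 0 1) (fun t => (0, t)) (fun t => (0, t)) B 0 isPreconnected_Ioc
    (by fun_prop) (by fun_prop)
    (fun t ht => ⟨⟨z0, i01 ht⟩, by simp [ht.1.ne']⟩) (fun t ht => ⟨z0, i01 ht⟩) hBc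
    (fun t ht => by
      obtain ⟨r, hr, h⟩ := hB 0 z0 t (i01 ht) ht.1
      exact ⟨r, hr, by simp only [add_zero]; rw [← h, h0]⟩)
  obtain ⟨k₂, E₂⟩ := edge (Ioc 0 1) (fun s => (s, 0)) (fun s => (0, s)) A Real.pi
    isPreconnected_Ioc (by fun_prop) (by fun_prop)
    (fun t ht => ⟨⟨i01 ht, z0⟩, by simp [ht.1.ne']⟩) (fun t ht => ⟨z0, i01 ht⟩) hAc
    (fun t ht => by
      obtain ⟨r, hr, h⟩ := hA 0 z0 t (i01 ht) ht.1
      exact ⟨r, hr, by rw [hπexp, mul_neg, ← h, h0]; ring⟩)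
  obtain ⟨k₃, E₃⟩ := edge (Ico 0 1) (fun s => (s, 1)) (fun s => (s, 1)) A 0 isPreconnected_Ico
    (by fun_prop) (by fun_prop)
    (fun t ht => ⟨⟨i10 ht, z1⟩, by simp [ht.2.ne]⟩) (fun t ht => ⟨i10 ht, z1⟩) hAc
    (fun t ht => by
      obtain ⟨r, hr, h⟩ := hA t (i10 ht) 1 z1 ht.2
      exact ⟨r, hr, by simp only [add_zero]; rw [← h, h1]⟩)
  obtain ⟨k₄, E₄⟩ := edge (Ico 0 1) (fun t => (1, t)) (fun t => (t, 1)) B Real.pi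
    isPreconnected_Ico (by fun_prop) (by fun_prop)
    (fun t ht => ⟨⟨z1, i10 ht⟩, by simp [ht.2.ne]⟩) (fun t ht => ⟨i10 ht, z1⟩) hBc
    (fun t ht => by
      obtain ⟨r, hr, h⟩ := hB t (i10 ht) 1 z1 ht.2
      exact ⟨r, hr, by rw [hπexp, mul_neg, ← h, h1]; ring⟩)
  have hcos : ∀ z, Real.cos (θ₂ z - θ₁ z) < 1 := by
    intro z
    rw [← Real.cos_zero]
    exact Real.cos_lt_cos_of_nonneg_of_le_pi le_rfl (by linarith [(hθ z).2]) (by linarith [(hθ z).1])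
  -- limits along the edges
  have lim0 : ∀ Q : ℝ × ℝ → ℝ, ContinuousOn Q (Icc 0 1 ×ˢ Icc 0 1) →
      Tendsto (fun t => Q (0, t)) (𝓝[>] 0) (𝓝 (Q (0, 0))) := by
    intro Q hQ
    have : ContinuousWithinAt (fun t : ℝ => Q (0, t)) (Icc 0 1) 0 :=
      (hQ.comp (f := fun t : ℝ => ((0:ℝ), t)) (by fun_prop) (fun t ht => ⟨z0, ht⟩)) 0 z0
    exact this.mono_left (by
      rw [← nhdsWithin_Ioc_eq_nhdsGT (zero_lt_one' ℝ)]
      exact nhdsWithin_mono _ Ioc_subset_Icc_self)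
  have lim1 : ∀ Q : ℝ × ℝ → ℝ, ContinuousOn Q (Icc 0 1 ×ˢ Icc 0 1) →
      Tendsto (fun t => Q (1 - t, 1)) (𝓝[>] 0) (𝓝 (Q (1, 1))) := by
    intro Q hQ
    have : ContinuousWithinAt (fun t : ℝ => Q (1 - t, 1)) (Icc 0 1) 0 :=
      (hQ.comp (f := fun t : ℝ => ((1 - t:ℝ), (1:ℝ))) (by fun_prop)
        (fun t ht => ⟨⟨by linarith [ht.2], by linarith [ht.1]⟩, z1⟩)) 0 z0
    have h2 : Tendsto (fun t : ℝ => Q (1 - t, 1)) (𝓝[Icc 0 1] 0) (𝓝 (Q (1 - 0, 1))) := this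
    rw [sub_zero] at h2
    exact h2.mono_left (by
      rw [← nhdsWithin_Ioc_eq_nhdsGT (zero_lt_one' ℝ)]
      exact nhdsWithin_mono _ Ioc_subset_Icc_self)
  have ev : ∀ᶠ t in 𝓝[>] (0:ℝ), t ∈ Ioc (0:ℝ) 1 := Ioc_mem_nhdsGT zero_lt_one
  have C0 := abs_angle_sub_le_pi_of_corner (γ := β) (δ := α) (L := L) (hbpos 0) (hapos 0) h0.symm
    (hβ 0) (hα 0) (by rw [h0]; exact hcos _) hLc hL
    (l₁ := B (0, 0) + 0 + 2 * Real.pi * k₁) (l₂ := A (0, 0) + Real.pi + 2 * Real.pi * k₂)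
    (by
      refine (((lim0 B hBc).add_const 0).add_const (2 * Real.pi * k₁)).congr' ?_
      filter_upwards [ev] with t ht using (E₁ t ht).symm)
    (by
      refine (((lim0 A hAc).add_const Real.pi).add_const (2 * Real.pi * k₂)).congr' ?_
      filter_upwards [ev] with t ht using (E₂ t ht).symm)
  have hrev : ∀ {c : ℝ → ℂ} {v : ℂ}, HasDerivAt c v 1 →
      HasDerivAt (fun t : ℝ => -c (1 - t)) v 0 := by
    intro c v hc
    have h2 : HasDerivAt (fun t : ℝ => 1 - t) (-1) 0 := by
      simpa using (hasDerivAt_id (0:ℝ)).const_sub 1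
    have h3 : HasDerivAt c v (1 - 0) := by simpa using hc
    simpa [Function.comp_def] using (h3.scomp (0:ℝ) h2).fun_neg
  have flipS : MapsTo (fun p : ℝ × ℝ => (1 - p.1, 1 - p.2)) S S := by
    rintro ⟨s, t⟩ ⟨⟨hs, ht⟩, hn⟩
    refine ⟨⟨⟨by linarith [hs.2], by linarith [hs.1]⟩, ⟨by linarith [ht.2], by linarith [ht.1]⟩⟩, ?_⟩
    simp only [mem_insert_iff, mem_singleton_iff, Prod.mk.injEq, not_or, not_and] at *
    constructor
    · intro e1 e2; exact hn.2 (by linarith) (by linarith)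
    · intro e1 e2; exact hn.1 (by linarith) (by linarith)
  -- The corner `(1, 1)` is brought to the origin by reversing time. The sign in `-α (1 - t)` keeps
  -- the velocities positive, and the two curves exchange their roles.
  have C1 := abs_angle_sub_le_pi_of_corner (γ := fun t => -α (1 - t)) (δ := fun t => -β (1 - t))
    (L := fun p => L (1 - p.2, 1 - p.1)) (hapos 1) (hbpos 1)
    (by simp [h1]) (hrev (hα 1)) (hrev (hβ 1))
    (by rw [← Real.cos_neg, neg_sub, ← h1]; exact hcos _)
    (hLc.comp (f := fun p : ℝ × ℝ => (1 - p.2, 1 - p.1)) (by fun_prop) (by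
      rintro ⟨s, t⟩ ⟨⟨hs, ht⟩, hn⟩
      refine flipS (x := (t, s)) ⟨⟨ht, hs⟩, ?_⟩
      simp only [mem_insert_iff, mem_singleton_iff, Prod.mk.injEq, not_or, not_and] at *
      exact ⟨fun e1 e2 => hn.1 e2 e1, fun e1 e2 => hn.2 e2 e1⟩))
    (by
      rintro ⟨s, t⟩ ⟨⟨hs, ht⟩, hn⟩
      have := hL _ (flipS (x := (t, s)) ⟨⟨ht, hs⟩, by
        simp only [mem_insert_iff, mem_singleton_iff, Prod.mk.injEq, not_or, not_and] at *
        exact ⟨fun e1 e2 => hn.1 e2 e1, fun e1 e2 => hn.2 e2 e1⟩⟩)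
      simp only at this ⊢
      rw [show -α (1 - t) - -β (1 - s) = β (1 - s) - α (1 - t) by ring]
      exact this)
    (l₁ := A (1, 1) + 0 + 2 * Real.pi * k₃) (l₂ := B (1, 1) + Real.pi + 2 * Real.pi * k₄)
    (by
      refine (((lim1 A hAc).add_const 0).add_const (2 * Real.pi * k₃)).congr' ?_
      filter_upwards [ev] with t ht
      simpa using (E₃ (1 - t) ⟨by linarith [ht.2], by linarith [ht.1]⟩).symm)
    (by
      refine (((lim1 B hBc).add_const Real.pi).add_const (2 * Real.pi * k₄)).congr' ?_
      filter_upwards [ev] with t ht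
      simpa using (E₄ (1 - t) ⟨by linarith [ht.2], by linarith [ht.1]⟩).symm)
  have F₁ := E₁ 1 ⟨zero_lt_one, le_rfl⟩
  have F₂ := E₂ 1 ⟨zero_lt_one, le_rfl⟩
  have F₃ := E₃ 0 ⟨le_rfl, zero_lt_one⟩
  have F₄ := E₄ 0 ⟨le_rfl, zero_lt_one⟩
  rw [hAd 0 z0, hBd 0 z0, ← h0] at C0
  rw [hAd 1 z1, hBd 1 z1, ← h1] at C1
  rw [abs_le] at C0 C1
  have T0 := hθ (α 0)
  have T1 := hθ (α 1)
  -- As `θ₂ - θ₁` lies in `(0, π)`, the bounds at the two removed corners force `k₁ = k₂` and `k₃ =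
  -- k₄ + 1`. Comparing sides at the other two corners gives `k₁ + k₂ = k₃ + k₄`, so `2 k₁ = 2 k₄ +
  -- 1`, which parity forbids.
  have g1 : k₁ = k₂ := by
    have a1 : (k₁ : ℝ) - k₂ < 1 := by
      have : Real.pi * (2 * (k₁ - k₂ : ℝ)) < Real.pi * 2 := by linarith
      have := lt_of_mul_lt_mul_left this hπ.le
      linarith
    have a2 : -1 < (k₁ : ℝ) - k₂ := by
      have : Real.pi * (-2) < Real.pi * (2 * (k₁ - k₂ : ℝ)) := by linarith
      have := lt_of_mul_lt_mul_left this hπ.le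
      linarith
    have a1' : k₁ - k₂ < 1 := by exact_mod_cast a1
    have a2' : -1 < k₁ - k₂ := by exact_mod_cast a2
    omega
  have g2 : k₃ = k₄ + 1 := by
    have a1 : (k₃ : ℝ) - k₄ < 2 := by
      have : Real.pi * (2 * (k₃ - k₄ : ℝ)) < Real.pi * 4 := by linarith
      have := lt_of_mul_lt_mul_left this hπ.le
      linarith
    have a2 : 0 < (k₃ : ℝ) - k₄ := by
      have : Real.pi * 0 < Real.pi * (2 * (k₃ - k₄ : ℝ)) := by linarith
      have := lt_of_mul_lt_mul_left this hπ.le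
      linarith
    have a1' : k₃ - k₄ < 2 := by exact_mod_cast a1
    have a2' : 0 < k₃ - k₄ := by exact_mod_cast a2
    omega
  subst g1 g2
  push_cast at F₃
  have : Real.pi * (2 * (2 * (k₁ - k₄) - 1) : ℝ) = 0 := by linarith
  have : ((2 * (k₁ - k₄) - 1 : ℤ) : ℝ) = 0 := by
    push_cast
    rcases mul_eq_zero.1 this with h | h
    · exact absurd h hπ.ne'
    · linarith
  have h9 : 2 * (k₁ - k₄) - 1 = 0 := by exact_mod_cast this
  omega

/-! ### Curves tangent to a continuous direction field; Peano's theorem. -/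

/-- A `C^1` curve whose velocity is a nonvanishing multiple of the direction field `θ`. -/
def IsCurve (θ : ℂ → ℝ) (c : ℝ → ℂ) : Prop :=
  ∃ h : ℝ → ℝ, Continuous h ∧ (∀ t, h t ≠ 0) ∧
    ∀ t, HasDerivAt c (h t * Complex.exp (θ (c t) * Complex.I)) t

lemma IsCurve.continuous {θ : ℂ → ℝ} {c : ℝ → ℂ} (hc : IsCurve θ c) : Continuous c := by
  obtain ⟨h, -, -, hd⟩ := hc
  exact continuous_iff_continuousAt.2 fun t => (hd t).continuousAt

lemma IsCurve.comp_affine {θ : ℂ → ℝ} {c : ℝ → ℂ} (hc : IsCurve θ c) (p : ℝ) {q : ℝ}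
    (hq : q ≠ 0) : IsCurve θ (fun u => c (p + u * q)) := by
  obtain ⟨h, hh, h0, hd⟩ := hc
  refine ⟨fun u => q * h (p + u * q), by fun_prop, fun t => mul_ne_zero hq (h0 _), fun t => ?_⟩
  have h2 : HasDerivAt (fun u : ℝ => p + u * q) q t := by
    simpa using ((hasDerivAt_id t).mul_const q).const_add p
  have := (hd (p + t * q)).scomp t h2
  simpa [Function.comp_def, mul_assoc] using this

/-- Each step contributes an error of at most `ε / N`, and the errors add up. The case `j = k` is a
step forward in time; `j = k + 1` is a step taken backward from the later grid point. One estimate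
thus serves both directions of time. -/
lemma euler_estimate {v : ℂ → ℂ} {y : ℤ → ℂ} {N : ℝ} (hN : 0 < N)
    (hy : ∀ k, ∃ j, (j = k ∨ j = k + 1) ∧ y (k + 1) - y k = (N⁻¹ : ℝ) * v (y j)) {w : ℂ} {ε : ℝ}
    {k m : ℤ} (h : ∀ j ∈ uIcc k m, ‖v (y j) - w‖ ≤ ε) :
    ‖y m - y k - ((m - k) / N : ℝ) * w‖ ≤ |(m - k : ℝ)| / N * ε := by
  have key : ∀ k m : ℤ, k ≤ m → (∀ j, k ≤ j → j ≤ m → ‖v (y j) - w‖ ≤ ε) →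
      ‖y m - y k - ((m - k) / N : ℝ) * w‖ ≤ (m - k : ℝ) / N * ε := by
    intro k m hkm
    induction m, hkm using Int.leInduction with
    | base => intro _; simp
    | succ m hkm ih =>
      intro h
      have h1 := ih (fun j h1 h2 => h j h1 (by omega))
      obtain ⟨j, hj, hj2⟩ := hy m
      have h2 : ‖v (y j) - w‖ ≤ ε := h j (by omega) (by omega)
      have e : y (m + 1) - y k - (((m + 1 : ℤ) - k) / N : ℝ) * w
          = (y m - y k - ((m - k) / N : ℝ) * w) + (N⁻¹ : ℝ) * (v (y j) - w) := by
        rw [mul_sub, ← hj2]; push_cast; field_simp; ring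
      rw [e]
      refine (norm_add_le _ _).trans ?_
      rw [norm_mul, Complex.norm_real, Real.norm_of_nonneg (by positivity)]
      have : N⁻¹ * ‖v (y j) - w‖ ≤ N⁻¹ * ε := by gcongr
      calc _ ≤ (m - k : ℝ) / N * ε + N⁻¹ * ε := by linarith
        _ = _ := by push_cast; field_simp; ring
  rcases le_total k m with hkm | hkm
  · have : (0:ℝ) ≤ m - k := by have : (k:ℝ) ≤ m := by exact_mod_cast hkm
                               linarith
    rw [abs_of_nonneg this]
    exact key k m hkm fun j h1 h2 => h j (by rw [uIcc_of_le hkm]; exact ⟨h1, h2⟩)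
  · have : (m - k : ℝ) ≤ 0 := by have : (m:ℝ) ≤ k := by exact_mod_cast hkm
                                 linarith
    rw [abs_of_nonpos this]
    have := key m k hkm fun j h1 h2 => h j (by rw [uIcc_of_ge hkm]; exact ⟨h1, h2⟩)
    rw [← norm_neg]
    have e1 : -(y m - y k - ((m - k) / N : ℝ) * w) = y k - y m - ((k - m) / N : ℝ) * w := by
      push_cast; ring
    rw [e1, neg_sub]
    exact this

/-- Peano's theorem: a bounded continuous vector field of the plane has a global integral curve
through every point. -/
lemma exists_integral_curve {v : ℂ → ℂ} (hv : Continuous v) (hb : ∀ z, ‖v z‖ ≤ 1) (x : ℂ) :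
    ∃ c : ℝ → ℂ, c 0 = x ∧ ∀ t, HasDerivAt c (v (c t)) t := by
  have hgrid : ∀ n : ℕ, ∃ y : ℤ → ℂ, y 0 = x ∧ ∀ k, ∃ j, (j = k ∨ j = k + 1) ∧
      y (k + 1) - y k = (((n : ℝ) + 1)⁻¹ : ℝ) * v (y j) := by
    intro n
    set s : ℂ := ((((n : ℝ) + 1)⁻¹ : ℝ) : ℂ) with hs
    let y : ℤ → ℂ := fun k => if 0 ≤ k then (fun z => z + s * v z)^[k.toNat] x
      else (fun z => z - s * v z)^[(-k).toNat] x
    refine ⟨y, by simp [y], fun k => ?_⟩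
    rcases le_or_gt 0 k with hk | hk
    · refine ⟨k, Or.inl rfl, ?_⟩
      have e : (k + 1).toNat = k.toNat + 1 := by omega
      simp only [y, hk, show 0 ≤ k + 1 by omega, if_true, e, Function.iterate_succ_apply']
      ring
    · refine ⟨k + 1, Or.inr rfl, ?_⟩
      have hy1 : y (k + 1) = (fun z => z - s * v z)^[(-(k + 1)).toNat] x := by
        rcases eq_or_ne k (-1) with rfl | hne
        · simp [y]
        · simp [y, show ¬ (0 ≤ k + 1) by omega]
      have hy0 : y k = y (k + 1) - s * v (y (k + 1)) := by
        rw [hy1]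
        have e : (-k).toNat = (-(k + 1)).toNat + 1 := by omega
        simp only [y, show ¬ (0 ≤ k) by omega, if_false, e, Function.iterate_succ_apply']
      rw [hy0]; ring
  choose y hy0 hy using hgrid
  -- Step functions do as well as polygons: rounding the time to the grid costs at most `1 / (n +
  -- 1)`, which vanishes in the limit.
  let cn : ℕ → ℝ → ℂ := fun n t => y n ⌊((n : ℝ) + 1) * t⌋
  have hpos : ∀ n : ℕ, (0 : ℝ) < (n : ℝ) + 1 := fun n => by positivity
  have hlipgrid : ∀ n k m, ‖y n m - y n k‖ ≤ |(m - k : ℝ)| / ((n : ℝ) + 1) := by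
    intro n k m
    have := euler_estimate (hpos n) (hy n) (w := 0) (ε := 1) (k := k) (m := m)
      (fun j _ => by simpa using hb _)
    simpa using this
  have hfloor : ∀ (n : ℕ) (s t : ℝ),
      |((⌊((n : ℝ) + 1) * t⌋ : ℝ) - ⌊((n : ℝ) + 1) * s⌋) / ((n : ℝ) + 1) - (t - s)|
        ≤ 1 / ((n : ℝ) + 1) := by
    intro n s t
    have e : ((⌊((n : ℝ) + 1) * t⌋ : ℝ) - ⌊((n : ℝ) + 1) * s⌋) / ((n : ℝ) + 1) - (t - s)
        = ((⌊((n : ℝ) + 1) * t⌋ : ℝ) - ⌊((n : ℝ) + 1) * s⌋ - ((n : ℝ) + 1) * (t - s))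
          / ((n : ℝ) + 1) := by
      have := (hpos n).ne'
      field_simp
    rw [e, abs_div, abs_of_pos (hpos n)]
    gcongr
    rw [abs_le]
    have a1 := Int.floor_le (((n : ℝ) + 1) * t)
    have a2 := Int.lt_floor_add_one (((n : ℝ) + 1) * t)
    have a3 := Int.floor_le (((n : ℝ) + 1) * s)
    have a4 := Int.lt_floor_add_one (((n : ℝ) + 1) * s)
    constructor <;> linarith
  have hn1 : ∀ n : ℕ, 1 / ((n : ℝ) + 1) ≤ 1 := by
    intro n; rw [div_le_one (hpos n)]; linarith [n.cast_nonneg (α := ℝ)]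
  -- A limit along an ultrafilter replaces the extraction of a subsequence: it exists at every time,
  -- because the approximations stay in a compact ball.
  let U : Ultrafilter ℕ := hyperfilter ℕ
  have hUtop : (U : Filter ℕ) ≤ atTop := by
    rw [← Nat.cofinite_eq_atTop]; exact hyperfilter_le_cofinite
  have hlim : ∀ t, ∃ z, Tendsto (fun n => cn n t) U (𝓝 z) := by
    intro t
    have hmem : ∀ n, cn n t ∈ Metric.closedBall x (|t| + 1) := by
      intro n
      rw [mem_closedBall_iff_norm]
      have h1 := hlipgrid n 0 ⌊((n : ℝ) + 1) * t⌋
      rw [hy0] at h1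
      refine h1.trans ?_
      have h2 := hfloor n 0 t
      simp only [mul_zero, Int.floor_zero, Int.cast_zero, sub_zero] at h2 ⊢
      have h3 := abs_sub_abs_le_abs_sub ((⌊((n : ℝ) + 1) * t⌋ : ℝ) / ((n : ℝ) + 1)) t
      rw [abs_div, abs_of_pos (hpos n)] at h3
      linarith [hn1 n]
    obtain ⟨z, -, hz⟩ := (isCompact_closedBall x (|t| + 1)).ultrafilter_le_nhds
      (U.map (fun n => cn n t)) (by
        rw [le_principal_iff]
        exact Filter.mem_map.2 (Filter.univ_mem' hmem))
    exact ⟨z, hz⟩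
  choose c hc using hlim
  refine ⟨c, ?_, fun t => ?_⟩
  · have h1 : (fun n => cn n 0) = fun _ => x := by funext n; simp [cn, hy0]
    have := hc 0
    rw [h1] at this
    exact tendsto_nhds_unique this tendsto_const_nhds
  · rw [hasDerivAt_iff_isLittleO, Asymptotics.isLittleO_iff]
    intro ε hε
    obtain ⟨δ, hδ, hδ2⟩ := Metric.continuousAt_iff.1 (hv.continuousAt (x := c t)) ε hε
    filter_upwards [Metric.ball_mem_nhds t (show 0 < δ / 2 by positivity)] with s hs
    rw [Metric.mem_ball, Real.dist_eq] at hs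
    have htend0 : Tendsto (fun n : ℕ => 1 / ((n : ℝ) + 1)) U (𝓝 0) :=
      tendsto_one_div_add_atTop_nhds_zero_nat.mono_left hUtop
    have hquot : Tendsto (fun n : ℕ => ((⌊((n : ℝ) + 1) * s⌋ : ℝ) - ⌊((n : ℝ) + 1) * t⌋)
        / ((n : ℝ) + 1)) U (𝓝 (s - t)) := by
      rw [tendsto_iff_dist_tendsto_zero]
      refine squeeze_zero (fun _ => dist_nonneg) (fun n => ?_) htend0
      rw [Real.dist_eq]; exact hfloor n t s
    have hest : ∀ᶠ n in (U : Filter ℕ), ‖cn n s - cn n t -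
        ((((⌊((n : ℝ) + 1) * s⌋ : ℝ) - ⌊((n : ℝ) + 1) * t⌋) / ((n : ℝ) + 1) : ℝ) : ℂ) * v (c t)‖
        ≤ |((⌊((n : ℝ) + 1) * s⌋ : ℝ) - ⌊((n : ℝ) + 1) * t⌋) / ((n : ℝ) + 1)| * ε := by
      have e1 : ∀ᶠ n in (U : Filter ℕ), dist (cn n t) (c t) < δ / 4 :=
        (hc t).eventually (Metric.ball_mem_nhds _ (by positivity))
      have e2 : ∀ᶠ n : ℕ in (U : Filter ℕ), 1 / ((n : ℝ) + 1) < δ / 4 :=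
        htend0.eventually (gt_mem_nhds (by positivity))
      filter_upwards [e1, e2] with n hn1 hn2
      have := euler_estimate (hpos n) (hy n) (w := v (c t)) (ε := ε) (k := ⌊((n : ℝ) + 1) * t⌋)
        (m := ⌊((n : ℝ) + 1) * s⌋) ?_
      · rw [abs_div, abs_of_pos (hpos n)]; exact this
      · intro j hj
        rw [← dist_eq_norm]
        refine (hδ2 ?_).le
        have h1 : ‖y n j - cn n t‖ ≤ |(j - ⌊((n : ℝ) + 1) * t⌋ : ℝ)| / ((n : ℝ) + 1) :=
          hlipgrid n _ j
        have h2 : |(j - ⌊((n : ℝ) + 1) * t⌋ : ℝ)|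
            ≤ |(⌊((n : ℝ) + 1) * s⌋ - ⌊((n : ℝ) + 1) * t⌋ : ℝ)| := by
          have := Set.abs_sub_left_of_mem_uIcc hj
          exact_mod_cast this
        have h3 := hfloor n t s
        have h4 := abs_sub_abs_le_abs_sub
          (((⌊((n : ℝ) + 1) * s⌋ : ℝ) - ⌊((n : ℝ) + 1) * t⌋) / ((n : ℝ) + 1)) (s - t)
        rw [abs_div, abs_of_pos (hpos n)] at h4
        have h5 : |(j - ⌊((n : ℝ) + 1) * t⌋ : ℝ)| / ((n : ℝ) + 1)
            ≤ |(⌊((n : ℝ) + 1) * s⌋ - ⌊((n : ℝ) + 1) * t⌋ : ℝ)| / ((n : ℝ) + 1) := by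
          have := (hpos n).le
          gcongr
        calc dist (y n j) (c t) ≤ dist (y n j) (cn n t) + dist (cn n t) (c t) :=
              dist_triangle _ _ _
          _ < δ := by rw [dist_eq_norm (y n j)]; linarith
    have l1 : Tendsto (fun n : ℕ => ‖cn n s - cn n t -
        ((((⌊((n : ℝ) + 1) * s⌋ : ℝ) - ⌊((n : ℝ) + 1) * t⌋) / ((n : ℝ) + 1) : ℝ) : ℂ) * v (c t)‖)
        U (𝓝 ‖c s - c t - ((s - t : ℝ) : ℂ) * v (c t)‖) :=
      (((hc s).sub (hc t)).sub
        (((Complex.continuous_ofReal.tendsto _).comp hquot).mul_const _)).norm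
    have := le_of_tendsto_of_tendsto l1 (hquot.abs.mul_const ε) hest
    rw [Complex.real_smul, Real.norm_eq_abs]
    linarith

lemma exists_unit_curve {θ : ℂ → ℝ} (hθ : Continuous θ) (x : ℂ) :
    ∃ c : ℝ → ℂ, c 0 = x ∧ ∀ t, HasDerivAt c (Complex.exp (θ (c t) * Complex.I)) t :=
  exists_integral_curve (v := fun z => Complex.exp (θ z * Complex.I)) (by fun_prop)
    (fun z => by simp [Complex.norm_exp_ofReal_mul_I]) x

lemma isCurve_of_unit {θ : ℂ → ℝ} {c : ℝ → ℂ}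
    (hc : ∀ t, HasDerivAt c (Complex.exp (θ (c t) * Complex.I)) t) : IsCurve θ c :=
  ⟨fun _ => 1, continuous_const, fun _ => one_ne_zero, fun t => by simpa using hc t⟩

/-- After rotation by `-y` the second term is real, so the left side is the absolute value of the
imaginary part of the rotated difference. -/
lemma abs_mul_sin_le_norm (x y t s : ℝ) :
    |t| * |Real.sin (y - x)| ≤
      ‖(t : ℂ) * Complex.exp (x * Complex.I) - s * Complex.exp (y * Complex.I)‖ := by
  rw [← abs_mul]
  have h : ‖((t : ℂ) * Complex.exp (x * Complex.I) - s * Complex.exp (y * Complex.I))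
      * Complex.exp ((-y : ℝ) * Complex.I)‖
      = ‖(t : ℂ) * Complex.exp (x * Complex.I) - s * Complex.exp (y * Complex.I)‖ := by
    rw [norm_mul, Complex.norm_exp_ofReal_mul_I, mul_one]
  rw [← h, ← abs_neg]
  refine le_trans (le_of_eq ?_) (Complex.abs_im_le_norm _)
  congr 1
  simp only [Complex.mul_im, Complex.mul_re, Complex.sub_re, Complex.sub_im, Complex.ofReal_re,
    Complex.ofReal_im, Complex.exp_ofReal_mul_I_re, Complex.exp_ofReal_mul_I_im]
  rw [Real.sin_sub, Real.cos_neg, Real.sin_neg]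
  ring

lemma norm_sub_sub_le_of_unit {θ : ℂ → ℝ} {c : ℝ → ℂ}
    (hc : ∀ t, HasDerivAt c (Complex.exp (θ (c t) * Complex.I)) t) {w : ℂ} {η r : ℝ}
    (h : ∀ t ∈ Icc (-r) r, ‖Complex.exp (θ (c t) * Complex.I) - w‖ ≤ η) {t : ℝ}
    (ht : t ∈ Icc (-r) r) (hr : 0 ≤ r) : ‖c t - c 0 - t * w‖ ≤ η * |t| := by
  have h1 : ∀ s ∈ Icc (-r) r, HasDerivWithinAt (fun s : ℝ => c s - s * w)
      (Complex.exp (θ (c s) * Complex.I) - w) (Icc (-r) r) s := by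
    intro s _
    have h2 : HasDerivAt (fun s : ℝ => (s : ℂ) * w) w s := by
      simpa using (Complex.ofRealCLM.hasDerivAt (x := s)).mul_const w
    exact ((hc s).sub h2).hasDerivWithinAt
  have := (convex_Icc (-r) r).norm_image_sub_le_of_norm_hasDerivWithin_le h1 h
    (show (0:ℝ) ∈ Icc (-r) r by constructor <;> linarith) ht
  simp only [Complex.ofReal_zero, zero_mul, sub_zero, Real.norm_eq_abs] at this
  rwa [sub_right_comm] at this

/-! ### Local boxes: nearby transverse curves meet. -/

/-- Near every point, curves of two transverse direction fields issued from nearby points meet. -/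
lemma exists_box {θ₁ θ₂ : ℂ → ℝ} (hθ₁ : Continuous θ₁) (hθ₂ : Continuous θ₂)
    (hθ : ∀ z, θ₁ z < θ₂ z ∧ θ₂ z < θ₁ z + Real.pi) (x : ℂ) :
    ∃ V ∈ 𝓝 x, ∀ y ∈ V, ∀ z ∈ V, ∃ c d : ℝ → ℂ, IsCurve θ₁ c ∧ IsCurve θ₂ d ∧ c 0 = y ∧ d 0 = z ∧
      ∃ t s, c t = d s := by
  set κ := Real.sin (θ₂ x - θ₁ x) with hκ
  have hκ0 : 0 < κ := Real.sin_pos_of_pos_of_lt_pi (by linarith [(hθ x).1]) (by linarith [(hθ x).2])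
  have hX₁ : Continuous fun z => Complex.exp (θ₁ z * Complex.I) := by fun_prop
  have hX₂ : Continuous fun z => Complex.exp (θ₂ z * Complex.I) := by fun_prop
  obtain ⟨δ₁, hδ₁, h₁⟩ := Metric.continuousAt_iff.1 (hX₁.continuousAt (x := x)) (κ / 4)
    (by positivity)
  obtain ⟨δ₂, hδ₂, h₂⟩ := Metric.continuousAt_iff.1 (hX₂.continuousAt (x := x)) (κ / 4)
    (by positivity)
  have hs : ContinuousAt (fun p : ℂ × ℂ => Real.sin (θ₂ p.2 - θ₁ p.1)) (x, x) := by fun_prop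
  obtain ⟨δ₃, hδ₃, h₃⟩ := Metric.continuousAt_iff.1 hs κ hκ0
  set δ := min δ₁ (min δ₂ δ₃) with hδ
  have hδ0 : 0 < δ := by positivity
  have hd1 : δ ≤ δ₁ := min_le_left _ _
  have hd2 : δ ≤ δ₂ := (min_le_right _ _).trans (min_le_left _ _)
  have hd3 : δ ≤ δ₃ := (min_le_right _ _).trans (min_le_right _ _)
  set r := δ / 2 with hr
  have hr0 : 0 < r := by positivity
  refine ⟨Metric.ball x (min r (κ * r / 8)), Metric.ball_mem_nhds _ (by positivity), ?_⟩
  intro y hy z hz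
  obtain ⟨c, hc0, hc⟩ := exists_unit_curve hθ₁ y
  obtain ⟨d, hd0, hd⟩ := exists_unit_curve hθ₂ z
  refine ⟨c, d, isCurve_of_unit hc, isCurve_of_unit hd, hc0, hd0, ?_⟩
  have near : ∀ {θ : ℂ → ℝ} {c : ℝ → ℂ} {y : ℂ},
      (∀ t, HasDerivAt c (Complex.exp (θ (c t) * Complex.I)) t) → c 0 = y →
      y ∈ Metric.ball x (min r (κ * r / 8)) → ∀ t ∈ Icc (-r) r, dist (c t) x < δ := by
    intro θ c y hc hc0 hy t ht
    have h1 := norm_sub_sub_le_of_unit hc (w := 0) (η := 1) (r := r)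
      (fun t _ => by simp [Complex.norm_exp_ofReal_mul_I]) ht hr0.le
    have h2 : |t| ≤ r := abs_le.2 ht
    rw [hc0] at h1
    simp only [mul_zero, sub_zero, one_mul] at h1
    have h3 : dist y x < r := (Metric.mem_ball.1 hy).trans_le (min_le_left _ _)
    calc dist (c t) x ≤ dist (c t) y + dist y x := dist_triangle _ _ _
      _ < δ := by rw [dist_eq_norm (c t)]; linarith
  have nc := near hc hc0 hy
  have nd := near hd hd0 hz
  have hyz : ‖y - z‖ < κ * r / 4 := by
    rw [← dist_eq_norm]
    have a1 := (Metric.mem_ball.1 hy).trans_le (min_le_right _ _)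
    have a2 := (Metric.mem_ball'.1 hz).trans_le (min_le_right _ _)
    linarith [dist_triangle y x z]
  have ec : ∀ t ∈ Icc (-r) r, ‖c t - y - t * Complex.exp (θ₁ x * Complex.I)‖ ≤ κ / 4 * |t| := by
    intro t ht
    rw [← hc0]
    refine norm_sub_sub_le_of_unit hc (fun s hs => ?_) ht hr0.le
    rw [← dist_eq_norm]
    exact (h₁ ((nc s hs).trans_le hd1)).le
  have ed : ∀ t ∈ Icc (-r) r, ‖d t - z - t * Complex.exp (θ₂ x * Complex.I)‖ ≤ κ / 4 * |t| := by
    intro t ht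
    rw [← hd0]
    refine norm_sub_sub_le_of_unit hd (fun s hs => ?_) ht hr0.le
    rw [← dist_eq_norm]
    exact (h₂ ((nd s hs).trans_le hd2)).le
  have hcc : Continuous c := (isCurve_of_unit hc).continuous
  have hdc : Continuous d := (isCurve_of_unit hd).continuous
  have h00 : (0:ℝ) ∈ Icc (-r) r := ⟨by linarith, hr0.le⟩
  -- The pair of parameters minimising the distance gives the intersection. It is interior: `|t| =
  -- r` would yield `κ r ≤ 2 ‖y - z‖ + κ r / 2 < κ r`, and likewise for `s`. At an interior minimum
  -- `c t - d s` is orthogonal to both tangents, which are independent, so it vanishes.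
  obtain ⟨⟨t, s⟩, ⟨ht, hs⟩, hmin⟩ := ((isCompact_Icc (a := -r) (b := r)).prod
    (isCompact_Icc (a := -r) (b := r))).exists_isMinOn ⟨(0, 0), h00, h00⟩
    (f := fun p : ℝ × ℝ => ‖c p.1 - d p.2‖) (by fun_prop)
  simp only at ht hs
  have hle : ‖c t - d s‖ ≤ ‖y - z‖ := by
    have : ‖c t - d s‖ ≤ ‖c 0 - d 0‖ := hmin (show ((0:ℝ), (0:ℝ)) ∈ _ from ⟨h00, h00⟩)
    rwa [hc0, hd0] at this
  have hlow : ‖(t : ℂ) * Complex.exp (θ₁ x * Complex.I) - s * Complex.exp (θ₂ x * Complex.I)‖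
      ≤ ‖c t - d s‖ + ‖y - z‖ + κ / 4 * |t| + κ / 4 * |s| := by
    have e : (t : ℂ) * Complex.exp (θ₁ x * Complex.I) - s * Complex.exp (θ₂ x * Complex.I)
        = (c t - d s) - (y - z) - (c t - y - t * Complex.exp (θ₁ x * Complex.I))
          + (d s - z - s * Complex.exp (θ₂ x * Complex.I)) := by ring
    rw [e]
    have := norm_add_le ((c t - d s) - (y - z) - (c t - y - t * Complex.exp (θ₁ x * Complex.I)))
      (d s - z - s * Complex.exp (θ₂ x * Complex.I))
    have := norm_sub_le ((c t - d s) - (y - z)) (c t - y - t * Complex.exp (θ₁ x * Complex.I))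
    have := norm_sub_le (c t - d s) (y - z)
    linarith [ec t ht, ed s hs]
  have b1 := abs_mul_sin_le_norm (θ₁ x) (θ₂ x) t s
  have b2 := abs_mul_sin_le_norm (θ₂ x) (θ₁ x) s t
  rw [norm_sub_rev] at b2
  rw [← hκ, abs_of_pos hκ0] at b1
  rw [← abs_neg (Real.sin _), ← Real.sin_neg, neg_sub, ← hκ, abs_of_pos hκ0] at b2
  have at' : |t| ≤ r := abs_le.2 ht
  have as' : |s| ≤ r := abs_le.2 hs
  have ht' : |t| < r := by
    by_contra hcon
    have : |t| = r := le_antisymm at' (not_lt.1 hcon)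
    rw [this] at b1 hlow
    nlinarith
  have hs' : |s| < r := by
    by_contra hcon
    have : |s| = r := le_antisymm as' (not_lt.1 hcon)
    rw [this] at b2 hlow
    nlinarith
  have crit : ∀ {e : ℝ → ℂ} {v p : ℂ} {u : ℝ}, HasDerivAt e v u → |u| < r →
      (∀ u' ∈ Icc (-r) r, ‖e u - p‖ ≤ ‖e u' - p‖) →
      (e u - p).re * v.re + (e u - p).im * v.im = 0 := by
    intro e v p u he hu hmin
    have hre : HasDerivAt (fun t => (e t).re) v.re u := Complex.reCLM.hasFDerivAt.comp_hasDerivAt u he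
    have him : HasDerivAt (fun t => (e t).im) v.im u := Complex.imCLM.hasFDerivAt.comp_hasDerivAt u he
    have hsq : HasDerivAt (fun t => ((e t).re - p.re) ^ 2 + ((e t).im - p.im) ^ 2)
        (2 * ((e u).re - p.re) * v.re + 2 * ((e u).im - p.im) * v.im) u := by
      exact (((hre.sub_const p.re).pow 2).add ((him.sub_const p.im).pow 2)).congr_deriv (by simp)
    have hloc : IsLocalMin (fun t => ((e t).re - p.re) ^ 2 + ((e t).im - p.im) ^ 2) u := by
      filter_upwards [Ioo_mem_nhds (abs_lt.1 hu).1 (abs_lt.1 hu).2] with u' hu'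
      have h1 := hmin u' (Ioo_subset_Icc_self hu')
      have h2 : ∀ w : ℂ, ‖w - p‖ ^ 2 = (w.re - p.re) ^ 2 + (w.im - p.im) ^ 2 := by
        intro w; rw [Complex.sq_norm, Complex.normSq_apply]; simp; ring
      rw [← h2, ← h2]
      gcongr
    have := hloc.hasDerivAt_eq_zero hsq
    simp only [Complex.sub_re, Complex.sub_im]
    linarith
  have c1 := crit (p := d s) (hc t) ht' (fun u hu => hmin (show (u, s) ∈ _ from ⟨hu, hs⟩))
  have c2 := crit (p := c t) (hd s) hs' (fun u hu => by
    rw [norm_sub_rev, norm_sub_rev (d u)]; exact hmin (show (t, u) ∈ _ from ⟨ht, hu⟩))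
  simp only [Complex.exp_ofReal_mul_I_re, Complex.exp_ofReal_mul_I_im, Complex.sub_re,
    Complex.sub_im] at c1 c2
  have hsin : 0 < Real.sin (θ₂ (d s) - θ₁ (c t)) := by
    have := h₃ (x := (c t, d s)) (by
      rw [Prod.dist_eq]; exact max_lt ((nc t ht).trans_le hd3) ((nd s hs).trans_le hd3))
    rw [Real.dist_eq] at this
    linarith [(abs_lt.1 this).1]
  rw [Real.sin_sub] at hsin
  refine ⟨t, s, Complex.ext ?_ ?_⟩
  · have : ((c t).re - (d s).re) * (Real.sin (θ₂ (d s)) * Real.cos (θ₁ (c t))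
        - Real.cos (θ₂ (d s)) * Real.sin (θ₁ (c t))) = 0 := by
      linear_combination Real.sin (θ₂ (d s)) * c1 + Real.sin (θ₁ (c t)) * c2
    rcases mul_eq_zero.1 this with h | h <;> linarith
  · have : ((c t).im - (d s).im) * (Real.sin (θ₂ (d s)) * Real.cos (θ₁ (c t))
        - Real.cos (θ₂ (d s)) * Real.sin (θ₁ (c t))) = 0 := by
      linear_combination -Real.cos (θ₂ (d s)) * c1 - Real.cos (θ₁ (c t)) * c2
    rcases mul_eq_zero.1 this with h | h <;> linarith

/-! ### Transverse curves of the plane meet at most once. -/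

lemma IsCurve.exists_positive {θ : ℂ → ℝ} {c : ℝ → ℂ} (hc : IsCurve θ c) :
    ∃ h : ℝ → ℝ, Continuous h ∧ (∀ t, 0 < h t) ∧
      ((∀ t, HasDerivAt c (h t * Complex.exp (θ (c t) * Complex.I)) t) ∨
        ∀ t, HasDerivAt c (-(h t * Complex.exp (θ (c t) * Complex.I))) t) := by
  obtain ⟨h, hh, h0, hd⟩ := hc
  have hsign : (∀ t, 0 < h t) ∨ ∀ t, h t < 0 := by
    by_contra! hcon
    obtain ⟨⟨a, ha⟩, b, hb⟩ := hcon
    obtain ⟨t, ht⟩ := mem_range_of_exists_le_of_exists_ge hh ⟨a, ha⟩ ⟨b, hb⟩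
    exact h0 t ht
  rcases hsign with h1 | h1
  · exact ⟨h, hh, h1, Or.inl hd⟩
  · refine ⟨fun t => -h t, hh.neg, fun t => neg_pos.2 (h1 t), Or.inr fun t => ?_⟩
    simpa using hd t

/-- Two transverse curves with the same starting point: the first is not contained in the second. -/
lemma exists_notMem_of_transverse {θ₁ θ₂ : ℂ → ℝ}
    (hθ : ∀ z, θ₁ z < θ₂ z ∧ θ₂ z < θ₁ z + Real.pi) {α β : ℝ → ℂ} (hα : IsCurve θ₁ α)
    (hβ : IsCurve θ₂ β) (hβi : InjOn β (Icc 0 1)) (h0 : α 0 = β 0) :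
    ∃ s ∈ Ioo (0 : ℝ) 1, ∀ t ∈ Icc (0 : ℝ) 1, α s ≠ β t := by
  by_contra! hcon
  -- Now `α = β ∘ τ` on `(0, 1)`, and `τ s → 0` by compactness and injectivity of `β`.
  -- Multiplication by `w` makes the tangent of `β` at `0` real. The imaginary part of `(β (τ s) - β
  -- 0) w` is then `o(τ s) = o(s)`, whereas that of `(α s - α 0) w` has a nonzero derivative at `0`.
  choose! τ hτ hτ2 using hcon
  obtain ⟨a, -, ha0, hα'⟩ := hα
  obtain ⟨b, -, hb0, hβ'⟩ := id hβ
  have hαc : Continuous α := continuous_iff_continuousAt.2 fun t => (hα' t).continuousAt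
  have ev : ∀ᶠ s in 𝓝[>] (0:ℝ), s ∈ Ioo (0:ℝ) 1 := Ioo_mem_nhdsGT zero_lt_one
  have hτlim : Tendsto τ (𝓝[>] 0) (𝓝 0) := by
    refine (isCompact_Icc (a := (0:ℝ)) (b := 1)).tendsto_nhds_of_unique_mapClusterPt
      (ev.mono fun s hs => hτ s hs) ?_
    intro y hy hcl
    refine hβi hy (by simp) ?_
    have h1 : MapClusterPt (β y) (𝓝[>] 0) (β ∘ τ) := hcl.continuousAt_comp hβ.continuous.continuousAt
    have h2 : Tendsto (β ∘ τ) (𝓝[>] 0) (𝓝 (β 0)) := by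
      rw [← h0]
      refine ((hαc.tendsto 0).mono_left nhdsWithin_le_nhds).congr' ?_
      filter_upwards [ev] with s hs using hτ2 s hs
    exact eq_of_nhds_neBot (h1.neBot.mono (inf_le_inf_left _ h2))
  set w := Complex.exp ((-θ₂ (β 0) : ℝ) * Complex.I) with hw
  have hda : HasDerivAt (fun t => (α t * w).im) (a 0 * Real.sin (θ₁ (α 0) - θ₂ (β 0))) 0 := by
    have := Complex.imCLM.hasFDerivAt.comp_hasDerivAt (0:ℝ) ((hα' 0).mul_const w)
    convert! this using 1
    rw [mul_assoc, hw, ← Complex.exp_add, ← add_mul, ← Complex.ofReal_add]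
    simp only [Complex.imCLM_apply, Complex.im_ofReal_mul, Complex.exp_ofReal_mul_I_im]
    rfl
  have hdb : HasDerivAt (fun t => (β t * w).im) 0 0 := by
    have := Complex.imCLM.hasFDerivAt.comp_hasDerivAt (0:ℝ) ((hβ' 0).mul_const w)
    convert! this using 1
    rw [mul_assoc, hw, ← Complex.exp_add, ← add_mul, ← Complex.ofReal_add]
    simp only [Complex.imCLM_apply, Complex.im_ofReal_mul, Complex.exp_ofReal_mul_I_im]
    simp
  have o1 : (fun s => τ s - 0) =O[𝓝[>] 0] fun s => β (τ s) - β 0 :=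
    (HasDerivAtFilter.isTheta_sub (hβ' 0) (by simp [hb0])).2.comp_tendsto
      (hτlim.prodMk tendsto_const_pure)
  have o2 : (fun s => β (τ s) - β 0) =O[𝓝[>] 0] fun s : ℝ => s - 0 := by
    have := ((hα' 0).isBigO_sub).mono (nhdsWithin_le_nhds (s := Ioi 0))
    refine this.congr' ?_ EventuallyEq.rfl
    filter_upwards [ev] with s hs
    rw [h0, hτ2 s hs]
  have o3 : (fun s => (β (τ s) * w).im - (β 0 * w).im) =o[𝓝[>] 0] fun s => τ s - 0 := by
    have := (hasDerivAt_iff_isLittleO.1 hdb).comp_tendsto hτlim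
    simpa [Function.comp_def] using this
  have o4 : (fun s => (β (τ s) * w).im - (β 0 * w).im) =o[𝓝[>] 0] fun s : ℝ => s - 0 :=
    o3.trans_isBigO (o1.trans o2)
  have o5 := (hasDerivAt_iff_isLittleO.1 hda).mono (nhdsWithin_le_nhds (s := Ioi 0))
  have hne : a 0 * Real.sin (θ₁ (α 0) - θ₂ (β 0)) ≠ 0 := by
    refine mul_ne_zero (ha0 0) ?_
    rw [← h0, ← neg_sub, Real.sin_neg, neg_ne_zero]
    exact (Real.sin_pos_of_pos_of_lt_pi (by linarith [(hθ (α 0)).1])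
      (by linarith [(hθ (α 0)).2])).ne'
  have o6 : (fun s : ℝ => (s - 0) • (a 0 * Real.sin (θ₁ (α 0) - θ₂ (β 0)))) =o[𝓝[>] 0]
      fun s : ℝ => s - 0 := by
    refine (o4.sub o5).congr' ?_ EventuallyEq.rfl
    filter_upwards [ev] with s hs
    rw [hτ2 s hs, h0]; ring
  have o7 : (fun s : ℝ => s - 0) =o[𝓝[>] 0] fun s : ℝ => s - 0 := by
    refine ((o6.const_mul_left (a 0 * Real.sin (θ₁ (α 0) - θ₂ (β 0)))⁻¹)).congr_left fun s => ?_
    rw [smul_eq_mul, mul_comm (s - 0), ← mul_assoc, inv_mul_cancel₀ hne, one_mul]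
  refine Asymptotics.isLittleO_irrefl (Eventually.frequently ?_) o7
  filter_upwards [ev] with s hs
  simpa using hs.1.ne'

/-- Two transverse curves of the plane meet at most once. -/
lemma no_bigon_unit {θ₁ θ₂ : ℂ → ℝ} (hθ₁ : Continuous θ₁) (hθ₂ : Continuous θ₂)
    (hθ : ∀ z, θ₁ z < θ₂ z ∧ θ₂ z < θ₁ z + Real.pi) {α β : ℝ → ℂ} (hα : IsCurve θ₁ α)
    (hβ : IsCurve θ₂ β) (hαi : InjOn α (Icc 0 1)) (hβi : InjOn β (Icc 0 1))
    (h0 : α 0 = β 0) (h1 : α 1 = β 1) (hmeet : ∀ s ∈ Icc (0 : ℝ) 1, ∀ t ∈ Icc (0 : ℝ) 1, α s = β t →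
      (s = 0 ∧ t = 0) ∨ (s = 1 ∧ t = 1)) : False := by
  obtain ⟨a, ha, ha0, hα'⟩ := hα.exists_positive
  obtain ⟨b, hb, hb0, hβ'⟩ := hβ.exists_positive
  have hadd : ∀ x : ℝ, Complex.exp (((x + Real.pi : ℝ) : ℂ) * Complex.I)
      = - Complex.exp (x * Complex.I) := by
    intro x; push_cast; rw [add_mul, Complex.exp_add, Complex.exp_pi_mul_I]; ring
  have hsub : ∀ x : ℝ, Complex.exp (((x - Real.pi : ℝ) : ℂ) * Complex.I)
      = - Complex.exp (x * Complex.I) := by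
    intro x
    have := hadd (x - Real.pi)
    rw [sub_add_cancel] at this
    rw [this, neg_neg]
  have hmeet' : ∀ s ∈ Icc (0 : ℝ) 1, ∀ t ∈ Icc (0 : ℝ) 1, β s = α t →
      (s = 0 ∧ t = 0) ∨ (s = 1 ∧ t = 1) := by
    intro s hs t ht h
    rcases hmeet t ht s hs h.symm with h | h
    · exact Or.inl h.symm
    · exact Or.inr h.symm
  -- A curve running against its field is positively tangent to the field with angle shifted by `π`.
  -- When exactly one curve is reversed, the two families exchange roles so that the difference of
  -- angles stays in `(0, π)`.
  rcases hα' with hα' | hα' <;> rcases hβ' with hβ' | hβ'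
  · exact no_simple_bigon hθ₁ hθ₂ hθ ha hb ha0 hb0 hα' hβ' hαi hβi h0 h1 hmeet
  · refine no_simple_bigon (θ₁ := fun z => θ₂ z - Real.pi) (θ₂ := θ₁) (by fun_prop) hθ₁ ?_ hb ha hb0
      ha0 (fun t => ?_) hα' hβi hαi h0.symm h1.symm hmeet'
    · intro z; constructor <;> linarith [(hθ z).1, (hθ z).2]
    · rw [hsub, mul_neg]; exact hβ' t
  · refine no_simple_bigon (θ₁ := θ₂) (θ₂ := fun z => θ₁ z + Real.pi) hθ₂ (by fun_prop) ?_ hb ha hb0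
      ha0 hβ' (fun t => ?_) hβi hαi h0.symm h1.symm hmeet'
    · intro z; constructor <;> linarith [(hθ z).1, (hθ z).2]
    · rw [hadd, mul_neg]; exact hα' t
  · refine no_simple_bigon (θ₁ := fun z => θ₁ z + Real.pi) (θ₂ := fun z => θ₂ z + Real.pi)
      (by fun_prop) (by fun_prop) ?_ ha hb ha0
      hb0 (fun t => ?_) (fun t => ?_) hαi hβi h0 h1 hmeet
    · intro z; constructor <;> linarith [(hθ z).1, (hθ z).2]
    · rw [hadd, mul_neg]; exact hα' t
    · rw [hadd, mul_neg]; exact hβ' t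

lemma injOn_comp_affine {c : ℝ → ℂ} {p q : ℝ} (hpq : p ≠ q) (hc : InjOn c (uIcc p q)) :
    InjOn (fun u => c (p + u * (q - p))) (Icc 0 1) := by
  have hm : MapsTo (fun u : ℝ => p + u * (q - p)) (Icc 0 1) (uIcc p q) := by
    intro u hu
    rw [mem_uIcc]
    rcases le_total p q with h | h
    · left; constructor <;> nlinarith [hu.1, hu.2]
    · right; constructor <;> nlinarith [hu.1, hu.2]
  refine hc.comp (fun u _ v _ h => ?_) hm
  have h' : p + u * (q - p) = p + v * (q - p) := h
  have : (u - v) * (q - p) = 0 := by linarith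
  rcases mul_eq_zero.1 this with h | h
  · linarith
  · exact absurd (by linarith) hpq

/-- Two transverse curves of the plane meet at most once. -/
lemma no_bigon {θ₁ θ₂ : ℂ → ℝ} (hθ₁ : Continuous θ₁) (hθ₂ : Continuous θ₂)
    (hθ : ∀ z, θ₁ z < θ₂ z ∧ θ₂ z < θ₁ z + Real.pi) {α β : ℝ → ℂ} (hα : IsCurve θ₁ α)
    (hβ : IsCurve θ₂ β) {s₀ s₁ t₀ t₁ : ℝ} (hαi : InjOn α (uIcc s₀ s₁)) (hβi : InjOn β (uIcc t₀ t₁))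
    (h0 : α s₀ = β t₀) (h1 : α s₁ = β t₁) (hne : α s₀ ≠ α s₁) : False := by
  have hs : s₀ ≠ s₁ := by rintro rfl; exact hne rfl
  have ht : t₀ ≠ t₁ := by rintro rfl; exact hne (h0.trans h1.symm)
  wlog hstd : s₀ = 0 ∧ s₁ = 1 ∧ t₀ = 0 ∧ t₁ = 1 generalizing α β s₀ s₁ t₀ t₁
  · refine this (hα.comp_affine s₀ (sub_ne_zero.2 hs.symm)) (hβ.comp_affine t₀ (sub_ne_zero.2 ht.symm))
      (s₀ := 0) (s₁ := 1) (t₀ := 0) (t₁ := 1) ?_ ?_ (by simpa using h0) (by simpa using h1)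
      (by simpa using hne) zero_ne_one zero_ne_one (by simp)
    · rw [uIcc_of_le zero_le_one]; exact injOn_comp_affine hs hαi
    · rw [uIcc_of_le zero_le_one]; exact injOn_comp_affine ht hβi
  obtain ⟨rfl, rfl, rfl, rfl⟩ := hstd
  rw [uIcc_of_le zero_le_one] at hαi hβi
  obtain ⟨x, hx, hx2⟩ := exists_notMem_of_transverse hθ hα hβ hβi h0
  -- `J` collects the parameters at which `α` meets the arc of `β`. It is closed and misses `x`, so
  -- the points of `J` nearest to `x` on either side bound a gap. The arcs cut off there form a
  -- bigon with no further contact.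
  set J : Set ℝ := Icc 0 1 ∩ α ⁻¹' (β '' Icc 0 1) with hJ
  have hJc : IsCompact J := isCompact_Icc.inter_right
    ((isCompact_Icc.image hβ.continuous).isClosed.preimage hα.continuous)
  have hxJ : x ∉ J := by
    rintro ⟨-, t, ht, h⟩
    exact hx2 t ht h.symm
  have J0 : (0:ℝ) ∈ J := ⟨by simp, 0, by simp, h0.symm⟩
  have J1 : (1:ℝ) ∈ J := ⟨by simp, 1, by simp, h1.symm⟩
  obtain ⟨s, ⟨hsJ, hsx⟩, hsmax⟩ := (hJc.inter_right (isClosed_Iic (a := x))).exists_isGreatest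
    ⟨0, J0, hx.1.le⟩
  obtain ⟨s', ⟨hsJ', hsx'⟩, hsmin⟩ := (hJc.inter_right (isClosed_Ici (a := x))).exists_isLeast
    ⟨1, J1, hx.2.le⟩
  have hlt : s < x := lt_of_le_of_ne hsx (by rintro rfl; exact hxJ hsJ)
  have hlt' : x < s' := lt_of_le_of_ne hsx' (by rintro rfl; exact hxJ hsJ')
  have hgap : ∀ u ∈ Icc s s', u ∈ J → u = s ∨ u = s' := by
    intro u hu huJ
    rcases le_total u x with h | h
    · exact Or.inl (le_antisymm (hsmax ⟨huJ, h⟩) hu.1)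
    · exact Or.inr (le_antisymm hu.2 (hsmin ⟨huJ, h⟩))
  obtain ⟨hs01, t, ht01, hst⟩ := id hsJ
  obtain ⟨hs01', t', ht01', hst'⟩ := id hsJ'
  have hss' : s ≠ s' := (hlt.trans hlt').ne
  have htt' : t ≠ t' := by
    rintro rfl
    exact hss' (hαi hs01 hs01' (hst.symm.trans hst'))
  have hsubα : uIcc s s' ⊆ Icc 0 1 := (convex_Icc (0:ℝ) 1).ordConnected.uIcc_subset hs01 hs01'
  have hsubβ : uIcc t t' ⊆ Icc 0 1 := (convex_Icc (0:ℝ) 1).ordConnected.uIcc_subset ht01 ht01'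
  refine no_bigon_unit hθ₁ hθ₂ hθ (hα.comp_affine s (sub_ne_zero.2 hss'.symm))
    (hβ.comp_affine t (sub_ne_zero.2 htt'.symm)) (injOn_comp_affine hss' (hαi.mono hsubα))
    (injOn_comp_affine htt' (hβi.mono hsubβ)) (by simpa using hst.symm) (by simpa using hst'.symm) ?_
  intro u hu v hv huv
  have hpos : 0 < s' - s := by linarith
  have hu' : s + u * (s' - s) ∈ Icc s s' := ⟨by nlinarith [hu.1], by nlinarith [hu.2]⟩
  have hv' : t + v * (t' - t) ∈ uIcc t t' := by
    rw [mem_uIcc]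
    rcases le_total t t' with h | h
    · left; constructor <;> nlinarith [hv.1, hv.2]
    · right; constructor <;> nlinarith [hv.1, hv.2]
  have huJ : s + u * (s' - s) ∈ J :=
    ⟨hsubα (by rw [uIcc_of_le (hlt.trans hlt').le]; exact hu'), _, hsubβ hv', huv.symm⟩
  have htne : t' - t ≠ 0 := sub_ne_zero.2 htt'.symm
  rcases hgap _ hu' huJ with h | h
  · left
    have e : u * (s' - s) = 0 := by linarith
    refine ⟨(mul_eq_zero.1 e).resolve_right hpos.ne', ?_⟩
    rw [h, ← hst] at huv
    have := hβi ht01 (hsubβ hv') huv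
    have e : v * (t' - t) = 0 := by linarith
    exact (mul_eq_zero.1 e).resolve_right htne
  · right
    have e : (u - 1) * (s' - s) = 0 := by linarith
    refine ⟨by linarith [(mul_eq_zero.1 e).resolve_right hpos.ne'], ?_⟩
    rw [h, ← hst'] at huv
    have := hβi ht01' (hsubβ hv') huv
    have e : (v - 1) * (t' - t) = 0 := by linarith
    linarith [(mul_eq_zero.1 e).resolve_right htne]

/-! ### Hyperbolic diffeomorphisms of the plane: continuity and type of the splitting. -/

lemma contDiff_iterate {A : ℂ → ℂ} (hA : ContDiff ℝ 1 A) (n : ℕ) : ContDiff ℝ 1 A^[n] := by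
  induction n with
  | zero => exact contDiff_id
  | succ n ih => exact ih.comp hA

/-- A `C^1` diffeomorphism `G` of the plane, with inverse `K`, is hyperbolic with respect to the
continuous family of norms `N` and the invariant splitting `Es ⊕ Eu`. -/
structure PlaneAnosov (G K : ℂ → ℂ) (N : ℂ → ℂ → ℝ) (Es Eu : ℂ → Submodule ℝ ℂ) : Prop where
  left_inv : ∀ z, K (G z) = z
  right_inv : ∀ z, G (K z) = z
  contDiff : ContDiff ℝ 1 G
  contDiff_inv : ContDiff ℝ 1 K
  continuous_norm : Continuous fun p : ℂ × ℂ => N p.1 p.2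
  norm_pos : ∀ z v, v ≠ 0 → 0 < N z v
  norm_smul : ∀ z (r : ℝ) v, N z (r • v) = |r| * N z v
  norm_add : ∀ z v w, N z (v + w) ≤ N z v + N z w
  isCompl : ∀ z, IsCompl (Es z) (Eu z)
  stable_mem : ∀ z, ∀ v ∈ Es z, fderiv ℝ G z v ∈ Es (G z)
  unstable_mem : ∀ z, ∀ v ∈ Eu z, fderiv ℝ G z v ∈ Eu (G z)
  stable_mem_inv : ∀ z, ∀ v ∈ Es z, fderiv ℝ K z v ∈ Es (K z)
  unstable_mem_inv : ∀ z, ∀ v ∈ Eu z, fderiv ℝ K z v ∈ Eu (K z)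
  contract : ∃ C lam : ℝ, 0 < C ∧ 0 < lam ∧ lam < 1 ∧
    (∀ (n : ℕ) z, ∀ v ∈ Es z, N (G^[n] z) (fderiv ℝ G^[n] z v) ≤ C * lam ^ n * N z v) ∧
    (∀ (n : ℕ) z, ∀ v ∈ Eu z, N (K^[n] z) (fderiv ℝ K^[n] z v) ≤ C * lam ^ n * N z v)

namespace PlaneAnosov

variable {G K : ℂ → ℂ} {N : ℂ → ℂ → ℝ} {Es Eu : ℂ → Submodule ℝ ℂ}

lemma symm (h : PlaneAnosov G K N Es Eu) : PlaneAnosov K G N Eu Es where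
  left_inv := h.right_inv
  right_inv := h.left_inv
  contDiff := h.contDiff_inv
  contDiff_inv := h.contDiff
  continuous_norm := h.continuous_norm
  norm_pos := h.norm_pos
  norm_smul := h.norm_smul
  norm_add := h.norm_add
  isCompl z := (h.isCompl z).symm
  stable_mem := h.unstable_mem_inv
  unstable_mem := h.stable_mem_inv
  stable_mem_inv := h.unstable_mem
  unstable_mem_inv := h.stable_mem
  contract := by
    obtain ⟨C, lam, h1, h2, h3, h4, h5⟩ := h.contract
    exact ⟨C, lam, h1, h2, h3, h5, h4⟩

lemma norm_zero (h : PlaneAnosov G K N Es Eu) (z : ℂ) : N z 0 = 0 := by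
  simpa using h.norm_smul z 0 0

lemma norm_nonneg (h : PlaneAnosov G K N Es Eu) (z v : ℂ) : 0 ≤ N z v := by
  rcases eq_or_ne v 0 with rfl | hv
  · exact (h.norm_zero z).ge
  · exact (h.norm_pos z v hv).le

lemma contDiff_iterate (h : PlaneAnosov G K N Es Eu) (n : ℕ) : ContDiff ℝ 1 G^[n] :=
  _root_.contDiff_iterate h.contDiff n

lemma differentiable_iterate (h : PlaneAnosov G K N Es Eu) (n : ℕ) : Differentiable ℝ G^[n] :=
  (h.contDiff_iterate n).differentiable one_ne_zero

lemma iterate_left_inv (h : PlaneAnosov G K N Es Eu) (n : ℕ) (z : ℂ) : K^[n] (G^[n] z) = z :=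
  Function.LeftInverse.iterate h.left_inv n z

lemma fderiv_iterate_left_inv (h : PlaneAnosov G K N Es Eu) (n : ℕ) (z v : ℂ) :
    fderiv ℝ K^[n] (G^[n] z) (fderiv ℝ G^[n] z v) = v := by
  have h1 := fderiv_comp z (h.symm.differentiable_iterate n (G^[n] z)) (h.differentiable_iterate n z)
  have h2 : K^[n] ∘ G^[n] = id := funext (h.iterate_left_inv n)
  rw [h2, fderiv_id] at h1
  exact (congrArg (fun L : ℂ →L[ℝ] ℂ => L v) h1).symm

lemma unstable_mem_iterate (h : PlaneAnosov G K N Es Eu) (n : ℕ) :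
    ∀ z, ∀ v ∈ Eu z, fderiv ℝ G^[n] z v ∈ Eu (G^[n] z) := by
  induction n with
  | zero => intro z v hv; simpa [fderiv_id] using hv
  | succ n ih =>
    intro z v hv
    rw [Function.iterate_succ, fderiv_comp z (h.differentiable_iterate n (G z))
      (h.contDiff.differentiable one_ne_zero z)]
    exact ih _ _ (h.unstable_mem z v hv)

/-- The stable bundle is characterised by boundedness, hence closed. -/
lemma isClosed_stable (h : PlaneAnosov G K N Es Eu) :
    IsClosed {p : ℂ × ℂ | p.2 ∈ Es p.1} := by
  obtain ⟨C, lam, hC, hl0, hl1, hs, hu⟩ := h.contract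
  have e : {p : ℂ × ℂ | p.2 ∈ Es p.1} = ⋂ n : ℕ, {p : ℂ × ℂ |
      N (G^[n] p.1) (fderiv ℝ G^[n] p.1 p.2) ≤ C * lam ^ n * N p.1 p.2} := by
    ext ⟨z, v⟩
    simp only [mem_ofPred_eq, mem_iInter]
    refine ⟨fun hv n => hs n z v hv, fun hv => ?_⟩
    obtain ⟨a, ha, b, hb, rfl⟩ := Submodule.mem_sup.1 (show v ∈ Es z ⊔ Eu z by
      rw [(h.isCompl z).sup_eq_top]; trivial)
    by_cases hb0 : b = 0
    · subst hb0; simpa using ha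
    exfalso
    have hbpos := h.norm_pos z b hb0
    -- The forward images of `b` stay bounded, since those of `a + b` and of `a` do. Returning from
    -- time `n` contracts `Eu` by `C * lam ^ n`, so `N z b` is arbitrarily small.
    have key : ∀ n : ℕ, N z b ≤ C * lam ^ n * (C * (N z (a + b) + N z a)) := by
      intro n
      have h1 := hu n _ _ (h.unstable_mem_iterate n z b hb)
      rw [h.fderiv_iterate_left_inv, h.iterate_left_inv] at h1
      refine h1.trans ?_
      have hln : lam ^ n ≤ 1 := pow_le_one₀ hl0.le hl1.le
      have e : fderiv ℝ G^[n] z b = fderiv ℝ G^[n] z (a + b) + (-1 : ℝ) • fderiv ℝ G^[n] z a := by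
        simp
      have h2 : N (G^[n] z) (fderiv ℝ G^[n] z b) ≤ C * (N z (a + b) + N z a) := by
        rw [e]
        refine (h.norm_add _ _ _).trans ?_
        rw [h.norm_smul, abs_neg, abs_one, one_mul]
        have h3 := hv n
        have h4 := hs n z a ha
        have h5 : C * lam ^ n * N z (a + b) ≤ C * 1 * N z (a + b) := by
          have := h.norm_nonneg z (a + b); gcongr
        have h6 : C * lam ^ n * N z a ≤ C * 1 * N z a := by
          have := h.norm_nonneg z a; gcongr
        linarith
      gcongr
    have hlim : Tendsto (fun n : ℕ => C * lam ^ n * (C * (N z (a + b) + N z a))) atTop (𝓝 0) := by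
      simpa using ((tendsto_pow_atTop_nhds_zero_of_lt_one hl0.le hl1).const_mul C).mul_const
        (C * (N z (a + b) + N z a))
    have := ge_of_tendsto hlim (Eventually.of_forall key)
    linarith
  rw [e]
  refine isClosed_iInter fun n => isClosed_le ?_ ?_
  · refine h.continuous_norm.comp (((h.contDiff_iterate n).continuous.comp continuous_fst).prodMk ?_)
    exact (((h.contDiff_iterate n).continuous_fderiv one_ne_zero).comp continuous_fst).clm_apply
      continuous_snd
  · exact continuous_const.mul h.continuous_norm

lemma isClosed_unstable (h : PlaneAnosov G K N Es Eu) :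
    IsClosed {p : ℂ × ℂ | p.2 ∈ Eu p.1} := h.symm.isClosed_stable

/-- The vectors of a closed family of subspaces that are everything: a closed condition. -/
lemma isClosed_eq_top {E : ℂ → Submodule ℝ ℂ} (hE : IsClosed {p : ℂ × ℂ | p.2 ∈ E p.1}) :
    IsClosed {z | E z = ⊤} := by
  have e : {z | E z = ⊤} = ⋂ v : ℂ, (fun z => (z, v)) ⁻¹' {p : ℂ × ℂ | p.2 ∈ E p.1} := by
    ext z
    simp [Submodule.eq_top_iff']
  rw [e]
  exact isClosed_iInter fun v => hE.preimage (by fun_prop)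

/-- A nonzero subspace contains a unit vector, and projection along the compact unit circle is a
closed map. -/
lemma isClosed_ne_bot {E : ℂ → Submodule ℝ ℂ} (hE : IsClosed {p : ℂ × ℂ | p.2 ∈ E p.1}) :
    IsClosed {z | E z ≠ ⊥} := by
  have e : {z | E z ≠ ⊥} = Prod.fst '' {p : ℂ × Metric.sphere (0:ℂ) 1 | (p.2 : ℂ) ∈ E p.1} := by
    ext z
    constructor
    · intro hz
      obtain ⟨v, hv, hv0⟩ := (Submodule.ne_bot_iff _).1 hz
      have hv1 := norm_ne_zero_iff.2 hv0
      exact ⟨(z, ⟨(‖v‖⁻¹ : ℝ) • v, by simp [hv1]⟩), (E z).smul_mem _ hv, rfl⟩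
    · rintro ⟨⟨z, v⟩, hv, rfl⟩
      exact (Submodule.ne_bot_iff _).2 ⟨v, hv, ne_zero_of_mem_unit_sphere v⟩
  rw [e]
  exact isClosedMap_fst_of_compactSpace _ (hE.preimage (f := fun p : ℂ × Metric.sphere (0:ℂ) 1 =>
    (p.1, (p.2 : ℂ))) (by fun_prop))

/-- The splitting of the plane is trivial or consists of lines. -/
lemma trichotomy (h : PlaneAnosov G K N Es Eu) :
    (∀ z, Es z = ⊤) ∨ (∀ z, Eu z = ⊤) ∨
      ∀ z, Module.finrank ℝ (Es z) = 1 ∧ Module.finrank ℝ (Eu z) = 1 := by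
  -- `Es z = ⊤` is a closed condition, and its negation `Eu z ≠ ⊥` is closed too; the plane is
  -- connected.
  have clopen : ∀ {G K : ℂ → ℂ} {Es Eu : ℂ → Submodule ℝ ℂ}, PlaneAnosov G K N Es Eu →
      (∀ z, Es z = ⊤) ∨ ∀ z, Es z ≠ ⊤ := by
    intro G K Es Eu h
    have e : {z | Es z = ⊤}ᶜ = {z | Eu z ≠ ⊥} := by
      ext z
      change ¬ (Es z = ⊤) ↔ ¬ (Eu z = ⊥)
      rw [not_iff_not]
      constructor
      · intro h1; have := (h.isCompl z).disjoint; rw [h1] at this; exact top_disjoint.1 this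
      · intro h1; have := (h.isCompl z).codisjoint; rw [h1] at this; exact codisjoint_bot.1 this
    have hcl : IsClopen {z | Es z = ⊤} := by
      refine ⟨isClosed_eq_top h.isClosed_stable, ?_⟩
      rw [← isClosed_compl_iff, e]
      exact isClosed_ne_bot h.isClosed_unstable
    rcases isClopen_iff.1 hcl with h1 | h1
    · right; intro z hz; exact (h1 ▸ (show z ∈ {z | Es z = ⊤} from hz) : z ∈ (∅ : Set ℂ))
    · left; intro z; exact (h1.symm ▸ trivial : z ∈ {z | Es z = ⊤})
  rcases clopen h with h1 | h1
  · exact Or.inl h1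
  rcases clopen h.symm with h2 | h2
  · exact Or.inr (Or.inl h2)
  refine Or.inr (Or.inr fun z => ?_)
  have hsum := Submodule.finrank_add_eq_of_isCompl (h.isCompl z)
  rw [Complex.finrank_real_complex] at hsum
  have a1 : Module.finrank ℝ (Es z) ≠ 2 := fun h3 => h1 z
    (Submodule.eq_top_of_finrank_eq (by rw [h3, Complex.finrank_real_complex]))
  have a2 : Module.finrank ℝ (Eu z) ≠ 2 := fun h3 => h2 z
    (Submodule.eq_top_of_finrank_eq (by rw [h3, Complex.finrank_real_complex]))
  omega

end PlaneAnosov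

/-! ### Angles of continuous line fields. -/

/-- `θ` is an angle of the line field `E`. -/
def IsLineAngle (E : ℂ → Submodule ℝ ℂ) (θ : ℂ → ℝ) : Prop :=
  ∀ z, Complex.exp (θ z * Complex.I) ∈ E z ∧
    ∀ v ∈ E z, ∃ r : ℝ, v = r * Complex.exp (θ z * Complex.I)

/-- A continuous line field of the plane has a continuous angle. -/
lemma exists_lineAngle {E : ℂ → Submodule ℝ ℂ} (hE : IsClosed {p : ℂ × ℂ | p.2 ∈ E p.1})
    (h1 : ∀ z, Module.finrank ℝ (E z) = 1) : ∃ θ : ℂ → ℝ, Continuous θ ∧ IsLineAngle E θ := by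
  have hu : ∀ z, ∃ u : ℂ, ‖u‖ = 1 ∧ u ∈ E z ∧ ∀ v ∈ E z, ∃ r : ℝ, v = r * u := by
    intro z
    obtain ⟨w, hw0, hw⟩ := finrank_eq_one_iff'.1 (h1 z)
    have hw1 : ‖(w : ℂ)‖ ≠ 0 := by simpa using hw0
    refine ⟨(‖(w : ℂ)‖⁻¹ : ℝ) • (w : ℂ), by simpa using inv_mul_cancel₀ hw1, (E z).smul_mem _ w.2, ?_⟩
    intro v hv
    obtain ⟨c, hc⟩ := hw ⟨v, hv⟩
    refine ⟨c * ‖(w : ℂ)‖, ?_⟩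
    have : c • (w : ℂ) = v := congrArg Subtype.val hc
    rw [← this]
    have : (‖(w : ℂ)‖ : ℂ) ≠ 0 := by exact_mod_cast hw1
    simp only [Complex.real_smul]
    push_cast
    field_simp
  choose u hu1 hu2 hu3 using hu
  have hunit : ∀ z v, ‖v‖ = 1 → v ∈ E z → v ^ 2 = u z ^ 2 := by
    intro z v hv1 hv
    obtain ⟨r, rfl⟩ := hu3 z v hv
    rw [norm_mul, hu1, mul_one, Complex.norm_real, Real.norm_eq_abs] at hv1
    have : r ^ 2 = 1 := by rw [← sq_abs, hv1, one_pow]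
    rw [mul_pow]
    have : (r : ℂ) ^ 2 = 1 := by exact_mod_cast this
    rw [this, one_mul]
  -- The unit vector of a line is defined up to sign, so its square is well defined. By compactness
  -- of the circle and closedness of `E`, every limit of `u` is a unit vector of the limiting line,
  -- so the square is continuous. Half an angle of the square is an angle of the line.
  have hD : Continuous fun z => u z ^ 2 := by
    rw [continuous_iff_ultrafilter]
    intro z g hg
    obtain ⟨v, hv1, hv⟩ := (isCompact_sphere (0:ℂ) 1).ultrafilter_le_nhds (g.map u) (by
      rw [le_principal_iff]
      exact Filter.mem_map.2 (Filter.univ_mem' fun z => by simp [hu1]))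
    have hv' : Tendsto u g (𝓝 v) := hv
    have hmem : v ∈ E z := by
      have : Tendsto (fun z => (z, u z)) g (𝓝 (z, v)) := (tendsto_id.mono_right hg).prodMk_nhds hv'
      exact hE.mem_of_tendsto this (Eventually.of_forall fun z => hu2 z)
    rw [← hunit z v (by simpa using hv1) hmem]
    exact hv'.pow 2
  obtain ⟨L, hLc, hL⟩ := exists_angle (S := univ) convex_univ hD.continuousOn (by
    intro z _ h0
    have := hu1 z
    rw [pow_eq_zero_iff two_ne_zero] at h0
    simp [h0] at this)
  refine ⟨fun z => L z / 2, (continuousOn_univ.1 hLc).div_const 2, fun z => ?_⟩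
  have h2 := hL z trivial
  rw [norm_pow, hu1, one_pow, Complex.ofReal_one, one_mul] at h2
  have h3 : u z ^ 2 = Complex.exp ((L z / 2 : ℝ) * Complex.I) ^ 2 := by
    rw [h2, ← Complex.exp_nat_mul]
    congr 1; push_cast; ring
  rcases sq_eq_sq_iff_eq_or_eq_neg.1 h3 with h4 | h4
  · rw [← h4]; exact ⟨hu2 z, hu3 z⟩
  · have h5 : Complex.exp ((L z / 2 : ℝ) * Complex.I) = -u z := by rw [h4, neg_neg]
    rw [h5]
    refine ⟨(E z).neg_mem (hu2 z), fun v hv => ?_⟩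
    obtain ⟨r, rfl⟩ := hu3 z v hv
    exact ⟨-r, by push_cast; ring⟩

/-- Angles of two complementary continuous line fields can be chosen so that their difference
stays between `0` and `π`. -/
lemma exists_lineAngles {E₁ E₂ : ℂ → Submodule ℝ ℂ} (hE₁ : IsClosed {p : ℂ × ℂ | p.2 ∈ E₁ p.1})
    (hE₂ : IsClosed {p : ℂ × ℂ | p.2 ∈ E₂ p.1})
    (h1 : ∀ z, Module.finrank ℝ (E₁ z) = 1) (h2 : ∀ z, Module.finrank ℝ (E₂ z) = 1)
    (h : ∀ z, IsCompl (E₁ z) (E₂ z)) : ∃ θ₁ θ₂ : ℂ → ℝ, Continuous θ₁ ∧ Continuous θ₂ ∧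
      IsLineAngle E₁ θ₁ ∧ IsLineAngle E₂ θ₂ ∧ ∀ z, θ₁ z < θ₂ z ∧ θ₂ z < θ₁ z + Real.pi := by
  obtain ⟨θ₁, c₁, a₁⟩ := exists_lineAngle hE₁ h1
  obtain ⟨φ, c₂, a₂⟩ := exists_lineAngle hE₂ h2
  have hπ := Real.pi_pos
  have hshift : ∀ (x : ℝ) (k : ℤ), Complex.exp (((x - k * Real.pi : ℝ) : ℂ) * Complex.I)
      = Complex.exp (x * Complex.I) ∨ Complex.exp (((x - k * Real.pi : ℝ) : ℂ) * Complex.I)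
      = -Complex.exp (x * Complex.I) := by
    intro x k
    apply sq_eq_sq_iff_eq_or_eq_neg.1
    rw [← Complex.exp_nat_mul, ← Complex.exp_nat_mul, Complex.exp_eq_exp_iff_exists_int]
    exact ⟨-k, by push_cast; ring⟩
  have hnot : ∀ z, ∀ k : ℤ, φ z - θ₁ z ≠ k * Real.pi := by
    intro z k hk
    have e : θ₁ z = φ z - k * Real.pi := by linarith
    have hmem : Complex.exp (θ₁ z * Complex.I) ∈ E₂ z := by
      rw [e]
      rcases hshift (φ z) k with h3 | h3 <;> rw [h3]
      · exact (a₂ z).1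
      · exact (E₂ z).neg_mem (a₂ z).1
    exact Complex.exp_ne_zero _ (Submodule.disjoint_def.1 (h z).disjoint _ (a₁ z).1 hmem)
  -- The difference of the two angles avoids the multiples of `π`, so it stays in the interval
  -- between consecutive multiples that contains its value at `0`.
  set k := ⌊(φ 0 - θ₁ 0) / Real.pi⌋ with hk
  have b1 : k * Real.pi ≤ φ 0 - θ₁ 0 := by
    have := Int.floor_le ((φ 0 - θ₁ 0) / Real.pi)
    rwa [le_div_iff₀ hπ] at this
  have b2 : φ 0 - θ₁ 0 < (k + 1) * Real.pi := by
    have := Int.lt_floor_add_one ((φ 0 - θ₁ 0) / Real.pi)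
    rwa [div_lt_iff₀ hπ] at this
  have hcont : Continuous fun z => φ z - θ₁ z := c₂.sub c₁
  refine ⟨θ₁, fun z => φ z - k * Real.pi, c₁, by fun_prop, a₁, fun z => ?_, fun z => ?_⟩
  · rcases hshift (φ z) k with h3 | h3 <;> rw [h3]
    · exact a₂ z
    · refine ⟨(E₂ z).neg_mem (a₂ z).1, fun v hv => ?_⟩
      obtain ⟨r, rfl⟩ := (a₂ z).2 v hv
      exact ⟨-r, by push_cast; ring⟩
  · constructor
    · by_contra hcon
      obtain ⟨w, hw⟩ := mem_range_of_exists_le_of_exists_ge hcont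
        ⟨z, (by linarith : φ z - θ₁ z ≤ k * Real.pi)⟩ ⟨0, b1⟩
      exact hnot w k hw
    · by_contra hcon
      obtain ⟨w, hw⟩ := mem_range_of_exists_le_of_exists_ge hcont
        ⟨0, b2.le⟩ ⟨z, (by linarith : (k + 1) * Real.pi ≤ φ z - θ₁ z)⟩
      exact hnot w (k + 1) (by push_cast; exact hw)

/-! ### Invariant curves and the points asymptotic to a fixed point. -/

/-- The image of a curve tangent to a line field under a map preserving the field. -/
lemma IsCurve.comp_map {E : ℂ → Submodule ℝ ℂ} {θ : ℂ → ℝ} (hθ : Continuous θ)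
    (hE : IsLineAngle E θ) {F : ℂ → ℂ} (hF : ContDiff ℝ 1 F)
    (hinj : ∀ z v, fderiv ℝ F z v = 0 → v = 0)
    (hmap : ∀ z, ∀ v ∈ E z, fderiv ℝ F z v ∈ E (F z)) {c : ℝ → ℂ} (hc : IsCurve θ c) :
    IsCurve θ (F ∘ c) := by
  have hcc := hc.continuous
  obtain ⟨h, hh, h0, hd⟩ := hc
  let w : ℝ → ℂ := fun t => fderiv ℝ F (c t) (Complex.exp (θ (c t) * Complex.I))
  have hw : Continuous w := ((hF.continuous_fderiv one_ne_zero).comp hcc).clm_apply (by fun_prop)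
  let ρ : ℝ → ℝ := fun t => (w t * Complex.exp ((-θ (F (c t)) : ℝ) * Complex.I)).re
  have hρ : Continuous ρ := by
    have := hF.continuous
    fun_prop
  have hwρ : ∀ t, w t = ρ t * Complex.exp (θ (F (c t)) * Complex.I) := by
    intro t
    obtain ⟨r, hr⟩ := (hE (F (c t))).2 _ (hmap (c t) _ (hE (c t)).1)
    have : ρ t = r := by
      change (w t * _).re = r
      rw [show w t = _ from hr, mul_assoc, ← Complex.exp_add, ← add_mul, ← Complex.ofReal_add]
      simp
    rw [this]; exact hr
  refine ⟨fun t => h t * ρ t, by fun_prop, fun t => mul_ne_zero (h0 t) fun h1 => ?_, fun t => ?_⟩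
  · have := hinj (c t) _ (show w t = 0 by rw [hwρ, h1]; simp)
    exact Complex.exp_ne_zero _ this
  · have h1 := ((hF.differentiable one_ne_zero (c t)).hasFDerivAt).comp_hasDerivAt t (hd t)
    convert! h1 using 1
    have h2 : fderiv ℝ F (c t) (h t * Complex.exp (θ (c t) * Complex.I)) = h t • w t := by
      rw [← Complex.real_smul, map_smul]
    rw [h2, hwρ, Complex.real_smul]
    simp [mul_assoc]

/-- A curve that starts near `P` and is short for the fibrewise norms stays near its starting
point. -/
lemma norm_sub_le_of_short {N : ℂ → ℂ → ℝ} {P : ℂ} {r δ ε κ T : ℝ} (hδ : 0 < δ)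
    (hN : ∀ z ∈ Metric.closedBall P r, ∀ v, δ * ‖v‖ ≤ N z v) {x x' : ℝ → ℂ}
    (hx : ∀ t, HasDerivAt x (x' t) t) (hshort : ∀ t ∈ Icc 0 T, N (x t) (x' t) ≤ ε)
    (hκ : ε < κ * δ) (hκ0 : 0 ≤ κ) (hr : ‖x 0 - P‖ + κ * T ≤ r) :
    ∀ t ∈ Icc 0 T, ‖x t - x 0‖ ≤ κ * t := by
  have hxc : Continuous x := continuous_iff_continuousAt.2 fun t => (hx t).continuousAt
  -- The lower bound on `N` is available only in the ball. At a time when the distance equals `κ *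
  -- t` the point is still in the ball, so its speed is below `κ` and the barrier is not crossed.
  refine image_norm_le_of_norm_deriv_right_lt_deriv_boundary (f := fun t => x t - x 0) (f' := x')
    (B := fun t => κ * t) (B' := fun _ => κ) (by fun_prop)
    (fun t _ => ((hx t).sub_const (x 0)).hasDerivWithinAt) (by simp)
    (fun t => by simpa using (hasDerivAt_id t).const_mul κ) ?_
  intro t ht heq
  have hmem : x t ∈ Metric.closedBall P r := by
    rw [mem_closedBall_iff_norm]
    have : κ * t ≤ κ * T := by have := ht.2.le; gcongr
    have h2 := norm_add_le (x t - x 0) (x 0 - P)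
    rw [sub_add_sub_cancel] at h2
    have heq' : ‖x t - x 0‖ = κ * t := heq
    linarith
  have h1 := (hN _ hmem (x' t)).trans (hshort t ⟨ht.1, ht.2.le⟩)
  have h2 : δ * ‖x' t‖ < δ * κ := by linarith
  exact lt_of_mul_lt_mul_left h2 hδ.le

namespace PlaneAnosov

variable {G K : ℂ → ℂ} {N : ℂ → ℂ → ℝ} {Es Eu : ℂ → Submodule ℝ ℂ}

lemma exists_norm_lower_bound (h : PlaneAnosov G K N Es Eu) (P : ℂ) :
    ∃ δ : ℝ, 0 < δ ∧ ∀ z ∈ Metric.closedBall P 1, ∀ v, δ * ‖v‖ ≤ N z v := by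
  obtain ⟨⟨z₀, v₀⟩, ⟨hz₀, hv₀⟩, hmin⟩ := ((isCompact_closedBall P 1).prod
    (isCompact_sphere (0:ℂ) 1)).exists_isMinOn ⟨(P, 1), by simp⟩ h.continuous_norm.continuousOn
  refine ⟨N z₀ v₀, h.norm_pos _ _ (ne_zero_of_mem_unit_sphere ⟨v₀, hv₀⟩), fun z hz v => ?_⟩
  rcases eq_or_ne v 0 with rfl | hv
  · simp [h.norm_zero]
  have hv1 := norm_pos_iff.2 hv
  have h1 : N z₀ v₀ ≤ N z ((‖v‖⁻¹ : ℝ) • v) :=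
    hmin (show (z, (‖v‖⁻¹ : ℝ) • v) ∈ _ from ⟨hz, by simp [hv1.ne']⟩)
  rw [h.norm_smul, abs_of_pos (by positivity)] at h1
  calc N z₀ v₀ * ‖v‖ ≤ ‖v‖⁻¹ * N z v * ‖v‖ := by gcongr
    _ = N z v := by field_simp

/-- Points joined by a curve tangent to the contracted bundle have asymptotic orbits. -/
lemma tendsto_iterate_of_tangent (h : PlaneAnosov G K N Es Eu) {c c' : ℝ → ℂ}
    (hc : ∀ t, HasDerivAt c (c' t) t) (hc' : Continuous c') (hmem : ∀ t, c' t ∈ Es (c t)) {P : ℂ}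
    (h0 : Tendsto (fun n => G^[n] (c 0)) atTop (𝓝 P)) :
    Tendsto (fun n => G^[n] (c 1)) atTop (𝓝 P) := by
  obtain ⟨C, lam, hC, hl0, hl1, hs, -⟩ := h.contract
  obtain ⟨δ, hδ, hN⟩ := h.exists_norm_lower_bound P
  have hcc : Continuous c := continuous_iff_continuousAt.2 fun t => (hc t).continuousAt
  obtain ⟨B, hB⟩ := (isCompact_Icc (a := (0:ℝ)) (b := 1)).bddAbove_image
    (h.continuous_norm.comp (hcc.prodMk hc')).continuousOn
  have hB' : ∀ t ∈ Icc (0:ℝ) 1, N (c t) (c' t) ≤ B := fun t ht => hB ⟨t, ht, rfl⟩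
  have hlim : Tendsto (fun n : ℕ => C * lam ^ n * B) atTop (𝓝 0) := by
    simpa using ((tendsto_pow_atTop_nhds_zero_of_lt_one hl0.le hl1).const_mul C).mul_const B
  rw [Metric.tendsto_atTop']
  intro ε hε
  -- The image of `c 0` is within `κ` of `P` and the image curve moves by at most `κ`. The bound `1
  -- / 2` keeps it in the unit ball, where `N` is controlled, and `ε / 2` gives the required
  -- accuracy.
  set κ := min (ε / 2) (1 / 2) with hκ
  have hκ0 : 0 < κ := by positivity
  have e1 := hlim.eventually (gt_mem_nhds (show 0 < κ * δ by positivity))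
  have e2 := h0.eventually (Metric.ball_mem_nhds P hκ0)
  have h1 : κ ≤ 1 / 2 := min_le_right _ _
  have h2 : κ ≤ ε / 2 := min_le_left _ _
  obtain ⟨n₀, hn₀⟩ := eventually_atTop.1 (e1.and e2)
  refine ⟨n₀, fun n hn => ?_⟩
  obtain ⟨a1, a2⟩ := hn₀ n hn.le
  rw [dist_eq_norm] at a2
  have := norm_sub_le_of_short (N := N) (P := P) (r := 1) (δ := δ) (ε := C * lam ^ n * B) (κ := κ)
    (T := 1) hδ hN (x := fun t => G^[n] (c t))
    (x' := fun t => fderiv ℝ G^[n] (c t) (c' t))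
    (fun t => (h.differentiable_iterate n (c t)).hasFDerivAt.comp_hasDerivAt t (hc t)) (by
      intro t ht
      refine (hs n _ _ (hmem t)).trans ?_
      have := hB' t ht
      gcongr) a1 hκ0.le (by linarith) 1 (by simp)
  have h3 := norm_add_le (G^[n] (c 1) - G^[n] (c 0)) (G^[n] (c 0) - P)
  rw [sub_add_sub_cancel] at h3
  rw [dist_eq_norm]
  linarith

lemma fderiv_ne_zero (h : PlaneAnosov G K N Es Eu) (z v : ℂ) (hv : fderiv ℝ G z v = 0) : v = 0 := by
  have := h.fderiv_iterate_left_inv 1 z v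
  simp only [Function.iterate_one] at this
  rw [hv, map_zero] at this
  exact this.symm

lemma isCurve_iterate (h : PlaneAnosov G K N Es Eu) {θ : ℂ → ℝ} (hθ : Continuous θ)
    (hE : IsLineAngle Eu θ) {c : ℝ → ℂ} (hc : IsCurve θ c) (n : ℕ) : IsCurve θ (G^[n] ∘ c) := by
  induction n with
  | zero => exact hc
  | succ n ih =>
    rw [Function.iterate_succ', Function.comp_assoc]
    exact ih.comp_map hθ hE h.contDiff h.fderiv_ne_zero h.unstable_mem

lemma tendsto_iterate_of_isCurve (h : PlaneAnosov G K N Es Eu) {θ : ℂ → ℝ} (hθ : Continuous θ)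
    (hE : IsLineAngle Es θ) {c : ℝ → ℂ} (hc : IsCurve θ c) {P : ℂ} (s t : ℝ)
    (h0 : Tendsto (fun n => G^[n] (c s)) atTop (𝓝 P)) :
    Tendsto (fun n => G^[n] (c t)) atTop (𝓝 P) := by
  rcases eq_or_ne s t with rfl | hst
  · exact h0
  have h1 := hc.comp_affine s (sub_ne_zero.2 hst.symm)
  have h1c := h1.continuous
  obtain ⟨g, hg, -, hd⟩ := h1
  have := h.tendsto_iterate_of_tangent hd ((Complex.continuous_ofReal.comp hg).mul
    (Complex.continuous_exp.comp ((Complex.continuous_ofReal.comp (hθ.comp h1c)).mul_const _))) (fun u => by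
    rw [← Complex.real_smul]; exact Submodule.smul_mem _ _ (hE _).1) (P := P) (by simpa using h0)
  simpa using this

/-- Contraction yields `|μ| ^ n ≤ C * lam ^ n`. As `C` may exceed `1`, all iterates are needed, not
just the first. -/
lemma abs_lt_one_of_eigenvector (h : PlaneAnosov G K N Es Eu) {P e : ℂ} (hP : G P = P)
    (he : e ∈ Es P) (he0 : e ≠ 0) {μ : ℝ} (hμ : fderiv ℝ G P e = μ * e) : |μ| < 1 := by
  obtain ⟨C, lam, hC, hl0, hl1, hs, -⟩ := h.contract
  have hit : ∀ n : ℕ, fderiv ℝ G^[n] P e = (μ ^ n : ℝ) • e := by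
    intro n
    have h1 := ((h.contDiff.differentiable one_ne_zero P).hasFDerivAt.iterate hP n).fderiv
    rw [h1]
    induction n with
    | zero => simp
    | succ n ih =>
      have h2 := ((h.contDiff.differentiable one_ne_zero P).hasFDerivAt.iterate hP n).fderiv
      rw [pow_succ, mul_apply_eq_comp, hμ, ← Complex.real_smul, map_smul, ih h2]
      rw [smul_smul, pow_succ, mul_comm]
  by_contra hcon
  rw [not_lt] at hcon
  have hpos := h.norm_pos P e he0
  have key : ∀ n : ℕ, N P e ≤ C * lam ^ n * N P e := by
    intro n
    have h1 := hs n P e he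
    rw [hit, h.norm_smul, Function.iterate_fixed hP, abs_pow] at h1
    have h2 : 1 ≤ |μ| ^ n := one_le_pow₀ hcon
    nlinarith
  have hlim : Tendsto (fun n : ℕ => C * lam ^ n * N P e) atTop (𝓝 0) := by
    simpa using ((tendsto_pow_atTop_nhds_zero_of_lt_one hl0.le hl1).const_mul C).mul_const (N P e)
  linarith [ge_of_tendsto hlim (Eventually.of_forall key)]

/-- Two points whose forward orbits remain near a fixed point agree as soon as their difference
points in the expanded direction. -/
lemma exists_nhds_unique (h : PlaneAnosov G K N Es Eu) {θs θu : ℂ → ℝ} (hs : IsLineAngle Es θs)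
    (hu : IsLineAngle Eu θu) {P : ℂ} (hsin : Real.sin (θs P - θu P) ≠ 0) (hP : G P = P) :
    ∃ V ∈ 𝓝 P, ∀ x y, (∀ n, G^[n] x ∈ V) → (∀ n, G^[n] y ∈ V) →
      ((x - y) * Complex.exp ((-θu P : ℝ) * Complex.I)).im = 0 → x = y := by
  set S := Real.sin (θs P - θu P) with hS
  set es := Complex.exp (θs P * Complex.I) with hes
  set eu := Complex.exp (θu P * Complex.I) with heu
  set A := fderiv ℝ G P with hA
  have hSpos : 0 < |S| := abs_pos.2 hsin
  obtain ⟨μ, hμ⟩ := (hs P).2 _ (by simpa [hP] using h.stable_mem P _ (hs P).1)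
  obtain ⟨σ, hσ⟩ := (hu P).2 _ (by simpa [hP] using h.unstable_mem P _ (hu P).1)
  obtain ⟨σ', hσ'⟩ := (hu P).2 (fderiv ℝ K P eu) (by
    have hKP : K P = P := by conv_lhs => rw [← hP, h.left_inv]
    simpa [hKP] using h.unstable_mem_inv P _ (hu P).1)
  have hμ1 : |μ| < 1 := h.abs_lt_one_of_eigenvector hP (hs P).1 (Complex.exp_ne_zero _) hμ
  have hσ1 : 1 < |σ| := by
    have hKP : K P = P := by conv_lhs => rw [← hP, h.left_inv]
    have h1 := h.symm.abs_lt_one_of_eigenvector hKP (hu P).1 (Complex.exp_ne_zero _) hσ'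
    have h2 := h.fderiv_iterate_left_inv 1 P eu
    simp only [Function.iterate_one] at h2
    rw [hP, hσ, ← Complex.real_smul, map_smul, hσ', Complex.real_smul, ← mul_assoc] at h2
    have h3 : (σ : ℂ) * σ' = 1 := mul_right_cancel₀ (Complex.exp_ne_zero _)
      (h2.trans (one_mul _).symm)
    have h4 : σ * σ' = 1 := by exact_mod_cast h3
    have h5 : |σ| * |σ'| = 1 := by rw [← abs_mul, h4, abs_one]
    by_contra hcon
    rw [not_lt] at hcon
    nlinarith [abs_nonneg σ', abs_nonneg σ]
  -- coordinates along the splitting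
  let fa : ℂ → ℝ := fun v => (v * Complex.exp ((-θu P : ℝ) * Complex.I)).im / S
  let fb : ℂ → ℝ := fun v => -(v * Complex.exp ((-θs P : ℝ) * Complex.I)).im / S
  have hfa_add : ∀ v w, fa (v + w) = fa v + fa w := by
    intro v w; simp only [fa, add_mul, Complex.add_im, add_div]
  have hfb_add : ∀ v w, fb (v + w) = fb v + fb w := by
    intro v w; simp only [fb, add_mul, Complex.add_im, neg_add, add_div]
  have hmul : ∀ x y : ℝ, Complex.exp (x * Complex.I) * Complex.exp ((-y : ℝ) * Complex.I)
      = Complex.exp ((x - y : ℝ) * Complex.I) := by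
    intro x y; rw [← Complex.exp_add, ← add_mul, ← Complex.ofReal_add, sub_eq_add_neg]
  have hcoord : ∀ r r' : ℝ, fa (r * es + r' * eu) = r ∧ fb (r * es + r' * eu) = r' := by
    intro r r'
    simp only [fa, fb, add_mul, mul_assoc, hes, heu, hmul, Complex.add_im, Complex.im_ofReal_mul,
      Complex.exp_ofReal_mul_I_im, sub_self, Real.sin_zero]
    rw [← neg_sub (θs P) (θu P), Real.sin_neg, ← hS]
    constructor <;> field_simp <;> ring
  have hdec : ∀ v, v = fa v * es + fb v * eu := by
    intro v
    obtain ⟨a, ha, b, hb, rfl⟩ := Submodule.mem_sup.1 (show v ∈ Es P ⊔ Eu P by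
      rw [(h.isCompl P).sup_eq_top]; trivial)
    obtain ⟨r, rfl⟩ := (hs P).2 a ha
    obtain ⟨r', rfl⟩ := (hu P).2 b hb
    rw [(hcoord r r').1, (hcoord r r').2]
  have hAv : ∀ v, fa (A v) = μ * fa v ∧ fb (A v) = σ * fb v := by
    intro v
    have e : A v = (μ * fa v : ℝ) * es + (σ * fb v : ℝ) * eu := by
      conv_lhs => rw [hdec v]
      rw [map_add, ← Complex.real_smul, ← Complex.real_smul, map_smul, map_smul, hμ, hσ]
      simp only [Complex.real_smul]; push_cast; ring
    rw [e]
    exact hcoord _ _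
  have hbd : ∀ v, |fa v| ≤ ‖v‖ / |S| ∧ |fb v| ≤ ‖v‖ / |S| := by
    intro v
    simp only [fa, fb, abs_div, abs_neg]
    constructor <;> gcongr <;> refine (Complex.abs_im_le_norm _).trans ?_ <;>
      rw [norm_mul, Complex.norm_exp_ofReal_mul_I, mul_one]
  have hnorm : ∀ v, ‖v‖ ≤ |fa v| + |fb v| := by
    intro v
    conv_lhs => rw [hdec v]
    refine (norm_add_le _ _).trans (le_of_eq ?_)
    simp [hes, heu, Complex.norm_exp_ofReal_mul_I]
  -- In the cone `|fa| ≤ |fb|` the nonlinear remainder has coordinates at most `2 η / |S|` times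
  -- `|fb|`. This leaves an expansion of at least `(|σ| + 1) / 2` and keeps the cone invariant.
  set η := |S| * min ((|σ| - 1) / 4) ((1 - |μ|) / 2) with hη
  have hη0 : 0 < η := mul_pos hSpos (lt_min (by linarith) (by linarith))
  have hη1 : 2 * (η / |S|) ≤ (|σ| - 1) / 2 := by
    have := min_le_left ((|σ| - 1) / 4) ((1 - |μ|) / 2)
    rw [hη, mul_div_cancel_left₀ _ hSpos.ne']; linarith
  have hη2 : 2 * (η / |S|) ≤ 1 - |μ| := by
    have := min_le_right ((|σ| - 1) / 4) ((1 - |μ|) / 2)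
    rw [hη, mul_div_cancel_left₀ _ hSpos.ne']; linarith
  have hstrict : HasStrictFDerivAt G A P := h.contDiff.contDiffAt.hasStrictFDerivAt one_ne_zero
  have ho := (hstrict.isLittleO).bound hη0
  rw [nhds_prod_eq] at ho
  obtain ⟨V₀, hV₀, hVsub⟩ := mem_prod_self_iff.1 ho
  refine ⟨V₀ ∩ Metric.ball P 1, inter_mem hV₀ (Metric.ball_mem_nhds _ one_pos), ?_⟩
  intro x y hx hy hxy
  -- Strict differentiability controls differences of two moving points. A difference in the cone
  -- stays there and grows while both points are in `V₀`. As `x - y` has `fa = 0` it starts in the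
  -- cone, and unbounded growth is excluded by the bounded neighbourhood.
  have step : ∀ u v, u ∈ V₀ → v ∈ V₀ → |fa (u - v)| ≤ |fb (u - v)| →
      |fa (G u - G v)| ≤ |fb (G u - G v)| ∧
        (|σ| + 1) / 2 * |fb (u - v)| ≤ |fb (G u - G v)| := by
    intro u v hu hv hcone
    have h1 : ‖G u - G v - A (u - v)‖ ≤ η * ‖u - v‖ := hVsub (show (u, v) ∈ V₀ ×ˢ V₀ from ⟨hu, hv⟩)
    set R := G u - G v - A (u - v) with hR
    have h2 : G u - G v = A (u - v) + R := by rw [hR]; ring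
    have h3 : ‖R‖ / |S| ≤ 2 * (η / |S|) * |fb (u - v)| := by
      have : ‖R‖ ≤ η * (2 * |fb (u - v)|) := by
        refine h1.trans ?_
        have := hnorm (u - v)
        gcongr
        linarith
      calc ‖R‖ / |S| ≤ η * (2 * |fb (u - v)|) / |S| := by gcongr
        _ = _ := by ring
    have h4 : |fa (G u - G v)| ≤ |μ| * |fa (u - v)| + ‖R‖ / |S| := by
      rw [h2, hfa_add, (hAv _).1, ← abs_mul]
      exact (abs_add_le _ _).trans (by linarith [(hbd R).1])
    have h5 : |σ| * |fb (u - v)| - ‖R‖ / |S| ≤ |fb (G u - G v)| := by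
      rw [h2, hfb_add, (hAv _).2, ← abs_mul]
      have := abs_sub_abs_le_abs_sub (σ * fb (u - v)) (-fb R)
      rw [abs_neg, sub_neg_eq_add] at this
      linarith [(hbd R).2]
    have h6 := abs_nonneg (fb (u - v))
    have h7 : (|σ| + 1) / 2 * |fb (u - v)| ≤ |fb (G u - G v)| := by nlinarith
    refine ⟨?_, h7⟩
    have h8 : |μ| * |fa (u - v)| ≤ |μ| * |fb (u - v)| := by gcongr
    nlinarith
  have iter : ∀ n : ℕ, |fa (G^[n] x - G^[n] y)| ≤ |fb (G^[n] x - G^[n] y)| ∧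
      ((|σ| + 1) / 2) ^ n * |fb (x - y)| ≤ |fb (G^[n] x - G^[n] y)| := by
    intro n
    induction n with
    | zero =>
      have : fa (x - y) = 0 := by simp only [fa]; rw [hxy, zero_div]
      simp [this]
    | succ n ih =>
      rw [Function.iterate_succ_apply', Function.iterate_succ_apply']
      obtain ⟨h1, h2⟩ := step _ _ (hx n).1 (hy n).1 ih.1
      refine ⟨h1, le_trans ?_ h2⟩
      rw [pow_succ', mul_assoc]
      exact mul_le_mul_of_nonneg_left ih.2 (by positivity)
  have hb0 : fb (x - y) = 0 := by
    by_contra hne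
    have hpos := abs_pos.2 hne
    have htend := (tendsto_pow_atTop_atTop_of_one_lt (show 1 < (|σ| + 1) / 2 by linarith)).atTop_mul_const
      hpos
    obtain ⟨n, hn⟩ := (htend.eventually_gt_atTop (2 / |S|)).exists
    have h1 := (iter n).2
    have h2 := (hbd (G^[n] x - G^[n] y)).2
    have h3 : ‖G^[n] x - G^[n] y‖ ≤ 2 := by
      rw [← dist_eq_norm]
      have := dist_triangle_right (G^[n] x) (G^[n] y) P
      linarith [Metric.mem_ball.1 (hx n).2, Metric.mem_ball.1 (hy n).2]
    have h4 : ‖G^[n] x - G^[n] y‖ / |S| ≤ 2 / |S| := by gcongr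
    linarith
  have ha0 : fa (x - y) = 0 := by simp only [fa]; rw [hxy, zero_div]
  have := hdec (x - y)
  rw [ha0, hb0] at this
  simpa [sub_eq_zero] using this

/-- Two points asymptotic to the fixed point `P` lie on an injective arc tangent to the contracted
bundle. -/
lemma exists_curve_of_tendsto (h : PlaneAnosov G K N Es Eu) {θs θu : ℂ → ℝ} (hθs : Continuous θs)
    (hs : IsLineAngle Es θs) (hu : IsLineAngle Eu θu) {P : ℂ}
    (hsin : Real.sin (θs P - θu P) ≠ 0) (hP : G P = P) {x y : ℂ}
    (hx : Tendsto (fun n => G^[n] x) atTop (𝓝 P)) (hy : Tendsto (fun n => G^[n] y) atTop (𝓝 P)) :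
    ∃ c : ℝ → ℂ, IsCurve θs c ∧ ∃ t t', c t = x ∧ c t' = y ∧ InjOn c (uIcc t t') := by
  obtain ⟨V, hV, huniq⟩ := h.exists_nhds_unique hs hu hsin hP
  obtain ⟨ρ₀, hρ₀, hρV⟩ := Metric.mem_nhds_iff.1 hV
  -- This integral curve serves as local stable manifold. A late iterate of a point asymptotic to
  -- `P` is matched with the point of `c` having the same coordinate `f`. Their difference is along
  -- `Eu P`, so `exists_nhds_unique` identifies them; `K^[n]` then carries the curve back to `x` and
  -- `y`.
  obtain ⟨c, hc0, hc⟩ := exists_unit_curve hθs P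
  have hcc : Continuous c := (isCurve_of_unit hc).continuous
  obtain ⟨C, lam, hC, hl0, hl1, hcon, -⟩ := h.contract
  obtain ⟨δ, hδ, hN⟩ := h.exists_norm_lower_bound P
  -- the coordinate along the curve is monotone near `P`
  set S := Real.sin (θs P - θu P) with hS
  let f : ℂ → ℝ := fun v => S * (v * Complex.exp ((-θu P : ℝ) * Complex.I)).im
  have hfc : Continuous f := by fun_prop
  have hfd : ∀ t, HasDerivAt (fun t => f (c t)) (S * Real.sin (θs (c t) - θu P)) t := by
    intro t
    have h1 := (Complex.imCLM.hasFDerivAt.comp_hasDerivAt t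
      ((hc t).mul_const (Complex.exp ((-θu P : ℝ) * Complex.I)))).const_mul S
    convert! h1 using 1
    rw [← Complex.exp_add, ← add_mul, ← Complex.ofReal_add, ← sub_eq_add_neg]
    simp only [Complex.imCLM_apply, Complex.exp_ofReal_mul_I_im]
  have hev : ∀ᶠ t in 𝓝 (0:ℝ), 0 < S * Real.sin (θs (c t) - θu P) := by
    have hct : ContinuousAt (fun t => S * Real.sin (θs (c t) - θu P)) 0 := by fun_prop
    refine hct.eventually (lt_mem_nhds ?_)
    change 0 < S * Real.sin (θs (c 0) - θu P)
    rw [hc0, ← hS]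
    exact mul_self_pos.2 hsin
  obtain ⟨δ₁, hδ₁, hmono⟩ := Metric.eventually_nhds_iff.1 hev
  -- the whole forward orbit of a short arc stays in `V`
  obtain ⟨B, hB⟩ := (isCompact_Icc (a := (-1:ℝ)) (b := 1)).bddAbove_image
    (f := fun t => N (c t) (Complex.exp (θs (c t) * Complex.I)))
    (h.continuous_norm.comp (f := fun t => (c t, Complex.exp (θs (c t) * Complex.I)))
      (by fun_prop)).continuousOn
  have hB' : ∀ t ∈ Icc (-1:ℝ) 1, N (c t) (Complex.exp (θs (c t) * Complex.I)) ≤ B :=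
    fun t ht => hB ⟨t, ht, rfl⟩
  have hB0 : 0 ≤ B := (h.norm_nonneg _ _).trans (hB' 0 (by simp))
  -- `C * B / δ` bounds the Euclidean speed of every iterate of the arc near `P`, and the added `1`
  -- makes the comparison strict. `T` keeps these iterates in the unit ball and in `V`, and `f`
  -- monotone on the arc.
  set κ := C * B / δ + 1 with hκ
  have hκ0 : 0 < κ := by positivity
  set T := min (min 1 (δ₁ / 2)) (min (1 / κ) (ρ₀ / (2 * κ))) with hT
  have hT0 : 0 < T := by positivity
  have hT1 : T ≤ 1 := (min_le_left _ _).trans (min_le_left _ _)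
  have hT2 : T < δ₁ := ((min_le_left _ _).trans (min_le_right _ _)).trans_lt (by linarith)
  have hT3 : κ * T ≤ 1 := by
    have : T ≤ 1 / κ := (min_le_right _ _).trans (min_le_left _ _)
    rw [le_div_iff₀ hκ0] at this; linarith
  have hT4 : κ * T < ρ₀ := by
    have : T ≤ ρ₀ / (2 * κ) := (min_le_right _ _).trans (min_le_right _ _)
    rw [le_div_iff₀ (by positivity)] at this; linarith
  have hGP : ∀ n, G^[n] P = P := fun n => Function.iterate_fixed hP n
  have horb : ∀ σ : ℝ, |σ| = 1 → ∀ n, ∀ t ∈ Icc 0 T, G^[n] (c (σ * t)) ∈ V := by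
    intro σ hσ n t ht
    have hd : ∀ t, HasDerivAt (fun t => G^[n] (c (σ * t)))
        (fderiv ℝ G^[n] (c (σ * t)) (σ • Complex.exp (θs (c (σ * t)) * Complex.I))) t := by
      intro t
      have h2 : HasDerivAt (fun u : ℝ => σ * u) σ t := by
        simpa using (hasDerivAt_id t).const_mul σ
      exact (h.differentiable_iterate n (c (σ * t))).hasFDerivAt.comp_hasDerivAt t
        ((hc (σ * t)).scomp t h2)
    have := norm_sub_le_of_short (N := N) (P := P) (r := 1) (δ := δ) (ε := C * B) (κ := κ) (T := T)
      hδ hN hd (by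
        intro t ht
        refine (hcon n _ _ (Submodule.smul_mem _ _ (hs _).1)).trans ?_
        rw [h.norm_smul, hσ, one_mul]
        have h1 : N (c (σ * t)) (Complex.exp (θs (c (σ * t)) * Complex.I)) ≤ B := by
          refine hB' _ (abs_le.1 ?_)
          rw [abs_mul, hσ, one_mul, abs_of_nonneg ht.1]
          exact ht.2.trans hT1
        have h2 : lam ^ n ≤ 1 := pow_le_one₀ hl0.le hl1.le
        have h3 := h.norm_nonneg (c (σ * t)) (Complex.exp (θs (c (σ * t)) * Complex.I))
        calc _ ≤ C * 1 * B := by gcongr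
          _ = C * B := by ring) (by rw [hκ, add_mul, div_mul_cancel₀ _ hδ.ne']; linarith) hκ0.le
      (by simp only [mul_zero, hc0, hGP, sub_self, _root_.norm_zero]; linarith) t ht
    apply hρV
    rw [mem_ball_iff_norm]
    simp only [mul_zero, hc0, hGP] at this
    have h3 : κ * t ≤ κ * T := by have := ht.2; gcongr
    linarith
  have horb' : ∀ n, ∀ t ∈ Icc (-T) T, G^[n] (c t) ∈ V := by
    intro n t ht
    rcases le_total 0 t with h0 | h0
    · simpa using horb 1 (by simp) n t ⟨h0, ht.2⟩
    · simpa using horb (-1) (by simp) n (-t) ⟨by linarith, by linarith [ht.1]⟩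
  have hSM : StrictMonoOn (fun t => f (c t)) (Icc (-T) T) := by
    refine strictMonoOn_of_deriv_pos (convex_Icc _ _) (hfc.comp hcc).continuousOn fun t ht => ?_
    rw [interior_Icc] at ht
    rw [(hfd t).deriv]
    refine hmono ?_
    rw [Real.dist_eq, sub_zero]
    exact (abs_lt.2 ht).trans hT2
  have hTm : (-T) ∈ Icc (-T) T := ⟨le_rfl, by linarith⟩
  have hTp : T ∈ Icc (-T) T := ⟨by linarith, le_rfl⟩
  have hT00 : (0:ℝ) ∈ Icc (-T) T := ⟨by linarith, hT0.le⟩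
  have hlo : f (c (-T)) < f P := by rw [← hc0]; exact hSM hTm hT00 (by linarith)
  have hhi : f P < f (c T) := by
    have := hSM hT00 hTp hT0
    simp only [hc0] at this; exact this
  have hfind : ∀ z, Tendsto (fun n => G^[n] z) atTop (𝓝 P) →
      ∀ᶠ n in atTop, ∃ t ∈ Icc (-T) T, c t = G^[n] z := by
    intro z hz
    have e1 := (hfc.tendsto P).comp hz
    have e2 := e1.eventually (Ioo_mem_nhds hlo hhi)
    obtain ⟨m, hm⟩ := eventually_atTop.1 (hz.eventually hV)
    filter_upwards [e2, eventually_ge_atTop m] with n hn hnm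
    obtain ⟨t, ht, hft⟩ := intermediate_value_Icc (show -T ≤ T by linarith)
      (hfc.comp hcc).continuousOn (Ioo_subset_Icc_self hn)
    refine ⟨t, ht, huniq _ _ (fun k => horb' k t ht) (fun k => ?_) ?_⟩
    · rw [← Function.iterate_add_apply]
      exact hm _ (by omega)
    · have h1 : f (c t) = f (G^[n] z) := hft
      have h2 : S * ((c t - G^[n] z) * Complex.exp ((-θu P : ℝ) * Complex.I)).im = 0 := by
        rw [sub_mul, Complex.sub_im, mul_sub]
        exact sub_eq_zero.2 h1
      exact (mul_eq_zero.1 h2).resolve_left hsin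
  obtain ⟨n, ⟨t, ht, htx⟩, t', ht', hty⟩ := ((hfind x hx).and (hfind y hy)).exists
  refine ⟨K^[n] ∘ c, h.symm.isCurve_iterate hθs hs (isCurve_of_unit hc) n, t, t', ?_, ?_, ?_⟩
  · rw [Function.comp_apply, htx, h.iterate_left_inv]
  · rw [Function.comp_apply, hty, h.iterate_left_inv]
  · intro a ha b hb hab
    have hsub : uIcc t t' ⊆ Icc (-T) T := (convex_Icc (-T) T).ordConnected.uIcc_subset ht ht'
    have h1 : c a = c b := by
      have := congrArg G^[n] hab
      simpa only [Function.comp_apply, h.symm.iterate_left_inv] using this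
    exact hSM.injOn (hsub ha) (hsub hb) (by simp only [h1])

/-! ### No heteroclinic points; fixed points of a map and of its translates. -/

lemma inv_fixed (h : PlaneAnosov G K N Es Eu) {P : ℂ} (hP : G P = P) : K P = P := by
  conv_lhs => rw [← hP, h.left_inv]

/-- A hyperbolic diffeomorphism of the plane has no heteroclinic points. -/
lemma eq_of_heteroclinic (h : PlaneAnosov G K N Es Eu) {θ₁ θ₂ : ℂ → ℝ} (hθ₁ : Continuous θ₁)
    (hθ₂ : Continuous θ₂) (h₁ : IsLineAngle Es θ₁) (h₂ : IsLineAngle Eu θ₂)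
    (hθ : ∀ z, θ₁ z < θ₂ z ∧ θ₂ z < θ₁ z + Real.pi) {P Q w : ℂ} (hP : G P = P) (hQ : G Q = Q)
    (hwP : Tendsto (fun n => G^[n] w) atTop (𝓝 P)) (hwQ : Tendsto (fun n => K^[n] w) atTop (𝓝 Q)) :
    P = Q := by
  have hsin : ∀ z, Real.sin (θ₂ z - θ₁ z) ≠ 0 := fun z =>
    (Real.sin_pos_of_pos_of_lt_pi (by linarith [(hθ z).1]) (by linarith [(hθ z).2])).ne'
  by_cases hw : G w = w
  · have e1 : (fun n => G^[n] w) = fun _ => w := funext fun n => Function.iterate_fixed hw n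
    have e2 : (fun n => K^[n] w) = fun _ => w :=
      funext fun n => Function.iterate_fixed (h.inv_fixed hw) n
    rw [e1] at hwP
    rw [e2] at hwQ
    exact (tendsto_nhds_unique hwP tendsto_const_nhds).trans
      (tendsto_nhds_unique tendsto_const_nhds hwQ)
  -- `w` and `G w` are distinct, both forward asymptotic to `P` and both backward asymptotic to `Q`.
  -- A stable arc and an unstable arc join them, and these form a bigon.
  exfalso
  have hGwP : Tendsto (fun n => G^[n] (G w)) atTop (𝓝 P) :=
    (tendsto_add_atTop_iff_nat (f := fun n => G^[n] w) 1).2 hwP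
  have hGwQ : Tendsto (fun n => K^[n] (G w)) atTop (𝓝 Q) := by
    rw [← tendsto_add_atTop_iff_nat 1]
    refine hwQ.congr fun n => ?_
    rw [Function.iterate_succ_apply, h.left_inv]
  obtain ⟨α, hα, s₀, s₁, hs₀, hs₁, hαi⟩ := h.exists_curve_of_tendsto hθ₁ h₁ h₂
    (by rw [← neg_sub, Real.sin_neg, neg_ne_zero]; exact hsin P) hP hwP hGwP
  obtain ⟨β, hβ, t₀, t₁, ht₀, ht₁, hβi⟩ := h.symm.exists_curve_of_tendsto hθ₂ h₂ h₁ (hsin Q)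
    (h.inv_fixed hQ) hwQ hGwQ
  exact no_bigon hθ₁ hθ₂ hθ hα hβ hαi hβi (hs₀.trans ht₀.symm) (hs₁.trans ht₁.symm)
    (by rw [hs₀, hs₁]; exact fun e => hw e.symm)

lemma map_add_natMul {G : ℂ → ℂ} {c : ℂ} (hc : ∀ z, G (z + c) = G z + c) (m : ℕ) (z : ℂ) :
    G (z + m * c) = G z + m * c := by
  induction m generalizing z with
  | zero => simp
  | succ m ih =>
    have : z + (m + 1 : ℕ) * c = (z + m * c) + c := by push_cast; ring
    rw [this, hc, ih]; push_cast; ring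

lemma iterate_add_const {G : ℂ → ℂ} {c : ℂ} (hc : ∀ z, G (z + c) = G z + c) (n : ℕ) (z : ℂ) :
    (fun z => G z + c)^[n] z = G^[n] z + n * c := by
  induction n with
  | zero => simp
  | succ n ih =>
    rw [Function.iterate_succ_apply', ih, Function.iterate_succ_apply', map_add_natMul hc]
    push_cast; ring

lemma inv_add_const (h : PlaneAnosov G K N Es Eu) {c : ℂ} (hc : ∀ z, G (z + c) = G z + c) (z : ℂ) :
    K (z + -c) = K z + -c := by
  have h1 := hc (K z + -c)
  rw [neg_add_cancel_right, h.right_inv] at h1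
  have h2 : z + -c = G (K z + -c) := by linear_combination h1
  rw [h2, h.left_inv]

/-- If every vector is contracted, fixed points of `G` and of its translates coincide. -/
lemma eq_of_stable_eq_top (h : PlaneAnosov G K N Es Eu) (htop : ∀ z, Es z = ⊤) {c : ℂ}
    (hc : ∀ z, G (z + c) = G z + c) {p q : ℂ} (hp : G p = p) (hq : G q + c = q) : q = p := by
  have hd : ∀ t : ℝ, HasDerivAt (fun t : ℝ => p + t * (q - p)) (q - p) t := by
    intro t
    simpa using ((Complex.ofRealCLM.hasDerivAt (x := t)).mul_const (q - p)).const_add p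
  -- The straight segment from `p` to `q` is tangent to the contracted bundle, so the orbit of `q`
  -- tends to `p`. But `G^[n] q = q - n * c`, so consecutive iterates differ by the constant `c`,
  -- which must be zero.
  have hlim := h.tendsto_iterate_of_tangent hd continuous_const
    (fun t => by rw [htop]; trivial) (P := p) (by
      simp [Function.iterate_fixed hp])
  simp only [Complex.ofReal_one, one_mul, add_sub_cancel] at hlim
  have hit : ∀ n : ℕ, G^[n] q + n * c = q := by
    intro n
    rw [← iterate_add_const hc]
    exact Function.iterate_fixed (f := fun z => G z + c) hq n
  have hdiff : Tendsto (fun n : ℕ => G^[n] q - G^[n + 1] q) atTop (𝓝 (p - p)) :=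
    hlim.sub ((tendsto_add_atTop_iff_nat 1).2 hlim)
  have e : (fun n : ℕ => G^[n] q - G^[n + 1] q) = fun _ => c := by
    funext n
    have h1 := hit n
    have h2 := hit (n + 1)
    push_cast at h2
    linear_combination h1 - h2
  rw [e, sub_self] at hdiff
  have hc0 : c = 0 := tendsto_nhds_unique tendsto_const_nhds hdiff
  have e2 : (fun n : ℕ => G^[n] q) = fun _ => q := by
    funext n
    have := hit n
    rwa [hc0, mul_zero, add_zero] at this
  rw [e2] at hlim
  exact tendsto_nhds_unique tendsto_const_nhds hlim

/-- Under `G` the point `z = γ t` is forward asymptotic to `p`, and `y = γ' t'` backward asymptotic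
to `p`. Under `H = G + c`, `z` is backward and `y` forward asymptotic to `q`. Because `H^n y = G^n y
+ n c` and `H^(-n) z = K^n z - n c`, both approach `q`, and a box at `q` gives a point on the stable
curve of the latter and the unstable curve of the former. Under `G` it is heteroclinic between `p +
n c` and `p - n c`, so `c ≠ 0` is impossible. -/
lemma eq_of_box {θ₁ θ₂ : ℂ → ℝ} (hθ₁ : Continuous θ₁)
    (hθ₂ : Continuous θ₂) (h₁ : IsLineAngle Es θ₁) (h₂ : IsLineAngle Eu θ₂)
    (hθ : ∀ z, θ₁ z < θ₂ z ∧ θ₂ z < θ₁ z + Real.pi) {c : ℂ} (hG : PlaneAnosov G K N Es Eu)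
    (hH : PlaneAnosov (fun z => G z + c) (fun z => K (z - c)) N Es Eu)
    (hc : ∀ z, G (z + c) = G z + c) {p q : ℂ} (hp : G p = p) (hq : G q + c = q)
    {γ δ γ' δ' : ℝ → ℂ} (hγ : IsCurve θ₁ γ) (hδ : IsCurve θ₂ δ) (hγ0 : γ 0 = p) (hδ0 : δ 0 = q)
    {t s : ℝ} (hts : γ t = δ s) (hγ' : IsCurve θ₁ γ') (hδ' : IsCurve θ₂ δ') (hγ0' : γ' 0 = q)
    (hδ0' : δ' 0 = p) {t' s' : ℝ} (hts' : γ' t' = δ' s') : q = p := by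
  have hKc := hG.inv_add_const hc
  have eJ : (fun z => K (z - c)) = fun z => K z + -c := by
    funext z; rw [sub_eq_add_neg, hKc]
  rw [eJ] at hH
  have hqJ : K q + -c = q := hH.inv_fixed hq
  -- orbits along the four sides of the box
  have zG : Tendsto (fun n => G^[n] (γ t)) atTop (𝓝 p) :=
    hG.tendsto_iterate_of_isCurve hθ₁ h₁ hγ 0 t (by simp [hγ0, Function.iterate_fixed hp])
  have zJ : Tendsto (fun n => (fun z => K z + -c)^[n] (γ t)) atTop (𝓝 q) := by
    rw [hts]
    exact hH.symm.tendsto_iterate_of_isCurve hθ₂ h₂ hδ 0 s (by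
      rw [hδ0]; simp [Function.iterate_fixed (f := fun z => K z + -c) hqJ])
  have yK : Tendsto (fun n => K^[n] (γ' t')) atTop (𝓝 p) := by
    rw [hts']
    exact hG.symm.tendsto_iterate_of_isCurve hθ₂ h₂ hδ' 0 s' (by
      simp [hδ0', Function.iterate_fixed (hG.inv_fixed hp)])
  have yH : Tendsto (fun n => (fun z => G z + c)^[n] (γ' t')) atTop (𝓝 q) :=
    hH.tendsto_iterate_of_isCurve hθ₁ h₁ hγ' 0 t' (by
      rw [hγ0']; simp [Function.iterate_fixed (f := fun z => G z + c) hq])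
  rcases eq_or_ne c 0 with rfl | hc0
  · simp only [add_zero] at hq yH
    exact hG.eq_of_heteroclinic hθ₁ hθ₂ h₁ h₂ hθ hq hp yH yK
  exfalso
  obtain ⟨V, hV, hbox⟩ := exists_box hθ₁ hθ₂ hθ q
  obtain ⟨n, ⟨hzV, hyV⟩, hn⟩ :=
    (((zJ.eventually hV).and (yH.eventually hV)).and (eventually_ge_atTop 1)).exists
  rw [iterate_add_const hKc] at hzV
  rw [iterate_add_const hc] at hyV
  obtain ⟨a, b, ha, hb, ha0, hb0, u, v, huv⟩ := hbox _ hzV _ hyV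
  have hGn : ∀ z, G (z + n * c) = G z + n * c := map_add_natMul hc n
  have hGn' : ∀ z, G (z + n * -c) = G z + n * -c := by
    intro z
    have := hGn (z + n * -c)
    rw [show z + n * -c + n * c = z by ring] at this
    rw [this]; ring
  have hKn : ∀ z, K (z + n * c) = K z + n * c := by
    intro z
    have := hG.inv_add_const hGn' z
    rwa [show -((n : ℂ) * -c) = n * c by ring] at this
  have hKn' : ∀ z, K (z + n * -c) = K z + n * -c := by
    intro z
    have := hG.inv_add_const hGn z
    rwa [show -((n : ℂ) * c) = n * -c by ring] at this
  have shift : ∀ {F : ℂ → ℂ} {d : ℂ}, (∀ z, F (z + d) = F z + d) → ∀ (m : ℕ) z,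
      F^[m] (z + d) = F^[m] z + d := by
    intro F d hF m
    induction m with
    | zero => intro z; rfl
    | succ m ih => intro z; rw [Function.iterate_succ_apply, hF, ih, Function.iterate_succ_apply]
  -- the base points have orbits asymptotic to translates of `p`
  have zlim : Tendsto (fun m => G^[m] (K^[n] (γ t) + n * -c)) atTop (𝓝 (p + n * -c)) := by
    simp only [shift hGn']
    refine Tendsto.add_const _ ?_
    rw [← tendsto_add_atTop_iff_nat n]
    refine zG.congr fun m => ?_
    rw [Function.iterate_add_apply, hG.symm.iterate_left_inv]
  have ylim : Tendsto (fun m => K^[m] (G^[n] (γ' t') + n * c)) atTop (𝓝 (p + n * c)) := by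
    simp only [shift hKn]
    refine Tendsto.add_const _ ?_
    rw [← tendsto_add_atTop_iff_nat n]
    refine yK.congr fun m => ?_
    rw [Function.iterate_add_apply, hG.iterate_left_inv]
  have w1 := hG.tendsto_iterate_of_isCurve hθ₁ h₁ ha 0 u (by rw [ha0]; exact zlim)
  have w2 := hG.symm.tendsto_iterate_of_isCurve hθ₂ h₂ hb 0 v (by rw [hb0]; exact ylim)
  rw [← huv] at w2
  have := hG.eq_of_heteroclinic hθ₁ hθ₂ h₁ h₂ hθ (by rw [hGn', hp]) (by rw [hGn, hp]) w1 w2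
  have h3 : (2 * n : ℂ) * c = 0 := by linear_combination -this
  have hn0 : (n : ℂ) ≠ 0 := by exact_mod_cast (by omega : n ≠ 0)
  simp [hn0, hc0] at h3

/-- Every point `p` has a neighbourhood `V` such that a hyperbolic diffeomorphism `G` fixing `p`
has no other point of `V` that is fixed up to a translation commuting with `G`. -/
lemma exists_nhds_eq_of_fixed (h : PlaneAnosov G K N Es Eu) (p : ℂ) :
    ∃ V ∈ 𝓝 p, ∀ (G K : ℂ → ℂ) (c q : ℂ), PlaneAnosov G K N Es Eu →
      PlaneAnosov (fun z => G z + c) (fun z => K (z - c)) N Es Eu →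
      (∀ z, G (z + c) = G z + c) → G p = p → q ∈ V → G q + c = q → q = p := by
  -- `V` depends on the splitting alone, because the iterate `G` to which it is applied is known
  -- only after `q` has been chosen in `V`.
  rcases h.trichotomy with htop | htop | hrank
  · exact ⟨univ, univ_mem, fun G K c q hG _ hc hp _ hq => hG.eq_of_stable_eq_top htop hc hp hq⟩
  · refine ⟨univ, univ_mem, fun G K c q hG hH hc hp _ hq => ?_⟩
    refine hG.symm.eq_of_stable_eq_top htop (hG.inv_add_const hc) (hG.inv_fixed hp) ?_
    have := hH.inv_fixed hq
    rwa [sub_eq_add_neg, hG.inv_add_const hc] at this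
  · obtain ⟨θ₁, θ₂, hθ₁, hθ₂, h₁, h₂, hθ⟩ := exists_lineAngles h.isClosed_stable
      h.isClosed_unstable (fun z => (hrank z).1) (fun z => (hrank z).2) h.isCompl
    obtain ⟨V, hV, hbox⟩ := exists_box hθ₁ hθ₂ hθ p
    refine ⟨V, hV, fun G K c q hG hH hc hp hqV hq => ?_⟩
    obtain ⟨γ, δ, hγ, hδ, hγ0, hδ0, t, s, hts⟩ := hbox p (mem_of_mem_nhds hV) q hqV
    obtain ⟨γ', δ', hγ', hδ', hγ0', hδ0', t', s', hts'⟩ := hbox q hqV p (mem_of_mem_nhds hV)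
    exact eq_of_box hθ₁ hθ₂ h₁ h₂ hθ hG hH hc hp hq hγ hδ hγ0 hδ0 hts hγ' hδ' hγ0' hδ0' hts'

end PlaneAnosov

/-! ### The covering of the cylinder and the pullback of the hyperbolic structure. -/

lemma Bundle.ContinuousRiemannianMetric.continuous_inner_apply {B : Type*} [TopologicalSpace B]
    {F : Type*} [NormedAddCommGroup F] [NormedSpace ℝ F] {E : B → Type*}
    [TopologicalSpace (Bundle.TotalSpace F E)] [∀ b, TopologicalSpace (E b)]
    [∀ b, AddCommGroup (E b)] [∀ b, Module ℝ (E b)] [∀ b, IsTopologicalAddGroup (E b)]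
    [∀ b, ContinuousConstSMul ℝ (E b)] [FiberBundle F E] [VectorBundle ℝ F E]
    (g : Bundle.ContinuousRiemannianMetric F E) {X : Type*} [TopologicalSpace X] {b : X → B}
    {v w : ∀ x, E (b x)} (hv : Continuous fun x => (⟨b x, v x⟩ : Bundle.TotalSpace F E))
    (hw : Continuous fun x => (⟨b x, w x⟩ : Bundle.TotalSpace F E)) :
    Continuous fun x => g.inner (b x) (v x) (w x) := by
  rw [continuous_iff_continuousAt]
  intro x
  have hb : ContinuousAt b x := by
    have := hv.continuousAt (x := x)
    rw [FiberBundle.continuousAt_totalSpace] at this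
    exact this.1
  have h1 : ContinuousAt (fun m ↦ Bundle.TotalSpace.mk' ℝ (E := Bundle.Trivial B ℝ) (b m)
      (g.inner (b m) (v m) (w m))) x := by
    rw [← continuousWithinAt_univ]
    exact ((g.continuous.continuousAt (x := b x)).comp_continuousWithinAt
      hb.continuousWithinAt).clm_bundle_apply₂ (F₁ := F) (F₂ := F)
      hv.continuousAt.continuousWithinAt hw.continuousAt.continuousWithinAt
  rw [FiberBundle.continuousAt_totalSpace] at h1
  exact h1.2

/-- The model of the cylinder. -/
noncomputable abbrev cylModel :
    ModelWithCorners ℝ (EuclideanSpace ℝ (Fin 1) × ℝ) (ModelProd (EuclideanSpace ℝ (Fin 1)) ℝ) :=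
  (𝓡 1).prod 𝓘(ℝ, ℝ)

/-- The universal covering of the cylinder by the plane. -/
noncomputable def cylCover (z : ℂ) : Circle × ℝ := (Circle.exp z.re, z.im)

lemma contMDiff_cylCover : ContMDiff 𝓘(ℝ, ℂ) cylModel 1 cylCover :=
  (contMDiff_circleExp.comp Complex.reCLM.contDiff.contMDiff).prodMk
    Complex.imCLM.contDiff.contMDiff

lemma continuous_cylCover : Continuous cylCover := contMDiff_cylCover.continuous

lemma mdifferentiableAt_cylCover (z : ℂ) : MDifferentiableAt 𝓘(ℝ, ℂ) cylModel cylCover z :=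
  contMDiff_cylCover.mdifferentiable one_ne_zero z

/-- The embedding of the cylinder in `ℂ × ℝ`. -/
lemma contMDiff_cyl_coe : ContMDiff cylModel 𝓘(ℝ, ℂ × ℝ) 1
    (fun x : Circle × ℝ => ((x.1 : ℂ), x.2)) := by
  have : Fact (Module.finrank ℝ ℂ = 1 + 1) := ⟨Complex.finrank_real_complex⟩
  have h1 : ContMDiff cylModel 𝓘(ℝ, ℂ) 1 (fun x : Circle × ℝ => (x.1 : ℂ)) :=
    (contMDiff_coe_sphere (n := 1) (E := ℂ)).comp contMDiff_fst
  have h2 : ContMDiff cylModel 𝓘(ℝ, ℝ) 1 (fun x : Circle × ℝ => x.2) := contMDiff_snd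
  exact h1.prodMk_space h2

/-- After composition with the embedding in `ℂ × ℝ` the map is explicit and its derivative visibly
injective; no chart of the circle is needed. -/
lemma mfderiv_cylCover_injective (z : ℂ) :
    Function.Injective (mfderiv 𝓘(ℝ, ℂ) cylModel cylCover z) := by
  have hcomp := mfderiv_comp z
    (contMDiff_cyl_coe.mdifferentiable one_ne_zero (cylCover z)) (mdifferentiableAt_cylCover z)
  have e : (fun x : Circle × ℝ => ((x.1 : ℂ), x.2)) ∘ cylCover
      = fun z : ℂ => (Complex.exp (z.re * Complex.I), z.im) := by
    funext z; simp [cylCover]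
  rw [e, mfderiv_eq_fderiv] at hcomp
  have hre : HasFDerivAt (fun z : ℂ => ((z.re : ℂ) * Complex.I))
      ((Complex.ofRealCLM.comp Complex.reCLM).smulRight Complex.I) z := by
    exact ((Complex.ofRealCLM.comp Complex.reCLM).smulRight Complex.I).hasFDerivAt (x := z)
  have hd : HasFDerivAt (fun z : ℂ => (Complex.exp (z.re * Complex.I), z.im))
      ((Complex.exp (z.re * Complex.I) • ((Complex.ofRealCLM.comp Complex.reCLM).smulRight
        Complex.I)).prod Complex.imCLM) z :=
    hre.cexp.prodMk Complex.imCLM.hasFDerivAt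
  rw [hd.fderiv] at hcomp
  rw [injective_iff_map_eq_zero]
  intro v hv
  have h1 := congrArg (fun L : ℂ →L[ℝ] ℂ × ℝ => L v) hcomp
  have h2 : ((Complex.exp (z.re * Complex.I) • ((Complex.ofRealCLM.comp Complex.reCLM).smulRight
        Complex.I)).prod Complex.imCLM) v = 0 := by
    refine h1.trans ?_
    change (mfderiv _ _ _ _) ((mfderiv _ _ _ _) v) = _
    rw [hv, map_zero]; rfl
  have h3 : Complex.exp (z.re * Complex.I) * ((v.re : ℂ) * Complex.I) = 0 := congrArg Prod.fst h2
  have h4 : v.im = 0 := congrArg Prod.snd h2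
  have h5 : v.re = 0 := by simpa [Complex.exp_ne_zero] using h3
  exact Complex.ext h5 h4

lemma finrank_cyl (x : Circle × ℝ) : Module.finrank ℝ (TangentSpace cylModel x) = 2 := by
  change Module.finrank ℝ (EuclideanSpace ℝ (Fin 1) × ℝ) = 2
  simp

lemma mfderiv_cylCover_bijective (z : ℂ) :
    Function.Bijective (mfderiv 𝓘(ℝ, ℂ) cylModel cylCover z) := by
  refine ⟨mfderiv_cylCover_injective z, ?_⟩
  have : FiniteDimensional ℝ (TangentSpace cylModel (cylCover z)) := by
    change FiniteDimensional ℝ (EuclideanSpace ℝ (Fin 1) × ℝ); infer_instance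
  have hf : FiniteDimensional ℝ (TangentSpace 𝓘(ℝ, ℂ) z) := by
    change FiniteDimensional ℝ ℂ; infer_instance
  refine (LinearMap.injective_iff_surjective_of_finrank_eq_finrank
    (f := (mfderiv 𝓘(ℝ, ℂ) cylModel cylCover z).toLinearMap) ?_).1 (mfderiv_cylCover_injective z)
  rw [finrank_cyl]
  exact Complex.finrank_real_complex

/-- The pullback to the plane of a norm on the tangent spaces of the cylinder. -/
noncomputable def liftNorm
    (g : Bundle.ContinuousRiemannianMetric (EuclideanSpace ℝ (Fin 1) × ℝ)
      (fun x : Circle × ℝ => TangentSpace cylModel x)) (z v : ℂ) : ℝ :=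
  riemannianLength g (mfderiv 𝓘(ℝ, ℂ) cylModel cylCover z v)

lemma continuous_liftNorm (g : Bundle.ContinuousRiemannianMetric (EuclideanSpace ℝ (Fin 1) × ℝ)
      (fun x : Circle × ℝ => TangentSpace cylModel x)) :
    Continuous fun p : ℂ × ℂ => liftNorm g p.1 p.2 := by
  have h1 : Continuous fun p : ℂ × ℂ =>
      (⟨cylCover p.1, mfderiv 𝓘(ℝ, ℂ) cylModel cylCover p.1 p.2⟩ : TangentBundle cylModel (Circle × ℝ)) :=
    (contMDiff_cylCover.continuous_tangentMap le_rfl).comp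
      (tangentBundleModelSpaceHomeomorph 𝓘(ℝ, ℂ)).symm.continuous
  exact Real.continuous_sqrt.comp (g.continuous_inner_apply h1 h1)

/-- The pullback to the plane of a field of subspaces of the tangent spaces of the cylinder. -/
noncomputable def liftField (E : ∀ x : Circle × ℝ, Submodule ℝ (TangentSpace cylModel x)) (z : ℂ) :
    Submodule ℝ ℂ :=
  (E (cylCover z)).comap (mfderiv 𝓘(ℝ, ℂ) cylModel cylCover z).toLinearMap

lemma isCompl_liftField {Es Eu : ∀ x : Circle × ℝ, Submodule ℝ (TangentSpace cylModel x)}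
    (h : ∀ x, IsCompl (Es x) (Eu x)) (z : ℂ) : IsCompl (liftField Es z) (liftField Eu z) := by
  let e : ℂ ≃ₗ[ℝ] TangentSpace cylModel (cylCover z) :=
    LinearEquiv.ofBijective (mfderiv 𝓘(ℝ, ℂ) cylModel cylCover z).toLinearMap
      (mfderiv_cylCover_bijective z)
  exact (Submodule.orderIsoMapComap e).symm.isCompl (h (cylCover z))

section RiemannianLength

variable {E : Type*} [NormedAddCommGroup E] [NormedSpace ℝ E]
  {H : Type*} [TopologicalSpace H] {I : ModelWithCorners ℝ E H}
  {M : Type*} [TopologicalSpace M] [ChartedSpace H M] [IsManifold I 1 M]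
  (g : Bundle.ContinuousRiemannianMetric E (fun x : M => TangentSpace I x)) {x : M}

lemma inner_self_nonneg_of_metric (v : TangentSpace I x) : 0 ≤ g.inner x v v := by
  rcases eq_or_ne v 0 with rfl | hv
  · simp
  · exact (g.pos x v hv).le

lemma riemannianLength_pos {v : TangentSpace I x} (hv : v ≠ 0) : 0 < riemannianLength g v :=
  Real.sqrt_pos.2 (g.pos x v hv)

lemma riemannianLength_smul (r : ℝ) (v : TangentSpace I x) :
    riemannianLength g (r • v) = |r| * riemannianLength g v := by
  have : g.inner x (r • v) (r • v) = r ^ 2 * g.inner x v v := by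
    rw [map_smul, map_smul, smul_apply, smul_eq_mul, smul_eq_mul]; ring
  rw [riemannianLength, this, Real.sqrt_mul (sq_nonneg r), Real.sqrt_sq_eq_abs]
  rfl

lemma riemannianLength_add_le (v w : TangentSpace I x) :
    riemannianLength g (v + w) ≤ riemannianLength g v + riemannianLength g w := by
  set a := g.inner x v v with ha
  set b := g.inner x w w with hb
  set c := g.inner x v w with hc
  have ha0 : 0 ≤ a := inner_self_nonneg_of_metric g v
  have hb0 : 0 ≤ b := inner_self_nonneg_of_metric g w
  have hquad : ∀ s t : ℝ, g.inner x (s • v + t • w) (s • v + t • w)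
      = s ^ 2 * a + 2 * (s * t) * c + t ^ 2 * b := by
    intro s t
    simp only [map_add, map_smul, add_apply, smul_apply,
      smul_eq_mul]
    rw [g.symm x w v, ← ha, ← hb, ← hc]; ring
  have hcs : c ^ 2 ≤ a * b := by
    have h1 := inner_self_nonneg_of_metric g (b • v + (-c) • w)
    rw [hquad] at h1
    rcases hb0.eq_or_lt with h0 | h0
    · have hw : w = 0 := by
        by_contra hw
        exact (g.pos x w hw).ne h0
      have : c = 0 := by rw [hc, hw, map_zero]
      rw [this, ← h0]; simp
    · have h2 : 0 ≤ b * (a * b - c ^ 2) := by linarith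
      linarith [nonneg_of_mul_nonneg_right h2 h0]
  have hsum : g.inner x (v + w) (v + w) = a + 2 * c + b := by
    have := hquad 1 1
    simpa using this
  rw [riemannianLength, riemannianLength, riemannianLength, hsum, ← ha, ← hb]
  have h1 : c ≤ √a * √b := by
    rw [← Real.sqrt_mul ha0]
    exact (le_abs_self c).trans (Real.abs_le_sqrt hcs)
  apply Real.sqrt_le_iff.2
  refine ⟨by positivity, ?_⟩
  nlinarith [Real.sq_sqrt ha0, Real.sq_sqrt hb0]

end RiemannianLength

lemma mfderiv_iterate_mem {f : Circle × ℝ → Circle × ℝ} (hf : MDifferentiable cylModel cylModel f)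
    {E : ∀ x : Circle × ℝ, Submodule ℝ (TangentSpace cylModel x)}
    (hE : ∀ x, ∀ v ∈ E x, mfderiv cylModel cylModel f x v ∈ E (f x)) (n : ℕ) :
    MDifferentiable cylModel cylModel f^[n] ∧
      ∀ x, ∀ v ∈ E x, mfderiv cylModel cylModel f^[n] x v ∈ E (f^[n] x) := by
  induction n with
  | zero =>
    refine ⟨mdifferentiable_id, fun x v hv => ?_⟩
    simp only [Function.iterate_zero]
    rw [mfderiv_id]
    exact hv
  | succ n ih =>
    rw [Function.iterate_succ]
    refine ⟨ih.1.comp hf, fun x v hv => ?_⟩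
    rw [mfderiv_comp x (ih.1 _) (hf x)]
    exact ih.2 _ _ (hE x v hv)

/-- The derivative of a lift of a map of the cylinder. -/
lemma mfderiv_lift_apply {A : ℂ → ℂ} {φ : Circle × ℝ → Circle × ℝ} (hA : Differentiable ℝ A)
    (hφ : MDifferentiable cylModel cylModel φ) (h : ∀ z, cylCover (A z) = φ (cylCover z)) (z v : ℂ) :
    (mfderiv 𝓘(ℝ, ℂ) cylModel cylCover (A z) (fderiv ℝ A z v) : EuclideanSpace ℝ (Fin 1) × ℝ)
      = mfderiv cylModel cylModel φ (cylCover z) (mfderiv 𝓘(ℝ, ℂ) cylModel cylCover z v) := by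
  have h1 := mfderiv_comp z (mdifferentiableAt_cylCover (A z)) (hA z).mdifferentiableAt
  have h2 := mfderiv_comp z (hφ (cylCover z)) (mdifferentiableAt_cylCover z)
  have e : cylCover ∘ A = φ ∘ cylCover := funext h
  rw [e, mfderiv_eq_fderiv] at h1
  have h3 := h1.symm.trans h2
  exact congrArg (fun L : ℂ →L[ℝ] EuclideanSpace ℝ (Fin 1) × ℝ => L v) h3

/-- All tangent spaces are by definition the model vector space, so vectors at points that are only
propositionally equal can be compared there. This handles `cylCover (A z) = φ (cylCover z)`. -/
lemma riemannianLength_congr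
    (g : Bundle.ContinuousRiemannianMetric (EuclideanSpace ℝ (Fin 1) × ℝ)
      (fun x : Circle × ℝ => TangentSpace cylModel x)) {x y : Circle × ℝ} (hxy : x = y)
    {v : TangentSpace cylModel x} {w : TangentSpace cylModel y}
    (hvw : (v : EuclideanSpace ℝ (Fin 1) × ℝ) = w) :
    riemannianLength g v = riemannianLength g w := by
  subst hxy; subst hvw; rfl

lemma mem_congr_of_eq {E : ∀ x : Circle × ℝ, Submodule ℝ (TangentSpace cylModel x)}
    {x y : Circle × ℝ} (hxy : x = y) {v : TangentSpace cylModel x} {w : TangentSpace cylModel y}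
    (hvw : (v : EuclideanSpace ℝ (Fin 1) × ℝ) = w) : v ∈ E x ↔ w ∈ E y := by
  subst hxy; subst hvw; rfl

lemma iterate_lift {A : ℂ → ℂ} {φ : Circle × ℝ → Circle × ℝ}
    (h : ∀ z, cylCover (A z) = φ (cylCover z)) (n : ℕ) (z : ℂ) :
    cylCover (A^[n] z) = φ^[n] (cylCover z) := by
  induction n generalizing z with
  | zero => rfl
  | succ n ih => rw [Function.iterate_succ_apply, ih, h, Function.iterate_succ_apply]

/-- A lift of an iterate of an Anosov diffeomorphism of the cylinder is hyperbolic. -/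
lemma planeAnosov_of_lift
    {f : (Circle × ℝ) ≃ₘ^1⟮cylModel, cylModel⟯ (Circle × ℝ)}
    (g : Bundle.ContinuousRiemannianMetric (EuclideanSpace ℝ (Fin 1) × ℝ)
      (fun x : Circle × ℝ => TangentSpace cylModel x))
    {Es Eu : ∀ x : Circle × ℝ, Submodule ℝ (TangentSpace cylModel x)} {C lam : ℝ} (hC : 0 < C)
    (hl0 : 0 < lam) (hl1 : lam < 1) (hcompl : ∀ x, IsCompl (Es x) (Eu x))
    (hEs : ∀ x, (Es x).map (mfderiv cylModel cylModel f x).toLinearMap = Es (f x))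
    (hEu : ∀ x, (Eu x).map (mfderiv cylModel cylModel f x).toLinearMap = Eu (f x))
    (hs : ∀ (n : ℕ) (x : Circle × ℝ), ∀ v ∈ Es x,
      riemannianLength g (mfderiv cylModel cylModel (f^[n]) x v)
        ≤ C * lam ^ n * riemannianLength g v)
    (hu : ∀ (n : ℕ) (x : Circle × ℝ), ∀ v ∈ Eu x,
      riemannianLength g (mfderiv cylModel cylModel (f.symm^[n]) x v)
        ≤ C * lam ^ n * riemannianLength g v)
    {k : ℕ} (hk : 0 < k) {G K : ℂ → ℂ} (hG : ContDiff ℝ 1 G) (hK : ContDiff ℝ 1 K)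
    (hKG : ∀ z, K (G z) = z) (hGK : ∀ z, G (K z) = z)
    (hGf : ∀ z, cylCover (G z) = f^[k] (cylCover z))
    (hKf : ∀ z, cylCover (K z) = f.symm^[k] (cylCover z)) :
    PlaneAnosov G K (liftNorm g) (liftField Es) (liftField Eu) := by
  have hfd : MDifferentiable cylModel cylModel f := f.contMDiff.mdifferentiable one_ne_zero
  have hfd' : MDifferentiable cylModel cylModel f.symm := f.symm.contMDiff.mdifferentiable one_ne_zero
  have fwd : ∀ {E : ∀ x : Circle × ℝ, Submodule ℝ (TangentSpace cylModel x)},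
      (∀ x, (E x).map (mfderiv cylModel cylModel f x).toLinearMap = E (f x)) →
      ∀ x, ∀ v ∈ E x, mfderiv cylModel cylModel f x v ∈ E (f x) := by
    intro E hE x v hv
    rw [← hE]
    exact Submodule.mem_map_of_mem hv
  have bwd : ∀ {E : ∀ x : Circle × ℝ, Submodule ℝ (TangentSpace cylModel x)},
      (∀ x, (E x).map (mfderiv cylModel cylModel f x).toLinearMap = E (f x)) →
      ∀ x, ∀ v ∈ E x, mfderiv cylModel cylModel f.symm x v ∈ E (f.symm x) := by
    intro E hE y
    obtain ⟨x, rfl⟩ : ∃ x, f x = y := f.surjective y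
    intro v hv
    rw [← hE] at hv
    obtain ⟨w, hw, rfl⟩ := hv
    refine (mem_congr_of_eq (f.symm_apply_apply x).symm ?_).1 hw
    have h1 := mfderiv_comp x (hfd' (f x)) (hfd x)
    have e : f.symm ∘ f = id := funext f.symm_apply_apply
    rw [e, mfderiv_id] at h1
    exact congrArg (fun L : (EuclideanSpace ℝ (Fin 1) × ℝ) →L[ℝ] EuclideanSpace ℝ (Fin 1) × ℝ => L w) h1
  have stay : ∀ {E : ∀ x : Circle × ℝ, Submodule ℝ (TangentSpace cylModel x)} {A : ℂ → ℂ}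
      {φ : Circle × ℝ → Circle × ℝ}, Differentiable ℝ A → MDifferentiable cylModel cylModel φ →
      (∀ z, cylCover (A z) = φ^[k] (cylCover z)) →
      (∀ x, ∀ v ∈ E x, mfderiv cylModel cylModel φ x v ∈ E (φ x)) →
      ∀ z, ∀ v ∈ liftField E z, fderiv ℝ A z v ∈ liftField E (A z) := by
    intro E A φ hA hφ hlift hE z v hv
    obtain ⟨h1, h2⟩ := mfderiv_iterate_mem hφ hE k
    exact (mem_congr_of_eq (hlift z) (mfderiv_lift_apply hA h1 hlift z v)).2 (h2 _ _ hv)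
  have contr : ∀ {E : ∀ x : Circle × ℝ, Submodule ℝ (TangentSpace cylModel x)} {A : ℂ → ℂ}
      {φ : Circle × ℝ → Circle × ℝ}, ContDiff ℝ 1 A → MDifferentiable cylModel cylModel φ →
      (∀ z, cylCover (A z) = φ^[k] (cylCover z)) →
      (∀ (n : ℕ) (x : Circle × ℝ), ∀ v ∈ E x,
        riemannianLength g (mfderiv cylModel cylModel (φ^[n]) x v)
          ≤ C * lam ^ n * riemannianLength g v) →
      ∀ (n : ℕ) z, ∀ v ∈ liftField E z,
        liftNorm g (A^[n] z) (fderiv ℝ A^[n] z v) ≤ C * (lam ^ k) ^ n * liftNorm g z v := by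
    intro E A φ hA hφ hlift hE n z v hv
    -- `A^[n]` covers `φ^[k * n]`, so the constant `C` is kept and the rate becomes `lam ^ k`.
    have hAn : Differentiable ℝ A^[n] := (hA.differentiable one_ne_zero).iterate n
    have hlift' : ∀ z, cylCover (A^[n] z) = φ^[k * n] (cylCover z) := by
      intro z
      rw [iterate_lift hlift, Function.iterate_mul]
    have hφ' : MDifferentiable cylModel cylModel φ^[k * n] :=
      (mfderiv_iterate_mem hφ (E := fun _ => ⊤) (fun _ _ _ => trivial) (k * n)).1
    rw [← pow_mul]
    refine le_of_eq_of_le ?_ (hE (k * n) _ _ hv)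
    exact riemannianLength_congr g (hlift' z) (mfderiv_lift_apply hAn hφ' hlift' z v)
  exact
    { left_inv := hKG
      right_inv := hGK
      contDiff := hG
      contDiff_inv := hK
      continuous_norm := continuous_liftNorm g
      norm_pos := fun z v hv => riemannianLength_pos g fun h0 => hv
        ((injective_iff_map_eq_zero _).1 (mfderiv_cylCover_injective z) v h0)
      norm_smul := fun z r v => by
        refine Eq.trans ?_ (riemannianLength_smul g r _)
        exact congrArg (riemannianLength g) (map_smul (mfderiv 𝓘(ℝ, ℂ) cylModel cylCover z) r v)
      norm_add := fun z v w => by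
        refine le_of_eq_of_le ?_ (riemannianLength_add_le g _ _)
        exact congrArg (riemannianLength g) (map_add (mfderiv 𝓘(ℝ, ℂ) cylModel cylCover z) v w)
      isCompl := isCompl_liftField hcompl
      stable_mem := stay (hG.differentiable one_ne_zero) hfd hGf (fwd hEs)
      unstable_mem := stay (hG.differentiable one_ne_zero) hfd hGf (fwd hEu)
      stable_mem_inv := stay (hK.differentiable one_ne_zero) hfd' hKf (bwd hEs)
      unstable_mem_inv := stay (hK.differentiable one_ne_zero) hfd' hKf (bwd hEu)
      contract := ⟨C, lam ^ k, hC, by positivity, pow_lt_one₀ hl0.le hl1 hk.ne',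
        contr hG hfd hGf hs, contr hK hfd' hKf hu⟩ }

/-! ### Lifts of maps of the cylinder and deck translations. -/

lemma cylCover_eq_iff {z w : ℂ} :
    cylCover z = cylCover w ↔ ∃ m : ℤ, z = w + m * (2 * Real.pi : ℝ) := by
  rw [cylCover, cylCover, Prod.mk.injEq, Circle.exp_eq_exp]
  constructor
  · rintro ⟨⟨m, hm⟩, him⟩
    exact ⟨m, Complex.ext (by simp [hm]) (by simp [him])⟩
  · rintro ⟨m, rfl⟩
    exact ⟨⟨m, by simp⟩, by simp⟩

lemma cylCover_add_int_mul (z : ℂ) (m : ℤ) :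
    cylCover (z + m * (2 * Real.pi : ℝ)) = cylCover z :=
  cylCover_eq_iff.2 ⟨m, rfl⟩

lemma cylCover_surjective : Function.Surjective cylCover := by
  rintro ⟨u, t⟩
  obtain ⟨s, rfl⟩ := Circle.exp_surjective u
  exact ⟨⟨s, t⟩, rfl⟩

lemma isOpenMap_cylCover : IsOpenMap cylCover :=
  (isLocalHomeomorph_circleExp.isOpenMap.prodMap IsOpenMap.id).comp
    Complex.equivRealProdCLM.toHomeomorph.isOpenMap

/-- Two lifts of the same map differ by a deck transformation. -/
lemma exists_eq_add_of_cylCover_eq {A B : ℂ → ℂ} (hA : Continuous A) (hB : Continuous B)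
    (h : ∀ z, cylCover (A z) = cylCover (B z)) :
    ∃ m : ℤ, ∀ z, A z = B z + m * (2 * Real.pi : ℝ) := by
  obtain ⟨m, hm⟩ := angle_unique (S := (univ : Set ℂ)) isPreconnected_univ
    (L₁ := fun z => (A z).re) (L₂ := fun z => (B z).re)
    (Complex.continuous_re.comp hA).continuousOn (Complex.continuous_re.comp hB).continuousOn
    (fun z _ => by
      have := congrArg (fun x : Circle × ℝ => (x.1 : ℂ)) (h z)
      simpa [cylCover] using this)
  refine ⟨m, fun z => Complex.ext ?_ ?_⟩
  · rw [hm z trivial]; simp; ring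
  · have : (A z).im = (B z).im := congrArg Prod.snd (h z)
    simp [this]

lemma exists_lift {φ : Circle × ℝ → Circle × ℝ} (hφ : Continuous φ) :
    ∃ F : ℂ → ℂ, Continuous F ∧ ∀ z, cylCover (F z) = φ (cylCover z) := by
  have hc : Continuous fun z => φ (cylCover z) := hφ.comp continuous_cylCover
  obtain ⟨e₀, he₀⟩ := Circle.exp_surjective (φ (cylCover 0)).1
  obtain ⟨r, -, hr⟩ := (Circle.isCoveringMap_exp.existsUnique_continuousMap_lifts
    (⟨fun z : ℂ => (φ (cylCover z)).1, continuous_fst.comp hc⟩ : C(ℂ, Circle)) 0 e₀ he₀).exists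
  refine ⟨fun z => Complex.equivRealProdCLM.symm (r z, (φ (cylCover z)).2), ?_, fun z => ?_⟩
  · exact Complex.equivRealProdCLM.symm.continuous.comp
      (r.continuous.prodMk (continuous_snd.comp hc))
  · exact Prod.ext (congrFun hr z) rfl

/-- The composite `exp (i Re F)` is `C^1`. Rotated so that its value at `z₀` is `1`, it has a smooth
logarithm nearby, whose imaginary part recovers `Re F` up to a constant. -/
lemma contDiff_lift {φ : Circle × ℝ → Circle × ℝ} (hφ : ContMDiff cylModel cylModel 1 φ)
    {F : ℂ → ℂ} (hF : Continuous F) (h : ∀ z, cylCover (F z) = φ (cylCover z)) :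
    ContDiff ℝ 1 F := by
  have hu : ContDiff ℝ 1 fun z => (((φ (cylCover z)).1 : ℂ), (φ (cylCover z)).2) :=
    contMDiff_iff_contDiff.1 (contMDiff_cyl_coe.comp (hφ.comp contMDiff_cylCover))
  have e1 : ∀ z, ((φ (cylCover z)).1 : ℂ) = Complex.exp ((F z).re * Complex.I) := by
    intro z; rw [← h z]; simp [cylCover]
  have e2 : ∀ z, (φ (cylCover z)).2 = (F z).im := by
    intro z; rw [← h z]; rfl
  simp only [e1, e2] at hu
  have hexp : ContDiff ℝ 1 fun z => Complex.exp ((F z).re * Complex.I) := hu.fst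
  have him : ContDiff ℝ 1 fun z => (F z).im := hu.snd
  have hre : ContDiff ℝ 1 fun z => (F z).re := by
    rw [contDiff_iff_contDiffAt]
    intro z₀
    have hlog : ContDiffAt ℝ 1 (fun z => Complex.log
        (Complex.exp ((F z).re * Complex.I) * Complex.exp (-((F z₀).re * Complex.I)))) z₀ := by
      refine ContDiffAt.comp (g := Complex.log) z₀ ?_ (hexp.contDiffAt.mul contDiffAt_const)
      refine (Complex.contDiffAt_log ?_).restrict_scalars ℝ
      rw [← Complex.exp_add, add_neg_cancel, Complex.exp_zero]
      exact Complex.one_mem_slitPlane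
    have hmain : ContDiffAt ℝ 1 (fun z => (F z₀).re + Complex.imCLM (Complex.log
        (Complex.exp ((F z).re * Complex.I) * Complex.exp (-((F z₀).re * Complex.I))))) z₀ :=
      contDiffAt_const.add (Complex.imCLM.contDiff.contDiffAt.comp z₀ hlog)
    refine hmain.congr_of_eventuallyEq ?_
    have hnear : ∀ᶠ z in 𝓝 z₀, |(F z).re - (F z₀).re| < Real.pi := by
      have : Continuous fun z => |(F z).re - (F z₀).re| := by fun_prop
      refine this.continuousAt.eventually (p := fun t => t < Real.pi) (gt_mem_nhds ?_)
      simp [Real.pi_pos]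
    filter_upwards [hnear] with z hz
    rw [abs_lt] at hz
    have e : (F z).re * Complex.I + -((F z₀).re * Complex.I)
        = (((F z).re - (F z₀).re : ℝ) : ℂ) * Complex.I := by push_cast; ring
    rw [← Complex.exp_add, e, Complex.log_exp] <;>
      simp only [Complex.mul_im, Complex.ofReal_re, Complex.I_im, Complex.ofReal_im, Complex.I_re,
        mul_one, mul_zero, add_zero, Complex.imCLM_apply]
    · ring
    · exact hz.1
    · exact hz.2.le
  have e : F = fun z => Complex.equivRealProdCLM.symm ((F z).re, (F z).im) := by
    funext z; exact (Complex.equivRealProdCLM.symm_apply_apply (F z)).symm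
  rw [e]
  exact Complex.equivRealProdCLM.symm.contDiff.comp (hre.prodMk him)

/-- A diffeomorphism of the cylinder lifts to a diffeomorphism of the plane. -/
lemma exists_lift_diffeomorph (f : (Circle × ℝ) ≃ₘ^1⟮cylModel, cylModel⟯ (Circle × ℝ)) :
    ∃ F F' : ℂ → ℂ, ContDiff ℝ 1 F ∧ ContDiff ℝ 1 F' ∧ (∀ z, F' (F z) = z) ∧
      (∀ z, F (F' z) = z) ∧ (∀ z, cylCover (F z) = f (cylCover z)) ∧
      ∀ z, cylCover (F' z) = f.symm (cylCover z) := by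
  obtain ⟨F, hF, hFf⟩ := exists_lift f.continuous
  obtain ⟨F₀, hF₀, hF₀f⟩ := exists_lift f.symm.continuous
  -- `F ∘ F₀` is a deck translation, and undoing it inside `F₀` gives a right inverse of `F`. `F₀ ∘
  -- F` is a deck translation as well, so `F` is injective and the inverse is two-sided.
  obtain ⟨m, hm⟩ := exists_eq_add_of_cylCover_eq (hF.comp hF₀) continuous_id (fun z => by
    rw [Function.comp_apply, hFf, hF₀f, f.apply_symm_apply, id])
  obtain ⟨n, hn⟩ := exists_eq_add_of_cylCover_eq (hF₀.comp hF) continuous_id (fun z => by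
    rw [Function.comp_apply, hF₀f, hFf, f.symm_apply_apply, id])
  simp only [Function.comp_apply, id] at hm hn
  have hF'f : ∀ z, cylCover (F₀ (z - m * (2 * Real.pi : ℝ))) = f.symm (cylCover z) := by
    intro z
    rw [hF₀f, ← cylCover_add_int_mul _ m, sub_add_cancel]
  have hF' : Continuous fun z => F₀ (z - m * (2 * Real.pi : ℝ)) := by fun_prop
  refine ⟨F, fun z => F₀ (z - m * (2 * Real.pi : ℝ)), contDiff_lift f.contMDiff hF hFf,
    contDiff_lift f.symm.contMDiff hF' hF'f, ?_, fun z => by rw [hm]; ring, hFf, hF'f⟩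
  have hinj : Function.Injective F := by
    intro z w hzw
    have h1 := hn z
    rw [hzw, hn w] at h1
    exact (add_right_cancel h1).symm
  intro z
  apply hinj
  rw [hm]; ring

/-- `m` is the degree of `φ` on the circle factor: `z ↦ F (z + 2π)` and `F` lift the same map, so
their difference is constant. -/
lemma map_add_int_mul_of_lift {φ : Circle × ℝ → Circle × ℝ} {F : ℂ → ℂ} (hF : Continuous F)
    (h : ∀ z, cylCover (F z) = φ (cylCover z)) :
    ∃ m : ℤ, ∀ z (j : ℤ), F (z + j * (2 * Real.pi : ℝ)) = F z + (m * j : ℤ) * (2 * Real.pi : ℝ) := by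
  obtain ⟨m, hm⟩ := exists_eq_add_of_cylCover_eq
    (A := fun z => F (z + (1 : ℤ) * (2 * Real.pi : ℝ))) (by fun_prop) hF
    (fun z => by rw [h, h, cylCover_add_int_mul])
  refine ⟨m, fun z j => ?_⟩
  induction j with
  | zero => simp
  | succ i ih =>
    have := hm (z + (i : ℤ) * (2 * Real.pi : ℝ))
    rw [ih] at this
    rw [show z + ((i + 1 : ℤ) : ℂ) * (2 * Real.pi : ℝ)
      = z + (i : ℤ) * (2 * Real.pi : ℝ) + (1 : ℤ) * (2 * Real.pi : ℝ) by push_cast; ring, this]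
    push_cast; ring
  | pred i ih =>
    have := hm (z + (-(i : ℤ) - 1 : ℤ) * (2 * Real.pi : ℝ))
    rw [show z + ((-(i : ℤ) - 1 : ℤ) : ℂ) * (2 * Real.pi : ℝ) + (1 : ℤ) * (2 * Real.pi : ℝ)
      = z + (-(i : ℤ) : ℤ) * (2 * Real.pi : ℝ) by push_cast; ring, ih] at this
    rw [← sub_eq_iff_eq_add] at this
    rw [← this]
    push_cast; ring

/-- Even iterates of a lift of a diffeomorphism commute with the deck transformations. -/
lemma iterate_lift_add_int_mul {φ φ' : Circle × ℝ → Circle × ℝ} {F F' : ℂ → ℂ}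
    (hF : Continuous F) (hF' : Continuous F') (hFφ : ∀ z, cylCover (F z) = φ (cylCover z))
    (hFφ' : ∀ z, cylCover (F' z) = φ' (cylCover z)) (hinv : ∀ z, F' (F z) = z)
    (n : ℕ) (z : ℂ) (j : ℤ) :
    F^[2 * n] (z + j * (2 * Real.pi : ℝ)) = F^[2 * n] z + j * (2 * Real.pi : ℝ) := by
  obtain ⟨m, hm⟩ := map_add_int_mul_of_lift hF hFφ
  obtain ⟨m', hm'⟩ := map_add_int_mul_of_lift hF' hFφ'
  have hpi : ((2 * Real.pi : ℝ) : ℂ) ≠ 0 := by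
    exact_mod_cast (mul_pos two_pos Real.pi_pos).ne'
  -- The degrees of `F` and of its inverse are integers with product `1`, so `m = ±1`; squaring
  -- removes a possible reversal of the circle.
  have hmm : m * m = 1 := by
    have h1 := hm' (F 0) (m * 1)
    rw [← hm, hinv, hinv, zero_add, zero_add] at h1
    have h2 : ((1 : ℤ) : ℂ) = ((m' * (m * 1) : ℤ) : ℂ) := mul_right_cancel₀ hpi h1
    have h3 : m * m' = 1 := by
      have := Int.cast_injective h2
      linear_combination -this
    rcases Int.eq_one_or_neg_one_of_mul_eq_one h3 with rfl | rfl <;> norm_num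
  have h2 : ∀ z (j : ℤ), F^[2] (z + j * (2 * Real.pi : ℝ)) = F^[2] z + j * (2 * Real.pi : ℝ) := by
    intro z j
    change F (F _) = F (F z) + _
    rw [hm, hm, ← mul_assoc, hmm, one_mul]
  rw [Function.iterate_mul]
  induction n with
  | zero => rfl
  | succ n ih => rw [Function.iterate_succ_apply', ih, h2, ← Function.iterate_succ_apply' F^[2]]

/-! ### Two nearby periodic points give a contradiction. -/

theorem lemma3p2
    (f : (Circle × ℝ) ≃ₘ^1⟮(𝓡 1).prod 𝓘(ℝ, ℝ), (𝓡 1).prod 𝓘(ℝ, ℝ)⟯ (Circle × ℝ))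
    (hf : IsAnosov f) :
    ¬ Dense (Function.periodicPts f) := by
  intro hdense
  obtain ⟨g, Es, Eu, C, lam, hC, hl0, hl1, hcompl, hEs, hEu, hs, hu⟩ := hf
  obtain ⟨F, F', hF, hF', hF'F, hFF', hFf, hF'f⟩ := exists_lift_diffeomorph f
  have key : ∀ {k : ℕ}, 0 < k → ∀ {G K : ℂ → ℂ}, ContDiff ℝ 1 G → ContDiff ℝ 1 K →
      (∀ z, K (G z) = z) → (∀ z, G (K z) = z) → (∀ z, cylCover (G z) = f^[k] (cylCover z)) →
      (∀ z, cylCover (K z) = f.symm^[k] (cylCover z)) →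
      PlaneAnosov G K (liftNorm g) (liftField Es) (liftField Eu) := fun hk _ _ =>
    planeAnosov_of_lift g hC hl0 hl1 hcompl hEs hEu hs hu hk
  obtain ⟨p, hp⟩ := cylCover_surjective.exists.1 hdense.nonempty
  obtain ⟨V, hV, hVeq⟩ :=
    (key one_pos hF hF' hF'F hFF' hFf hF'f).exists_nhds_eq_of_fixed p
  obtain ⟨q, ⟨hqV, hqp⟩, hq⟩ : ∃ q ∈ interior V ∩ {p}ᶜ, cylCover q ∈ Function.periodicPts f := by
    refine (hdense.preimage isOpenMap_cylCover).inter_open_nonempty _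
      (isOpen_interior.inter isOpen_compl_singleton) ?_
    have : (interior V ∩ {p}ᶜ) ∈ 𝓝[≠] p :=
      inter_mem (mem_nhdsWithin_of_mem_nhds (interior_mem_nhds.2 hV)) self_mem_nhdsWithin
    exact Filter.nonempty_of_mem this
  obtain ⟨kp, hkp, hpp⟩ := hp
  obtain ⟨kq, hkq, hqq⟩ := hq
  -- A common multiple of both periods, even so that `F^[k]` commutes with the deck translations.
  set k := 2 * (kp * kq) with hk
  have hk0 : 0 < k := by positivity
  have hpk : Function.IsPeriodicPt f k (cylCover p) := (hpp.mul_const kq).const_mul 2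
  have hqk : Function.IsPeriodicPt f k (cylCover q) := (hqq.const_mul kp).const_mul 2
  have hFk := iterate_lift hFf k
  have hF'k := iterate_lift hF'f k
  obtain ⟨a, ha⟩ := cylCover_eq_iff.1 ((hFk p).trans hpk)
  obtain ⟨b, hb⟩ := cylCover_eq_iff.1 ((hFk q).trans hqk)
  have hadd := iterate_lift_add_int_mul hF.continuous hF'.continuous hFf hF'f hF'F (kp * kq)
  rw [← hk] at hadd
  have translate : ∀ m : ℤ, PlaneAnosov (fun z => F^[k] z + m * (2 * Real.pi : ℝ))
      (fun z => F'^[k] (z - m * (2 * Real.pi : ℝ))) (liftNorm g) (liftField Es) (liftField Eu) := by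
    intro m
    refine key hk0 ?_ ?_ ?_ ?_ ?_ ?_
    · exact (contDiff_iterate hF k).add contDiff_const
    · exact (contDiff_iterate hF' k).comp (contDiff_id.sub contDiff_const)
    · intro z
      rw [add_sub_cancel_right]
      exact (Function.LeftInverse.iterate hF'F k) z
    · intro z
      rw [Function.LeftInverse.iterate hFF' k, sub_add_cancel]
    · intro z
      rw [cylCover_add_int_mul, hFk]
    · intro z
      rw [hF'k, ← cylCover_add_int_mul _ m, sub_add_cancel]
  have e : -(a : ℂ) * (2 * Real.pi : ℝ) = ((-a : ℤ) : ℂ) * (2 * Real.pi : ℝ) := by push_cast; ring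
  -- With `G = F^[k] - 2πa`, which fixes `p`, and `c = 2π (a - b)`, the map `G + c = F^[k] - 2πb`
  -- fixes `q`.
  refine hqp (hVeq _ _ (((a - b : ℤ) : ℂ) * (2 * Real.pi : ℝ)) q (translate (-a)) ?_ ?_ ?_
    (interior_subset hqV) ?_)
  · convert translate (-b) using 2
    · push_cast; ring
    · congr 1; push_cast; ring
  · intro z
    rw [hadd]; ring
  · rw [ha]; push_cast; ring
  · rw [hb]; push_cast; ring
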